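/- Let $d,n\ge 1$ be integers and let $D\subset\mathbb R^d$ be a bounded Lipschitz domain: a bounded, nonempty, connected open set for which there are $\delta\ge 0$ and $R>0$ such that for every $a\in\partial D$ there are orthonormal coordinates $(x,y)\in\mathbb R^{d-1}\times\mathbb R$ centered at $a$ and a $\delta$-Lipschitz function $A:\mathbb R^{d-1}\to\mathbb R$ with $D\cap W=\{(x,y)\in W: y>A(x)\}$, where $W=[-R/2,R/2]^d$ in these coordinates. Functions, kernels and polynomials are all real-valued or all complex-valued. Let $\Omega$ be homogeneous of degree $0$ and of class $C^{n+1}$ on $\mathbb R^d\setminus\{0\}$, with zero integral over the unit sphere. Put $K(x)=\Omega(x)/|x|^d$, $$Tf(y)=\lim_{\varepsilon\to 0+}\int_{|y-x|>\varepsilon} f(x)K(y-x)\,dx,\qquad T_Df=\chi_D\,T(\chi_Df).$$ Cubes are closed with edges parallel to the coordinate axes, $\ell(Q)$ is the side length of $Q$, and $\mathcal P_n$ is the space of polynomials on $\mathbb R^d$ of degree at most $n$. The Zygmund space $\mathcal Z_n(D)$ consists of the $f\in L^1_{loc}(D)$ for which $$\|f\|_{n,D}=\sup_{Q\subset D}\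 \inf_{P\in\mathcal P_n}\ \frac1{\ell(Q)^n}\,\frac1{|Q|}\int_Q|f-P|\,dx<\infty ,$$ and it is normed by $\|f\|_{n,D}+\|f\|_{L^1(D)}$. Then for every $f\in\mathcal Z_n(D)$ the principal value $T(\chi_Df)(y)$ exists for almost every $y\in D$, and $T_D$ is a bounded operator from $\mathcal Z_n(D)$ into itself if and only if the following two properties hold: (i) $T_D P\in\mathcal Z_n(D)$ for every $P\in\mathcal P_n$; (ii) there is a constant $C$ such that for every cube $Q\subset D$, with center $x_0$ and side length $\ell$, and every polynomial $P_{x_0}$ that is homogeneous of degree $n$ with respect to $x-x_0$, there is a polynomial $S_Q\in\mathcal P_n$ with $$\frac1{|Q|}\int_Q|T_DP_{x_0}-S_Q|\,dx\le C\,\|P_{x_0}\|_{L^\infty(D)}\,\frac{\ell^n}{\max\{1,\log(1/\ell)\}} .$$ -/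

import Mathlib

open MeasureTheory Filter Topology
open scoped ENNReal NNReal

noncomputable section

namespace ZygmundTP

/-- The closed cube with center `c`, side length `l` and edges parallel to the coordinate axes. -/
def cube {d : ℕ} (c : EuclideanSpace ℝ (Fin d)) (l : ℝ) : Set (EuclideanSpace ℝ (Fin d)) :=
  {x | ∀ i, |x i - c i| ≤ l / 2}

/-- Bounded `(δ, R)`-Lipschitz domains: a bounded, open, connected (nonempty) set such that around
every boundary point `a`, in the orthonormal coordinates `Φ (z - a)`, the part of `D` in the cube
with center `a` and side length `R` is the part of that cube above the graph of a `δ`-Lipschitz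
function `A` of `d - 1` variables; the vertical coordinate is the `j`-th one. -/
structure IsBoundedLipschitzDomainWith {d : ℕ} (δ : ℝ≥0) (R : ℝ)
    (D : Set (EuclideanSpace ℝ (Fin d))) : Prop where
  isOpen : IsOpen D
  isConnected : IsConnected D
  isBounded : Bornology.IsBounded D
  graph : ∀ a ∈ frontier D,
    ∃ (j : Fin d) (Φ : EuclideanSpace ℝ (Fin d) ≃ₗᵢ[ℝ] EuclideanSpace ℝ (Fin d))
      (A : EuclideanSpace ℝ {i : Fin d // i ≠ j} → ℝ),
      LipschitzWith δ A ∧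
      ∀ z, Φ (z - a) ∈ cube 0 R →
        (z ∈ D ↔ A (WithLp.toLp 2 fun i => Φ (z - a) i.1) < Φ (z - a) j)

/-- Bounded Lipschitz domains. -/
def IsBoundedLipschitzDomain {d : ℕ} (D : Set (EuclideanSpace ℝ (Fin d))) : Prop :=
  ∃ (δ : ℝ≥0) (R : ℝ), 0 < R ∧ IsBoundedLipschitzDomainWith δ R D

variable {𝕜 : Type*} [RCLike 𝕜] {d : ℕ}

/-- The function on `ℝ^d` given by a polynomial in `d` variables. -/
def polyFun (P : MvPolynomial (Fin d) 𝕜) (x : EuclideanSpace ℝ (Fin d)) : 𝕜 :=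
  MvPolynomial.eval (fun i => ((x i : ℝ) : 𝕜)) P

/-- `Ω` is homogeneous of degree `0`, of class `C^k` off the origin, and has zero integral on the
unit sphere with respect to the surface measure. -/
structure IsCZNumerator (k : ℕ) (Ω : EuclideanSpace ℝ (Fin d) → 𝕜) : Prop where
  homogeneous : ∀ t : ℝ, 0 < t → ∀ x, Ω (t • x) = Ω x
  contDiffOn : ContDiffOn ℝ k Ω {0}ᶜ
  integral_sphere : ∫ u : Metric.sphere (0 : EuclideanSpace ℝ (Fin d)) 1, Ω u
    ∂(volume : Measure (EuclideanSpace ℝ (Fin d))).toSphere = 0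

/-- The kernel `K(x) = Ω(x) / |x|^d`. -/
def czKernel (Ω : EuclideanSpace ℝ (Fin d) → 𝕜) (x : EuclideanSpace ℝ (Fin d)) : 𝕜 :=
  Ω x / ((‖x‖ ^ d : ℝ) : 𝕜)

/-- The truncated integral of `f(x) K(y - x)` over `|y - x| > ε`. -/
def czTrunc (Ω f : EuclideanSpace ℝ (Fin d) → 𝕜) (y : EuclideanSpace ℝ (Fin d)) (ε : ℝ) : 𝕜 :=
  ∫ x in {x | ε < ‖y - x‖}, f x * czKernel Ω (y - x)

/-- The principal value integral defining `T f (y)` exists. -/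
def PVExists (Ω f : EuclideanSpace ℝ (Fin d) → 𝕜) (y : EuclideanSpace ℝ (Fin d)) : Prop :=
  (∀ ε : ℝ, 0 < ε → IntegrableOn (fun x => f x * czKernel Ω (y - x)) {x | ε < ‖y - x‖}) ∧
    ∃ v : 𝕜, Tendsto (czTrunc Ω f y) (𝓝[>] 0) (𝓝 v)

/-- `T f (y)`, the principal value of the integral of `f(x) K(y - x)`
(meaningful where `PVExists Ω f y`). -/
def czOp (Ω f : EuclideanSpace ℝ (Fin d) → 𝕜) (y : EuclideanSpace ℝ (Fin d)) : 𝕜 :=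
  limUnder (𝓝[>] (0 : ℝ)) (czTrunc Ω f y)

/-- The restricted operator `T_D f = χ_D T (χ_D f)`. A function on `D` is represented by any
function on `ℝ^d`, of which only the values on `D` are used. -/
def restrictedCZ (Ω : EuclideanSpace ℝ (Fin d) → 𝕜) (D : Set (EuclideanSpace ℝ (Fin d)))
    (f : EuclideanSpace ℝ (Fin d) → 𝕜) : EuclideanSpace ℝ (Fin d) → 𝕜 :=
  D.indicator (czOp Ω (D.indicator f))

/-- The supremum, over the cubes `Q ⊆ D` of side length `l`, of the infimum over the polynomials
`P` of degree at most `n` of `l ^ (-n)` times the mean of `|f - P|` over `Q`. -/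
def zygmundSeminorm (n : ℕ) (D : Set (EuclideanSpace ℝ (Fin d)))
    (f : EuclideanSpace ℝ (Fin d) → 𝕜) : ℝ≥0∞ :=
  ⨆ (c : EuclideanSpace ℝ (Fin d)) (l : ℝ) (_ : 0 < l) (_ : cube c l ⊆ D),
    ⨅ (P : MvPolynomial (Fin d) 𝕜) (_ : P.totalDegree ≤ n),
      (⨍⁻ x in cube c l, ‖f x - polyFun P x‖ₑ ∂volume) / ENNReal.ofReal (l ^ n)

/-- Membership in the Zygmund space `Z_n(D)`. -/
def MemZygmund (n : ℕ) (D : Set (EuclideanSpace ℝ (Fin d)))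
    (f : EuclideanSpace ℝ (Fin d) → 𝕜) : Prop :=
  LocallyIntegrableOn f D ∧ zygmundSeminorm n D f < ∞

/-- The norm of `Z_n(D)`: the seminorm plus the norm of `L^1(D)`. -/
def zygmundNorm (n : ℕ) (D : Set (EuclideanSpace ℝ (Fin d)))
    (f : EuclideanSpace ℝ (Fin d) → 𝕜) : ℝ≥0∞ :=
  zygmundSeminorm n D f + ∫⁻ x in D, ‖f x‖ₑ

/-- `T_D` is bounded on `Z_n(D)`. -/
def IsBoundedOnZygmund (n : ℕ) (Ω : EuclideanSpace ℝ (Fin d) → 𝕜)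
    (D : Set (EuclideanSpace ℝ (Fin d))) : Prop :=
  ∃ C : ℝ≥0, ∀ f : EuclideanSpace ℝ (Fin d) → 𝕜, MemZygmund n D f →
    MemZygmund n D (restrictedCZ Ω D f) ∧
      zygmundNorm n D (restrictedCZ Ω D f) ≤ C * zygmundNorm n D f

end ZygmundTP

end

noncomputable section

namespace ZygmundTP

variable {𝕜 : Type*} [RCLike 𝕜] {d : ℕ}

/-! On a cube `Q` of side `l` let `P_Q` be a polynomial of degree at most `n` that is nearly optimal
for `f`. Two such polynomials, on cubes of comparable size `t` with a large intersection, differ by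
`O(t^n)` there, so their Taylor coefficients of order `k` at a nearby point differ by `O(t^(n-k))`.
Along cubes that grow geometrically inside a cone these differences form a geometric series if `k <
n`, and count the steps if `k = n` (`exists_chain_bound`). A Lipschitz domain has such cones at
every point, with locally constant axis (`exists_coneDomain`). Consequently the Taylor coefficients
of `P_Q` at the center of `Q` are bounded for order less than `n` and `O(log(1/l))` for order `n`
(`exists_center_coeff_bound`). The same chains show that `f` is bounded, that `f - P_Q` is `O(ρ^n (1
+ log(ρ/l)))` within distance `ρ ≥ l` of the center (`exists_growth_bound`), and that inside `Q` it
is Hölder continuous of order `1/2`, with a constant depending on the distance to the boundary of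
`Q` (`exists_holder_bound`).

The central estimate needs neither (i) nor (ii): on `Q`, `T_D(f - P_Q)` is within `O(l^n)`, in mean,
of a polynomial of degree at most `n` (`IsCZNumerator.exists_approx_sub`). Near a point, the
cancellation of the kernel and Hölder continuity give the principal value. Far from `Q`, the Taylor
expansion of the kernel to order `n` leaves a remainder that beats the growth of `f - P_Q`. So the
only question is how well `T_D P_Q` is approximated on `Q`.

Sufficiency: split `P_Q` into its part homogeneous of degree `n` about the center and a remainder
with bounded coefficients. Condition (i), applied to the finitely many monomials, controls the
remainder. The homogeneous part has size `O(max(1, log(1/l)))`, exactly the factor gained in (ii).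

Necessity: polynomials have zero seminorm, which gives (i). For (ii) the test function is `P(x - x₀)
log|x - x₀|`. Its norm is at most a constant times the supremum of `|P(x - x₀)|` over `D`, and on
the cube of side `l` about `x₀` it is approximated by `log l · P(x - x₀)`. Boundedness of `T_D`
together with the central estimate approximates `log l · T_D P`, and division by `log l` yields the
gain (`IsCZNumerator.exists_homogeneous_approx`). -/

/-- Euclidean space of dimension `d`. -/
abbrev Euc (d : ℕ) := EuclideanSpace ℝ (Fin d)

/-! ### Cubes: inclusions, norms and volume. -/

section Cube

theorem abs_apply_le_norm (x : Euc d) (i : Fin d) : |x i| ≤ ‖x‖ := by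
  simpa using PiLp.norm_apply_le x i

theorem norm_le_sum_abs (x : Euc d) : ‖x‖ ≤ ∑ i, |x i| := by
  conv_lhs => rw [← (EuclideanSpace.basisFun (Fin d) ℝ).sum_repr x]
  refine (norm_sum_le _ _).trans (Finset.sum_le_sum fun i _ => ?_)
  simp [norm_smul]

theorem norm_sub_le_of_mem_cube {c x : Euc d} {l : ℝ} (h : x ∈ cube c l) :
    ‖x - c‖ ≤ d * (l / 2) := by
  refine (norm_le_sum_abs _).trans ?_
  refine (Finset.sum_le_sum (g := fun _ => l / 2) fun i _ => ?_).trans (by simp)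
  simpa using h i

theorem mem_cube_of_norm_sub_le {c x : Euc d} {l : ℝ} (h : ‖x - c‖ ≤ l / 2) : x ∈ cube c l :=
  fun i => by simpa using (abs_apply_le_norm (x - c) i).trans h

theorem self_mem_cube (c : Euc d) {l : ℝ} (hl : 0 ≤ l) : c ∈ cube c l :=
  mem_cube_of_norm_sub_le (by simpa using by linarith)

theorem cube_subset_cube {c c' : Euc d} {l l' : ℝ} (h : ‖c - c'‖ + l / 2 ≤ l' / 2) :
    cube c l ⊆ cube c' l' := by
  intro x hx i
  have h1 : |c i - c' i| ≤ ‖c - c'‖ := by simpa using abs_apply_le_norm (c - c') i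
  have h2 := hx i
  have h3 : |x i - c' i| ≤ |x i - c i| + |c i - c' i| := abs_sub_le _ _ _
  linarith

theorem le_of_cube_subset (hd : 1 ≤ d) {c c' : Euc d} {l l' : ℝ} (hl : 0 ≤ l)
    (h : cube c l ⊆ cube c' l') : l ≤ l' := by
  set e : Euc d := EuclideanSpace.single ⟨0, hd⟩ 1 with he
  have hcr : ∀ a : ℝ, |a| ≤ l / 2 → |c ⟨0, hd⟩ + a - c' ⟨0, hd⟩| ≤ l' / 2 := by
    intro a ha
    have h1 : c + a • e ∈ cube c l := mem_cube_of_norm_sub_le (by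
      rw [add_sub_cancel_left, norm_smul, he]; simpa using ha)
    simpa [he] using h h1 ⟨0, hd⟩
  have h1 := (abs_le.1 (hcr (l / 2) (by rw [abs_of_nonneg (by positivity)]))).2
  have h2 := (abs_le.1 (hcr (-(l / 2)) (by rw [abs_neg, abs_of_nonneg (by positivity)]))).1
  linarith

theorem isClosed_cube (c : Euc d) (l : ℝ) : IsClosed (cube c l) := by
  have : cube c l = ⋂ i, {x : Euc d | |x i - c i| ≤ l / 2} := by ext; simp [cube]
  rw [this]
  exact isClosed_iInter fun i => isClosed_le (by fun_prop) continuous_const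

theorem measurableSet_cube (c : Euc d) (l : ℝ) : MeasurableSet (cube c l) :=
  (isClosed_cube c l).measurableSet

theorem isCompact_cube (c : Euc d) (l : ℝ) : IsCompact (cube c l) := by
  refine Metric.isCompact_of_isClosed_isBounded (isClosed_cube c l) ?_
  refine (Metric.isBounded_closedBall (x := c) (r := d * (l / 2))).subset fun x hx => ?_
  simpa [dist_eq_norm] using norm_sub_le_of_mem_cube hx

theorem volume_cube (c : Euc d) (l : ℝ) (hl : 0 ≤ l) :
    volume (cube c l) = ENNReal.ofReal (l ^ d) := by
  have h := (PiLp.volume_preserving_ofLp (Fin d)).measure_preimage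
    (s := Set.Icc (fun i => c i - l / 2) (fun i => c i + l / 2)) measurableSet_Icc.nullMeasurableSet
  have h2 : (WithLp.ofLp ⁻¹' (Set.Icc (fun i => c i - l / 2) (fun i => c i + l / 2)) :
      Set (Euc d)) = cube c l := by
    ext x
    simp only [Set.mem_preimage, Set.mem_Icc, Pi.le_def, cube, Set.mem_ofPred_eq, abs_le]
    constructor
    · rintro ⟨h1, h2⟩ i
      constructor <;> linarith [h1 i, h2 i]
    · intro h
      exact ⟨fun i => by linarith [(h i).1], fun i => by linarith [(h i).2]⟩
  rw [← h2, h, Real.volume_Icc_pi]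
  simp [ENNReal.ofReal_pow hl]

end Cube

/-! ### Polynomial functions, affine substitution and Taylor coefficients, interpolation. -/

section Poly

open MvPolynomial

@[simp] theorem polyFun_add (P Q : MvPolynomial (Fin d) 𝕜) (x : Euc d) :
    polyFun (P + Q) x = polyFun P x + polyFun Q x := by simp [polyFun]

@[simp] theorem polyFun_sub (P Q : MvPolynomial (Fin d) 𝕜) (x : Euc d) :
    polyFun (P - Q) x = polyFun P x - polyFun Q x := by simp [polyFun]

@[simp] theorem polyFun_mul (P Q : MvPolynomial (Fin d) 𝕜) (x : Euc d) :
    polyFun (P * Q) x = polyFun P x * polyFun Q x := by simp [polyFun]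

@[simp] theorem polyFun_C (a : 𝕜) (x : Euc d) : polyFun (C a) x = a := by simp [polyFun]

@[simp] theorem polyFun_zero (x : Euc d) : polyFun (0 : MvPolynomial (Fin d) 𝕜) x = 0 := by
  simp [polyFun]

@[simp] theorem polyFun_sum {ι : Type*} (s : Finset ι) (P : ι → MvPolynomial (Fin d) 𝕜)
    (x : Euc d) : polyFun (∑ i ∈ s, P i) x = ∑ i ∈ s, polyFun (P i) x := by simp [polyFun]

theorem continuous_polyFun (P : MvPolynomial (Fin d) 𝕜) : Continuous (polyFun P) := by
  have h : Continuous fun x : Euc d => fun i => ((x i : ℝ) : 𝕜) := by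
    refine continuous_pi fun i => ?_
    exact RCLike.continuous_ofReal.comp (by fun_prop)
  exact (MvPolynomial.continuous_eval P).comp h

theorem totalDegree_sub_le {n : ℕ} {P Q : MvPolynomial (Fin d) 𝕜} (hP : P.totalDegree ≤ n)
    (hQ : Q.totalDegree ≤ n) : (P - Q).totalDegree ≤ n :=
  (totalDegree_sub P Q).trans (max_le hP hQ)

theorem totalDegree_add_le {n : ℕ} {P Q : MvPolynomial (Fin d) 𝕜} (hP : P.totalDegree ≤ n)
    (hQ : Q.totalDegree ≤ n) : (P + Q).totalDegree ≤ n :=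
  (totalDegree_add P Q).trans (max_le hP hQ)

theorem totalDegree_C_mul_le {n : ℕ} (a : 𝕜) {P : MvPolynomial (Fin d) 𝕜}
    (hP : P.totalDegree ≤ n) : (C a * P).totalDegree ≤ n :=
  (totalDegree_mul _ _).trans (by simpa using hP)

/-- The polynomial `u ↦ P (z + l u)`. -/
def affineSub (z : Euc d) (l : ℝ) (P : MvPolynomial (Fin d) 𝕜) : MvPolynomial (Fin d) 𝕜 :=
  bind₁ (fun i => C ((z i : ℝ) : 𝕜) + C (l : 𝕜) * X i) P

@[simp] theorem polyFun_affineSub (z : Euc d) (l : ℝ) (P : MvPolynomial (Fin d) 𝕜) (u : Euc d) :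
    polyFun (affineSub z l P) u = polyFun P (z + l • u) := by
  simp only [polyFun, affineSub]
  refine (eval₂Hom_bind₁ (RingHom.id 𝕜) _ _ P).trans ?_
  change eval _ P = eval _ P
  congr 2
  funext i
  change eval _ _ = _
  simp

theorem totalDegree_affineSub_le (z : Euc d) (l : ℝ) (P : MvPolynomial (Fin d) 𝕜) :
    (affineSub z l P).totalDegree ≤ P.totalDegree := by
  rw [affineSub, bind₁, aeval_def, eval₂_eq']
  refine totalDegree_finsetSum_le fun s hs => ?_
  refine (totalDegree_mul _ _).trans ?_
  rw [algebraMap_eq, totalDegree_C, zero_add]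
  refine (totalDegree_finsetProd _ _).trans ?_
  refine le_trans ?_ (le_totalDegree hs)
  rw [Finsupp.sum_fintype _ _ (fun _ => rfl)]
  refine Finset.sum_le_sum fun i _ => (totalDegree_pow _ _).trans ?_
  refine (Nat.mul_le_mul_left _ ?_).trans (mul_one _).le
  refine (totalDegree_add _ _).trans (max_le (by simp) ?_)
  exact (totalDegree_mul _ _).trans (by simp)

theorem affineSub_sub (z : Euc d) (l : ℝ) (P Q : MvPolynomial (Fin d) 𝕜) :
    affineSub z l (P - Q) = affineSub z l P - affineSub z l Q := by simp [affineSub]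

theorem affineSub_zero_monomial (l : ℝ) (s : Fin d →₀ ℕ) (a : 𝕜) :
    affineSub 0 l (monomial s a) = C ((l : 𝕜) ^ s.degree) * monomial s a := by
  rw [affineSub, bind₁_monomial, monomial_eq]
  simp only [PiLp.zero_apply, RCLike.ofReal_zero, C_0, zero_add, mul_pow, Finset.prod_mul_distrib]
  rw [Finset.prod_pow_eq_pow_sum, Finsupp.degree_apply, C_pow, Finsupp.prod]
  ring

theorem coeff_affineSub_zero (l : ℝ) (P : MvPolynomial (Fin d) 𝕜) (s : Fin d →₀ ℕ) :
    coeff s (affineSub 0 l P) = (l : 𝕜) ^ s.degree * coeff s P := by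
  induction P using MvPolynomial.induction_on' with
  | monomial u a =>
    rw [affineSub_zero_monomial, coeff_C_mul, coeff_monomial]
    split_ifs with h
    · rw [h]
    · simp
  | add p q hp hq =>
    have : affineSub 0 l (p + q) = affineSub 0 l p + affineSub 0 l q := by simp [affineSub]
    rw [this, coeff_add, hp, hq, coeff_add]
    ring

theorem affineSub_affineSub_zero (z : Euc d) (l : ℝ) (P : MvPolynomial (Fin d) 𝕜) :
    affineSub 0 l (affineSub z 1 P) = affineSub z l P := by
  simp only [affineSub, bind₁_bind₁]
  congr 2
  funext i
  simp

/-- Dilations act diagonally on coefficients. Hence a bound for the polynomial rescaled from a cube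
of side `l` to unit size is a bound for the Taylor coefficients at `z`, up to powers of `l`. -/
theorem coeff_affineSub (z : Euc d) (l : ℝ) (P : MvPolynomial (Fin d) 𝕜) (s : Fin d →₀ ℕ) :
    coeff s (affineSub z l P) = (l : 𝕜) ^ s.degree * coeff s (affineSub z 1 P) := by
  rw [← affineSub_affineSub_zero, coeff_affineSub_zero]

/-- The multi-indices of order at most `n`. -/
def multiIdx (d n : ℕ) : Finset (Fin d →₀ ℕ) := (Finsupp.finite_of_degree_le (σ := Fin d) n).toFinset

@[simp] theorem mem_multiIdx {n : ℕ} {s : Fin d →₀ ℕ} : s ∈ multiIdx d n ↔ s.degree ≤ n := by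
  simp [multiIdx]

theorem coeff_eq_zero_of_lt {n : ℕ} {P : MvPolynomial (Fin d) 𝕜} (hP : P.totalDegree ≤ n)
    {s : Fin d →₀ ℕ} (hs : n < s.degree) : coeff s P = 0 := by
  refine coeff_eq_zero_of_totalDegree_lt (lt_of_le_of_lt hP ?_)
  simpa [Finsupp.degree_apply] using hs

theorem degree_le_of_coeff_ne_zero {n : ℕ} {P : MvPolynomial (Fin d) 𝕜} (hP : P.totalDegree ≤ n)
    {s : Fin d →₀ ℕ} (hs : coeff s P ≠ 0) : s.degree ≤ n := by
  by_contra h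
  exact hs (coeff_eq_zero_of_lt hP (not_le.1 h))

theorem polyFun_eq_sum {n : ℕ} {P : MvPolynomial (Fin d) 𝕜} (hP : P.totalDegree ≤ n) (x : Euc d) :
    polyFun P x = ∑ s ∈ multiIdx d n, coeff s P * ∏ i, ((x i : ℝ) : 𝕜) ^ s i := by
  rw [polyFun, eval_eq']
  refine Finset.sum_subset (fun s hs => ?_) fun s _ hs => ?_
  · exact mem_multiIdx.2 (degree_le_of_coeff_ne_zero hP (mem_support_iff.1 hs))
  · rw [notMem_support_iff.1 hs, zero_mul]

theorem norm_monomial_le (x : Euc d) (s : Fin d →₀ ℕ) :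
    ‖∏ i, ((x i : ℝ) : 𝕜) ^ s i‖ ≤ ‖x‖ ^ s.degree := by
  rw [norm_prod, Finsupp.degree_eq_sum, ← Finset.prod_pow_eq_pow_sum]
  refine Finset.prod_le_prod (fun i _ => norm_nonneg _) fun i _ => ?_
  rw [norm_pow, RCLike.norm_ofReal]
  exact pow_le_pow_left₀ (abs_nonneg _) (abs_apply_le_norm x i) _

theorem polyFun_affineSub_one_sub (z x : Euc d) (P : MvPolynomial (Fin d) 𝕜) :
    polyFun (affineSub z 1 P) (x - z) = polyFun P x := by simp

theorem norm_polyFun_le {n : ℕ} {P : MvPolynomial (Fin d) 𝕜} (hP : P.totalDegree ≤ n)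
    (z x : Euc d) : ‖polyFun P x‖ ≤
      ∑ s ∈ multiIdx d n, ‖coeff s (affineSub z 1 P)‖ * ‖x - z‖ ^ s.degree := by
  rw [← polyFun_affineSub_one_sub z x, polyFun_eq_sum ((totalDegree_affineSub_le _ _ _).trans hP)]
  refine (norm_sum_le _ _).trans (Finset.sum_le_sum fun s _ => ?_)
  rw [norm_mul]
  gcongr
  exact norm_monomial_le _ _

theorem polyFun_eq_coeff_zero (z : Euc d) (P : MvPolynomial (Fin d) 𝕜) :
    polyFun P z = coeff 0 (affineSub z 1 P) := by
  rw [← polyFun_affineSub_one_sub z z, sub_self, polyFun]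
  simp only [PiLp.zero_apply, RCLike.ofReal_zero]
  rw [← constantCoeff_eq, ← MvPolynomial.eval_zero]
  rfl

theorem norm_polyFun_sub_le {n : ℕ} {P : MvPolynomial (Fin d) 𝕜} (hP : P.totalDegree ≤ n)
    (z x : Euc d) : ‖polyFun P x - polyFun P z‖ ≤
      ∑ s ∈ (multiIdx d n).erase 0, ‖coeff s (affineSub z 1 P)‖ * ‖x - z‖ ^ s.degree := by
  rw [polyFun_eq_coeff_zero z, ← polyFun_affineSub_one_sub z x,
    polyFun_eq_sum ((totalDegree_affineSub_le _ _ _).trans hP),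
    ← Finset.add_sum_erase _ _ (show (0 : Fin d →₀ ℕ) ∈ multiIdx d n by simp)]
  simp only [Finsupp.coe_zero, Pi.zero_apply, pow_zero, Finset.prod_const_one, mul_one,
    add_sub_cancel_left]
  refine (norm_sum_le _ _).trans (Finset.sum_le_sum fun s _ => ?_)
  rw [norm_mul]
  gcongr
  exact norm_monomial_le _ _

variable (𝕜) in
/-- A finite set of points that determines the polynomials of degree at most `n`, with the
interpolating polynomials. -/
theorem exists_interpolation (d n : ℕ) :
    ∃ (m : Finset (Euc d)) (L : Euc d → MvPolynomial (Fin d) 𝕜),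
      (∀ u ∈ m, u ∈ cube (0 : Euc d) (1 / 2)) ∧ (∀ u, (L u).totalDegree ≤ n) ∧
      ∀ P : MvPolynomial (Fin d) 𝕜, P.totalDegree ≤ n → P = ∑ u ∈ m, C (polyFun P u) * L u := by
  classical
  -- A grid with `n + 1` values in each coordinate: more than the degree in each variable, so
  -- evaluation on the grid is injective, and a left inverse of it provides the interpolating
  -- polynomials. All values are at most `1/4`, which leaves room for translating the nodes inside
  -- the unit cube.
  let S : Finset ℝ := (Finset.range (n + 1)).image fun k : ℕ => (k : ℝ) / (4 * (n + 1))
  let m : Finset (Euc d) := (Fintype.piFinset fun _ : Fin d => S).image (WithLp.toLp 2)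
  let V := restrictTotalDegree (Fin d) 𝕜 n
  let ev : V →ₗ[𝕜] (m → 𝕜) :=
    { toFun := fun P u => polyFun P.1 u.1
      map_add' := fun P Q => by funext u; simp
      map_smul' := fun a P => by funext u; simp [polyFun] }
  have hinj : LinearMap.ker ev = ⊥ := by
    rw [LinearMap.ker_eq_bot']
    intro P hP
    apply Subtype.ext
    refine eq_zero_of_eval_zero_at_prod_finset P.1
      (fun _ => S.image fun t : ℝ => (t : 𝕜)) (fun i => ?_) fun x hx => ?_
    · have h1 : P.1.degreeOf i ≤ n := (degreeOf_le_totalDegree _ i).trans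
        ((mem_restrictTotalDegree _ _ _).1 P.2)
      rw [Finset.card_image_of_injective _ RCLike.ofReal_injective, Finset.card_image_of_injective,
        Finset.card_range]
      · exact Nat.lt_succ_of_le h1
      · intro a b hab
        have h : (4 * ((n : ℝ) + 1)) ≠ 0 := by positivity
        have := (div_left_inj' h).1 hab
        exact_mod_cast this
    · simp only [Finset.mem_image] at hx
      choose t ht hxt using hx
      have hm : (WithLp.toLp 2 t : Euc d) ∈ m :=
        Finset.mem_image_of_mem _ (Fintype.mem_piFinset.2 ht)
      have := congrFun hP ⟨_, hm⟩
      simp only [LinearMap.coe_mk, AddHom.coe_mk, ev, polyFun, Pi.zero_apply] at this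
      rw [← this]
      congr 2
      funext i
      exact (hxt i).symm
  obtain ⟨G, hG⟩ := ev.exists_leftInverse_of_injective hinj
  refine ⟨m, fun u => if h : u ∈ m then (G (Pi.single ⟨u, h⟩ 1)).1 else 0, fun u hu => ?_,
    fun u => ?_, fun P hP => ?_⟩
  · simp only [m, Finset.mem_image, Fintype.mem_piFinset] at hu
    obtain ⟨t, ht, rfl⟩ := hu
    intro i
    obtain ⟨k, hk, hk'⟩ := Finset.mem_image.1 (ht i)
    have hkn : (k : ℝ) ≤ n := by
      exact_mod_cast Nat.lt_succ_iff.1 (Finset.mem_range.1 hk)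
    simp only [PiLp.zero_apply, sub_zero]
    rw [← hk', abs_of_nonneg (by positivity), div_le_iff₀ (by positivity)]
    linarith
  · dsimp only
    split_ifs with h
    · exact (mem_restrictTotalDegree _ _ _).1 (G _).2
    · simp
  · have hPV : P ∈ V := (mem_restrictTotalDegree _ _ _).2 hP
    have h1 : G (ev ⟨P, hPV⟩) = ⟨P, hPV⟩ := LinearMap.congr_fun hG _
    have h2 : ev ⟨P, hPV⟩ = ∑ u : m, polyFun P u.1 • (Pi.single u 1 : m → 𝕜) := by
      funext v
      simp [ev, Finset.sum_apply, Pi.single_apply]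
    rw [h2, map_sum] at h1
    have h3 := congrArg Subtype.val h1
    rw [AddSubmonoidClass.coe_finsetSum] at h3
    rw [← Finset.sum_coe_sort m]
    refine Eq.trans h3.symm ?_
    refine Finset.sum_congr rfl fun u _ => ?_
    simp [smul_eq_C_mul]

end Poly

/-! ### Equivalence of norms for polynomials of bounded degree, uniform in the cube. -/

section PolyBounds

open MvPolynomial

variable (𝕜) in
/-- The Taylor coefficients of a polynomial are controlled by its supremum on a cube. -/
theorem exists_coeff_bound (d n : ℕ) : ∃ A : ℝ, 0 ≤ A ∧
    ∀ P : MvPolynomial (Fin d) 𝕜, P.totalDegree ≤ n → ∀ (z : Euc d) (ρ B : ℝ), 0 < ρ →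
      (∀ x ∈ cube z ρ, ‖polyFun P x‖ ≤ B) →
      ∀ s, ‖coeff s (affineSub z 1 P)‖ * ρ ^ s.degree ≤ A * B := by
  obtain ⟨m, L, hm, hL, hrep⟩ := exists_interpolation 𝕜 d n
  refine ⟨∑ u ∈ m, ∑ s ∈ multiIdx d n, ‖coeff s (L u)‖, by positivity, ?_⟩
  intro P hP z ρ B hρ hB s
  have hB0 : 0 ≤ B := (norm_nonneg _).trans (hB z (self_mem_cube z hρ.le))
  set R := affineSub z ρ P with hR
  have hRdeg : R.totalDegree ≤ n := (totalDegree_affineSub_le _ _ _).trans hP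
  have h1 : ‖coeff s R‖ = ‖coeff s (affineSub z 1 P)‖ * ρ ^ s.degree := by
    rw [hR, coeff_affineSub, norm_mul, norm_pow, RCLike.norm_ofReal, abs_of_pos hρ, mul_comm]
  rw [← h1]
  by_cases hs : s ∈ multiIdx d n
  -- After rescaling to unit size, each coefficient is a fixed linear combination of the values at
  -- the nodes.
  · have h2 : coeff s R = ∑ u ∈ m, polyFun R u * coeff s (L u) := by
      conv_lhs => rw [hrep R hRdeg]
      rw [coeff_sum]
      exact Finset.sum_congr rfl fun u _ => coeff_C_mul _ _ _
    rw [h2, Finset.sum_mul]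
    refine (norm_sum_le _ _).trans (Finset.sum_le_sum fun u hu => ?_)
    rw [norm_mul, mul_comm]
    refine mul_le_mul ?_ ?_ (norm_nonneg _) (by positivity)
    · exact Finset.single_le_sum (f := fun s => ‖coeff s (L u)‖) (fun _ _ => norm_nonneg _) hs
    · rw [hR, polyFun_affineSub]
      refine hB _ fun i => ?_
      have := hm u hu i
      simp only [PiLp.zero_apply, sub_zero] at this
      simp only [PiLp.add_apply, PiLp.smul_apply, smul_eq_mul, add_sub_cancel_left, abs_mul,
        abs_of_pos hρ]
      nlinarith
  · rw [coeff_eq_zero_of_lt hRdeg (by simpa using hs), norm_zero]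
    positivity

theorem setLIntegral_cube_translate_le (F : Euc d → ℝ≥0∞) {a c : Euc d} {l' l : ℝ}
    (h : ∀ w ∈ cube (0 : Euc d) l', a + w ∈ cube c l) :
    ∫⁻ w in cube (0 : Euc d) l', F (a + w) ≤ ∫⁻ x in cube c l, F x := by
  rw [← lintegral_indicator (measurableSet_cube _ _), ← lintegral_indicator (measurableSet_cube _ _),
    ← lintegral_add_left_eq_self ((cube c l).indicator F) a]
  refine lintegral_mono fun w => ?_
  by_cases hw : w ∈ cube (0 : Euc d) l'
  · rw [Set.indicator_of_mem hw, Set.indicator_of_mem (h w hw)]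
  · rw [Set.indicator_of_notMem hw]
    exact zero_le

variable (𝕜) in
/-- The values of a polynomial near a cube are controlled by its mean on the cube. -/
theorem exists_polyFun_bound (d n : ℕ) (M : ℝ) (hM : 0 ≤ M) : ∃ A : ℝ, 0 ≤ A ∧
    ∀ P : MvPolynomial (Fin d) 𝕜, P.totalDegree ≤ n → ∀ (c y : Euc d) (l : ℝ), 0 < l →
      ‖y - c‖ ≤ M * l →
      ‖polyFun P y‖ₑ * ENNReal.ofReal (l ^ d) ≤
        ENNReal.ofReal A * ∫⁻ x in cube c l, ‖polyFun P x‖ₑ := by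
  obtain ⟨m, L, hm, hL, hrep⟩ := exists_interpolation 𝕜 d n
  set M' : ℝ := M + d with hM'
  set B : ℝ := ∑ u ∈ m, ∑ s ∈ multiIdx d n, ‖coeff s (affineSub 0 1 (L u))‖ * M' ^ s.degree
    with hBdef
  have hM'0 : 0 ≤ M' := by positivity
  have hB0 : 0 ≤ B := by positivity
  have hLB : ∀ u ∈ m, ∀ v : Euc d, ‖v‖ ≤ M' → ‖polyFun (L u) v‖ ≤ B := by
    intro u hu v hv
    refine (norm_polyFun_le (hL u) 0 v).trans ?_
    refine le_trans ?_ (Finset.single_le_sum (f := fun u => ∑ s ∈ multiIdx d n,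
      ‖coeff s (affineSub 0 1 (L u))‖ * M' ^ s.degree) (fun _ _ => by positivity) hu)
    refine Finset.sum_le_sum fun s _ => ?_
    rw [sub_zero]
    gcongr
  clear_value B
  refine ⟨2 ^ d * (m.card * B),
    mul_nonneg (by positivity) (mul_nonneg (Nat.cast_nonneg _) hB0), ?_⟩
  intro P hP c y l hl hy
  set I := ∫⁻ x in cube c l, ‖polyFun P x‖ₑ with hI
  -- Interpolation is applied with all nodes translated by `w`. Integrating in `w` over the smaller
  -- cube turns the values at the nodes into integrals over the cube of side `l`.
  have key : ∀ w ∈ cube (0 : Euc d) (l / 2), ‖polyFun P y‖ₑ ≤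
      ∑ u ∈ m, ENNReal.ofReal B * ‖polyFun P ((c + l • u) + w)‖ₑ := by
    intro w hw
    set R := affineSub (c + w) l P with hR
    have hRdeg : R.totalDegree ≤ n := (totalDegree_affineSub_le _ _ _).trans hP
    set v : Euc d := l⁻¹ • (y - c - w) with hv
    have hyR : polyFun P y = polyFun R v := by
      rw [hR, polyFun_affineSub, hv, smul_inv_smul₀ hl.ne']
      congr 1
      abel
    have hvn : ‖v‖ ≤ M' := by
      rw [hv, norm_smul, norm_inv, Real.norm_of_nonneg hl.le, inv_mul_le_iff₀ hl]
      have h1 := norm_sub_le_of_mem_cube hw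
      rw [sub_zero] at h1
      have h2 := norm_sub_le (y - c) w
      have h3 : (d : ℝ) * (l / 2 / 2) ≤ d * l := by gcongr; linarith
      rw [hM']
      linarith
    rw [hyR]
    conv_lhs => rw [hrep R hRdeg]
    rw [polyFun_sum]
    refine (enorm_sum_le _ _).trans (Finset.sum_le_sum fun u hu => ?_)
    rw [polyFun_mul, polyFun_C, enorm_mul, mul_comm]
    refine mul_le_mul' ?_ ?_
    · rw [← ofReal_norm]
      exact ENNReal.ofReal_le_ofReal (hLB u hu v hvn)
    · rw [hR, polyFun_affineSub]
      apply le_of_eq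
      congr 2
      abel
  have h1 : ‖polyFun P y‖ₑ * ENNReal.ofReal ((l / 2) ^ d) ≤
      ∑ u ∈ m, ENNReal.ofReal B * I := by
    rw [← volume_cube (0 : Euc d) (l / 2) (by positivity), ← setLIntegral_const]
    refine (setLIntegral_mono' (measurableSet_cube _ _) key).trans ?_
    rw [lintegral_finsetSum']
    · refine Finset.sum_le_sum fun u hu => ?_
      rw [lintegral_const_mul']
      · gcongr
        refine setLIntegral_cube_translate_le (fun x => ‖polyFun P x‖ₑ) fun w hw => ?_
        intro i
        have e1 := hw i
        have e2 := hm u hu i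
        simp only [PiLp.zero_apply, sub_zero] at e1 e2
        simp only [PiLp.add_apply, PiLp.smul_apply, smul_eq_mul]
        rw [show c i + l * u i + w i - c i = l * u i + w i by ring]
        refine (abs_add_le _ _).trans ?_
        rw [abs_mul, abs_of_pos hl]
        nlinarith
      · exact ENNReal.ofReal_ne_top
    · intro u _
      refine Measurable.aemeasurable ?_
      have := (continuous_polyFun P).comp (continuous_const_add (c + l • u))
      exact (this.enorm.measurable).const_mul _
  rw [Finset.sum_const, nsmul_eq_mul, ← mul_assoc] at h1
  have h2 : ENNReal.ofReal (l ^ d) = ENNReal.ofReal (2 ^ d) * ENNReal.ofReal ((l / 2) ^ d) := by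
    rw [← ENNReal.ofReal_mul (by positivity), ← mul_pow]
    congr 2
    ring
  rw [h2, ENNReal.ofReal_mul (by positivity), ENNReal.ofReal_mul (Nat.cast_nonneg _),
    ENNReal.ofReal_natCast]
  calc _ = ENNReal.ofReal (2 ^ d) * (‖polyFun P y‖ₑ * ENNReal.ofReal ((l / 2) ^ d)) := by ring
    _ ≤ ENNReal.ofReal (2 ^ d) * (m.card * ENNReal.ofReal B * I) := by gcongr
    _ = _ := by ring

/-- The diagonal of a multilinear map is a polynomial. -/
theorem exists_poly_of_multilinear {k : ℕ}
    (f : ContinuousMultilinearMap ℝ (fun _ : Fin k => Euc d) 𝕜) :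
    ∃ P : MvPolynomial (Fin d) 𝕜, P.totalDegree ≤ k ∧ ∀ h, f (fun _ => h) = polyFun P h := by
  let e := EuclideanSpace.basisFun (Fin d) ℝ
  refine ⟨∑ r : Fin k → Fin d, C (f fun i => e (r i)) * ∏ i, X (r i), ?_, fun h => ?_⟩
  · refine totalDegree_finsetSum_le fun r _ => totalDegree_C_mul_le _ ?_
    refine (totalDegree_finsetProd _ _).trans ?_
    simp
  · have h1 : (fun _ : Fin k => h) = fun _ => ∑ j, h j • e j := by
      funext _
      conv_lhs => rw [← e.sum_repr h]
      simp [e]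
    rw [h1, ContinuousMultilinearMap.map_sum, polyFun_sum]
    refine Finset.sum_congr rfl fun r _ => ?_
    rw [ContinuousMultilinearMap.map_smul_univ]
    simp [polyFun, RCLike.real_smul_eq_coe_mul, mul_comm]

end PolyBounds

/-! ### Comparison of approximating polynomials along chains of cubes; Lebesgue points. -/

section Chain

open MvPolynomial

/-- `P` is a polynomial of degree at most `n` whose mean distance to `f` on the cube with center
`c` and side `l` is at most `N l ^ n`. -/
structure ApproxOn (n : ℕ) (f : Euc d → 𝕜) (N : ℝ) (c : Euc d) (l : ℝ)
    (P : MvPolynomial (Fin d) 𝕜) : Prop where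
  deg : P.totalDegree ≤ n
  meas : AEStronglyMeasurable f (volume.restrict (cube c l))
  le : ∫⁻ x in cube c l, ‖f x - polyFun P x‖ₑ ≤ ENNReal.ofReal (N * l ^ n * l ^ d)

theorem aemeasurable_enorm_sub_polyFun {f : Euc d → 𝕜} {s : Set (Euc d)}
    (hf : AEStronglyMeasurable f (volume.restrict s)) (P : MvPolynomial (Fin d) 𝕜) :
    AEMeasurable (fun x => ‖f x - polyFun P x‖ₑ) (volume.restrict s) :=
  (hf.sub (continuous_polyFun P).aestronglyMeasurable).enorm

theorem le_of_enorm_mul_le {a : 𝕜} {V B : ℝ} (hV : 0 < V) (hB : 0 ≤ B)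
    (h : ‖a‖ₑ * ENNReal.ofReal V ≤ ENNReal.ofReal (B * V)) : ‖a‖ ≤ B := by
  rw [← ofReal_norm, ← ENNReal.ofReal_mul (norm_nonneg _),
    ENNReal.ofReal_le_ofReal_iff (by positivity)] at h
  exact le_of_mul_le_mul_right h hV

variable (𝕜) in
/-- Comparison of approximating polynomials on two cubes with a large intersection. -/
theorem exists_compare_bound (d n : ℕ) (M : ℝ) (hM : 0 ≤ M) : ∃ A : ℝ, 0 ≤ A ∧
    ∀ (f : Euc d → 𝕜) (N : ℝ) (c c' c'' : Euc d) (l l' l'' : ℝ)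
      (P P' : MvPolynomial (Fin d) 𝕜), 0 ≤ N → ApproxOn n f N c l P → ApproxOn n f N c' l' P' →
      0 ≤ l → 0 ≤ l' → 0 < l'' → l ≤ M * l'' → l' ≤ M * l'' →
      cube c'' l'' ⊆ cube c l → cube c'' l'' ⊆ cube c' l' →
      ∀ x, ‖x - c''‖ ≤ M * l'' → ‖polyFun (P - P') x‖ ≤ A * N * l'' ^ n := by
  obtain ⟨A, hA, hb⟩ := exists_polyFun_bound 𝕜 d n M hM
  refine ⟨A * (2 * (M ^ n * M ^ d)), by positivity, ?_⟩
  intro f N c c' c'' l l' l'' P P' hN hP hP' hl hl' hl'' hlM hlM' hs hs' x hx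
  have h1 := hb (P - P') (totalDegree_sub_le hP.deg hP'.deg) c'' x l'' hl'' hx
  refine le_of_enorm_mul_le (V := l'' ^ d) (by positivity) (by positivity) (h1.trans ?_)
  have h2 : ∫⁻ x in cube c'' l'', ‖polyFun (P - P') x‖ₑ ≤
      ENNReal.ofReal (2 * (M ^ n * M ^ d) * N * l'' ^ n * l'' ^ d) := by
    calc ∫⁻ x in cube c'' l'', ‖polyFun (P - P') x‖ₑ
        ≤ ∫⁻ x in cube c'' l'', (‖f x - polyFun P x‖ₑ + ‖f x - polyFun P' x‖ₑ) := by
          refine lintegral_mono fun x => ?_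
          rw [polyFun_sub, ← sub_sub_sub_cancel_left (polyFun P' x) (polyFun P x) (f x), add_comm]
          exact enorm_sub_le
      _ = (∫⁻ x in cube c'' l'', ‖f x - polyFun P x‖ₑ) +
          ∫⁻ x in cube c'' l'', ‖f x - polyFun P' x‖ₑ :=
          lintegral_add_left' (aemeasurable_enorm_sub_polyFun
            (hP.meas.mono_measure (Measure.restrict_mono hs le_rfl)) P) _
      _ ≤ ENNReal.ofReal (N * l ^ n * l ^ d) + ENNReal.ofReal (N * l' ^ n * l' ^ d) :=
          add_le_add ((lintegral_mono_set hs).trans hP.le) ((lintegral_mono_set hs').trans hP'.le)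
      _ ≤ ENNReal.ofReal (N * (M * l'') ^ n * (M * l'') ^ d) +
          ENNReal.ofReal (N * (M * l'') ^ n * (M * l'') ^ d) := by gcongr
      _ = _ := by
          rw [← ENNReal.ofReal_add (by positivity) (by positivity)]
          congr 1
          ring
  refine (mul_le_mul_right h2 _).trans ?_
  rw [← ENNReal.ofReal_mul hA]
  apply le_of_eq
  congr 1
  ring

/-- The centers are at distance at most `t - s ≤ κ s / 4`, and the smaller cube has half-side `κ s /
4`. This fixes the ratio `1 + κ / 4` of consecutive scales in the chains. -/
theorem cube_subset_of_shift {x e : Euc d} (he : ‖e‖ ≤ 1) {κ s t : ℝ} (hκ : 0 < κ)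
    (hst : s ≤ t) (ht : t ≤ (1 + κ / 4) * s) :
    cube (x + s • e) (κ * s / 2) ⊆ cube (x + t • e) (κ * t) := by
  refine cube_subset_cube ?_
  have : ‖x + s • e - (x + t • e)‖ ≤ t - s := by
    rw [add_sub_add_left_eq_sub, ← sub_smul, norm_smul, Real.norm_eq_abs, abs_sub_comm,
      abs_of_nonneg (sub_nonneg.2 hst)]
    nlinarith [norm_nonneg e]
  nlinarith

variable (𝕜) in
/-- One step of a chain of cubes with nearly equal sides. -/
theorem exists_step_bound (d n : ℕ) (κ : ℝ) (hκ : 0 < κ) (hκ1 : κ ≤ 1) : ∃ A : ℝ, 0 ≤ A ∧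
    ∀ (f : Euc d → 𝕜) (N : ℝ) (x e : Euc d) (s t : ℝ) (P P' : MvPolynomial (Fin d) 𝕜),
      0 ≤ N → ‖e‖ ≤ 1 → 0 < s → s ≤ t → t ≤ (1 + κ / 4) * s →
      ApproxOn n f N (x + s • e) (κ * s) P → ApproxOn n f N (x + t • e) (κ * t) P' →
      ∀ α : Fin d →₀ ℕ, α.degree ≤ n →
        ‖coeff α (affineSub x 1 (P - P'))‖ ≤ A * N * s ^ (n - α.degree) := by
  -- Large enough that `M` times the side `κ s / 2` of the common cube dominates both sides and the
  -- distance from its center to every point of the cube of side `s` about the vertex `x`.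
  set M : ℝ := 4 + (d + 2) / κ with hM
  have hM0 : 0 ≤ M := by positivity
  obtain ⟨A, hA, hcmp⟩ := exists_compare_bound 𝕜 d n M hM0
  obtain ⟨A', hA', hcf⟩ := exists_coeff_bound 𝕜 d n
  refine ⟨A' * A, by positivity, ?_⟩
  intro f N x e s t P P' hN he hs hst ht hP hP' α hα
  have ht0 : 0 < t := hs.trans_le hst
  have hMl : M * (κ * s / 2) = 2 * κ * s + (d + 2) * s / 2 := by
    rw [hM]; field_simp; ring
  have hsup : ∀ y ∈ cube x s, ‖polyFun (P - P') y‖ ≤ A * N * s ^ n := by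
    intro y hy
    refine (hcmp f N (x + s • e) (x + t • e) (x + s • e) (κ * s) (κ * t) (κ * s / 2) P P' hN hP hP'
      (by positivity) (by positivity) (by positivity) ?_ ?_ ?_ ?_ y ?_).trans ?_
    · rw [hMl]; nlinarith [mul_nonneg (Nat.cast_nonneg (α := ℝ) d) hs.le, mul_pos hκ hs]
    · rw [hMl]
      have : κ * t ≤ κ * ((1 + κ / 4) * s) := by gcongr
      nlinarith [mul_nonneg (Nat.cast_nonneg (α := ℝ) d) hs.le, mul_pos hκ hs]
    · refine cube_subset_cube ?_
      rw [sub_self, norm_zero]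
      nlinarith [mul_pos hκ hs]
    · exact cube_subset_of_shift he hκ hst ht
    · have h1 := norm_sub_le_of_mem_cube hy
      have h2 : ‖y - (x + s • e)‖ ≤ ‖y - x‖ + s := by
        rw [← sub_sub]
        refine (norm_sub_le _ _).trans ?_
        rw [norm_smul, Real.norm_of_nonneg hs.le]
        nlinarith
      rw [hMl]
      nlinarith [mul_pos hκ hs]
    · gcongr
      nlinarith
  have h := hcf (P - P') (totalDegree_sub_le hP.deg hP'.deg) x s _ hs hsup α
  have h3 : s ^ n = s ^ (n - α.degree) * s ^ α.degree := by rw [← pow_add]; congr 1; omega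
  refine le_of_mul_le_mul_right (h.trans_eq ?_) (pow_pos hs α.degree)
  rw [h3]
  ring

/-- The growth of the Taylor coefficients along a chain of cubes. -/
def chainWeight (n k : ℕ) (s t : ℝ) : ℝ :=
  t ^ (n - k) * if k < n then 1 else 1 + Real.log (t / s)

theorem chainWeight_nonneg {n k : ℕ} {s t : ℝ} (hs : 0 < s) (hst : s ≤ t) :
    0 ≤ chainWeight n k s t := by
  have : 0 ≤ Real.log (t / s) := Real.log_nonneg ((one_le_div hs).2 hst)
  unfold chainWeight
  split_ifs
  · have := hs.trans_le hst
    positivity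
  · have := hs.trans_le hst
    positivity

theorem chainWeight_le {n k : ℕ} {s t : ℝ} (hs : 0 < s) (hst : s ≤ t) :
    chainWeight n k s t ≤ t ^ (n - k) * (1 + Real.log (t / s)) := by
  have h0 : 0 ≤ Real.log (t / s) := Real.log_nonneg ((one_le_div hs).2 hst)
  have := hs.trans_le hst
  unfold chainWeight
  gcongr
  split_ifs <;> linarith

/-- Since `n - k ≥ 1`, the ratio of the series is at most `q`; the bound does not depend on the
number of terms, so no logarithm arises below the top order. -/
theorem sum_geometric_powers_le {n k : ℕ} {t q : ℝ} (ht : 0 < t) (hq : 0 < q) (hq1 : q < 1)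
    (hkn : k < n) (m : ℕ) :
    ∑ j ∈ Finset.range m, (t * q ^ j) ^ (n - k) ≤ t ^ (n - k) * (1 - q)⁻¹ := by
  have h1 : ∀ j ∈ Finset.range m, (t * q ^ j) ^ (n - k) ≤ t ^ (n - k) * q ^ j := by
    intro j _
    rw [mul_pow]
    gcongr
    rw [← pow_mul]
    exact pow_le_pow_of_le_one hq.le hq1.le (Nat.le_mul_of_pos_right _ (by omega))
  refine (Finset.sum_le_sum h1).trans ?_
  rw [← Finset.mul_sum]
  gcongr
  rw [← tsum_geometric_of_lt_one hq.le hq1]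
  exact (summable_geometric_of_lt_one hq.le hq1).sum_le_tsum _ fun _ _ => by positivity

variable (𝕜) in
/-- Comparison of approximating polynomials along a chain of cubes in a cone with vertex `x`. -/
theorem exists_chain_bound (d n : ℕ) (κ : ℝ) (hκ : 0 < κ) (hκ1 : κ ≤ 1) : ∃ A : ℝ, 0 ≤ A ∧
    ∀ (f : Euc d → 𝕜) (N : ℝ) (x e : Euc d) (s t : ℝ) (P P' : MvPolynomial (Fin d) 𝕜),
      0 ≤ N → ‖e‖ ≤ 1 → 0 < s → s ≤ t →
      (∀ u, 0 < u → u ≤ t → ∃ R, ApproxOn n f N (x + u • e) (κ * u) R) →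
      ApproxOn n f N (x + s • e) (κ * s) P → ApproxOn n f N (x + t • e) (κ * t) P' →
      ∀ α : Fin d →₀ ℕ, α.degree ≤ n →
        ‖coeff α (affineSub x 1 (P - P'))‖ ≤ A * N * chainWeight n α.degree s t := by
  obtain ⟨A, hA, hstep⟩ := exists_step_bound 𝕜 d n κ hκ hκ1
  set θ : ℝ := 1 + κ / 4 with hθ
  have hθ1 : 1 < θ := by rw [hθ]; linarith
  set q : ℝ := θ⁻¹ with hqdef
  have hq0 : 0 < q := by positivity
  have hq1 : q < 1 := inv_lt_one_of_one_lt₀ hθ1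
  have hlogθ : 0 < Real.log θ := Real.log_pos hθ1
  have hqinv : 0 < (1 - q)⁻¹ := inv_pos.2 (by linarith)
  refine ⟨A * (2 + (1 - q)⁻¹ + (Real.log θ)⁻¹), by positivity, ?_⟩
  intro f N x e s t P P' hN he hs hst hfam hP hP' α hα
  set k := α.degree with hk
  have ht : 0 < t := hs.trans_le hst
  -- The chain descends from `t` through the scales `t q^j`. Induction on the number `m` of scales
  -- above `s`: a single step links `s` to `t q^m`, after which the shorter chain takes over.
  have chain : ∀ m : ℕ, ∀ s, 0 < s → t * q ^ m ≤ s → s ≤ t → ∀ P,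
      ApproxOn n f N (x + s • e) (κ * s) P →
      ‖coeff α (affineSub x 1 (P - P'))‖ ≤
        A * N * (t ^ (n - k) + ∑ j ∈ Finset.range m, (t * q ^ j) ^ (n - k)) := by
    intro m
    induction m with
    | zero =>
      intro s hs h1 h2 P hP
      have hts : t = s := le_antisymm (by simpa using h1) h2
      refine (hstep f N x e s t P P' hN he hs h2 ?_ hP hP' α hα).trans ?_
      · rw [hts]; nlinarith
      · simp [hts, hk]
    | succ m ih =>
      intro s hs h1 h2 P hP
      rw [Finset.sum_range_succ]
      by_cases hc : t * q ^ m ≤ s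
      · refine (ih s hs hc h2 P hP).trans ?_
        gcongr
        have : 0 ≤ (t * q ^ m) ^ (n - k) := by positivity
        linarith
      · push Not at hc
        have hu0 : 0 < t * q ^ m := by positivity
        have hut : t * q ^ m ≤ t := mul_le_of_le_one_right ht.le (pow_le_one₀ hq0.le hq1.le)
        obtain ⟨R, hR⟩ := hfam (t * q ^ m) hu0 hut
        have e1 := ih _ hu0 le_rfl hut R hR
        have e2 := hstep f N x e s (t * q ^ m) P R hN he hs hc.le ?_ hP hR α hα
        · have e3 : P - P' = (P - R) + (R - P') := by ring
          have e4 : affineSub x 1 (P - P') = affineSub x 1 (P - R) + affineSub x 1 (R - P') := by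
            rw [e3]; simp [affineSub]
          rw [e4, coeff_add]
          refine (norm_add_le _ _).trans ?_
          have e5 : s ^ (n - k) ≤ (t * q ^ m) ^ (n - k) := by gcongr
          have e6 : A * N * s ^ (n - k) ≤ A * N * (t * q ^ m) ^ (n - k) := by gcongr
          rw [← hk] at e2
          nlinarith
        · have : t * q ^ m = θ * (t * q ^ (m + 1)) := by
            rw [pow_succ, hqdef]; field_simp
          rw [this]
          gcongr
  have hlog : 0 ≤ Real.log (t / s) := Real.log_nonneg ((one_le_div hs).2 hst)
  -- The number of steps needed to reach `s` from `t`. For `k = n` every step costs a constant, and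
  -- this count is the logarithm in `chainWeight`.
  set m : ℕ := ⌈Real.log (t / s) / Real.log θ⌉₊ with hm
  have hm1 : Real.log (t / s) / Real.log θ ≤ m := Nat.le_ceil _
  have hm2 : (m : ℝ) ≤ Real.log (t / s) / Real.log θ + 1 :=
    (Nat.ceil_lt_add_one (by positivity)).le
  have hms : t * q ^ m ≤ s := by
    have h1 : t / s ≤ θ ^ m := by
      rw [div_le_iff₀ hlogθ] at hm1
      rw [← Real.log_le_log_iff (by positivity) (by positivity), Real.log_pow]
      exact hm1
    rw [hqdef, inv_pow, ← div_eq_mul_inv, div_le_iff₀ (by positivity)]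
    rwa [div_le_iff₀ hs, mul_comm] at h1
  refine (chain m s hs hms hst P hP).trans ?_
  have hfin : t ^ (n - k) + ∑ j ∈ Finset.range m, (t * q ^ j) ^ (n - k) ≤
      (2 + (1 - q)⁻¹ + (Real.log θ)⁻¹) * chainWeight n k s t := by
    have hinv : 0 < (Real.log θ)⁻¹ := inv_pos.2 hlogθ
    unfold chainWeight
    split_ifs with hkn
    · have := sum_geometric_powers_le ht hq0 hq1 hkn m
      have h0 : 0 < t ^ (n - k) := by positivity
      nlinarith
    · have h0 : n - k = 0 := by omega
      simp only [h0, pow_zero, Finset.sum_const, Finset.card_range, nsmul_eq_mul, mul_one, one_mul]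
      rw [div_eq_mul_inv] at hm2
      nlinarith [mul_nonneg hqinv.le hlog]
  calc _ ≤ A * N * ((2 + (1 - q)⁻¹ + (Real.log θ)⁻¹) * chainWeight n k s t) := by gcongr
    _ = _ := by ring

/-- `x` is a Lebesgue point of `f`. -/
def LebesguePt (f : Euc d → 𝕜) (x : Euc d) : Prop :=
  ∀ ε : ℝ, 0 < ε → ∀ᶠ r in 𝓝[>] (0 : ℝ),
    ∫⁻ y in Metric.closedBall x r, ‖f y - f x‖ₑ ≤ ENNReal.ofReal (ε * r ^ d)

theorem ae_lebesguePt {f : Euc d → 𝕜} {D : Set (Euc d)} (hD : IsOpen D)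
    (hf : LocallyIntegrableOn f D) : ∀ᵐ x ∂volume.restrict D, LebesguePt f x := by
  have hvol : ∀ (x : Euc d) (r : ℝ), 0 ≤ r → volume (Metric.closedBall x r) =
      ENNReal.ofReal (r ^ d) * volume (Metric.ball (0 : Euc d) 1) := by
    intro x r hr
    rw [Measure.addHaar_closedBall _ _ hr]
    simp
  have base : ∀ g : Euc d → 𝕜, LocallyIntegrable g volume → ∀ᵐ x, LebesguePt g x := by
    intro g hg
    filter_upwards [(IsUnifLocDoublingMeasure.vitaliFamily (volume : Measure (Euc d)) 1).ae_tendsto_lintegral_enorm_sub_div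
      hg] with x hx
    have h1 := hx.comp (IsUnifLocDoublingMeasure.tendsto_closedBall_filterAt (volume : Measure (Euc d))
      (K := 1) (x := x) (l := 𝓝[>] (0 : ℝ)) (fun _ => x) id tendsto_id (by
        filter_upwards [self_mem_nhdsWithin] with r hr
        simpa using (Set.mem_Ioi.1 hr).le))
    intro ε hε
    set v := volume (Metric.ball (0 : Euc d) 1) with hv
    have hv0 : v ≠ 0 := (Metric.measure_ball_pos _ _ one_pos).ne'
    have hvt : v ≠ ∞ := measure_ball_lt_top.ne
    have hpos : 0 < ENNReal.ofReal ε / v := ENNReal.div_pos (by simpa using hε) hvt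
    filter_upwards [h1.eventually (gt_mem_nhds hpos), self_mem_nhdsWithin] with r hr hr0
    have hr0' : 0 < r := hr0
    simp only [Function.comp, id] at hr
    have hb0 : volume (Metric.closedBall x r) ≠ 0 := (Metric.measure_closedBall_pos _ _ hr0').ne'
    have hbt : volume (Metric.closedBall x r) ≠ ∞ := measure_closedBall_lt_top.ne
    have h2 := (ENNReal.div_le_iff hb0 hbt).1 hr.le
    refine h2.trans (le_of_eq ?_)
    rw [hvol x r hr0'.le, ENNReal.ofReal_mul hε.le, mul_comm (ENNReal.ofReal (r ^ d)), ← mul_assoc,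
      ENNReal.div_mul_cancel hv0 hvt]
  -- The function is only locally integrable on `D`. It is cut off to countably many open pieces on
  -- which it is integrable; being a Lebesgue point depends only on small balls, which stay inside a
  -- piece.
  obtain ⟨T, hTc, hTo, hTs, hTi⟩ := hf.exists_countable_integrableOn
  have h2 : ∀ u ∈ T, ∀ᵐ x, x ∈ u ∩ D → LebesguePt f x := by
    intro u hu
    have ho : IsOpen (u ∩ D) := (hTo u hu).inter hD
    have hi : Integrable ((u ∩ D).indicator f) volume :=
      (integrable_indicator_iff ho.measurableSet).2 (hTi u hu)
    filter_upwards [base _ hi.locallyIntegrable] with x hx hxu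
    intro ε hε
    obtain ⟨δ, hδ, hball⟩ := Metric.isOpen_iff.1 ho x hxu
    filter_upwards [hx ε hε, Ioo_mem_nhdsGT hδ] with r hr hrδ
    refine le_trans (le_of_eq ?_) hr
    refine setLIntegral_congr_fun Metric.isClosed_closedBall.measurableSet fun y hy => ?_
    have hy' : y ∈ u ∩ D := hball (Metric.closedBall_subset_ball hrδ.2 hy)
    simp only [Set.indicator_of_mem hy', Set.indicator_of_mem hxu]
  rw [ae_restrict_iff' hD.measurableSet]
  have h3 := (ae_ball_iff hTc).2 h2
  filter_upwards [h3] with x hx hxD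
  obtain ⟨u, hu, hxu⟩ := Set.mem_iUnion₂.1 (hTs hxD)
  exact hx u hu ⟨hxu, hxD⟩

variable (𝕜) in
/-- At a Lebesgue point the function is close to the approximating polynomials on the cubes of
a cone with vertex at this point. -/
theorem exists_chain_limit_bound (d n : ℕ) (hn : 1 ≤ n) (κ : ℝ) (hκ : 0 < κ) (hκ1 : κ ≤ 1) :
    ∃ A : ℝ, 0 ≤ A ∧
    ∀ (f : Euc d → 𝕜) (N : ℝ) (x e : Euc d) (t : ℝ) (P : MvPolynomial (Fin d) 𝕜),
      0 ≤ N → ‖e‖ ≤ 1 → 0 < t → LebesguePt f x →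
      (∀ u, 0 < u → u ≤ t → ∃ R, ApproxOn n f N (x + u • e) (κ * u) R) →
      ApproxOn n f N (x + t • e) (κ * t) P →
        ‖f x - polyFun P x‖ ≤ A * N * t ^ n := by
  obtain ⟨A, hA, hchain⟩ := exists_chain_bound 𝕜 d n κ hκ hκ1
  obtain ⟨A', hA', hpb⟩ := exists_polyFun_bound 𝕜 d n κ⁻¹ (by positivity)
  refine ⟨A' + A, by positivity, ?_⟩
  intro f N x e t P hN he ht hx hfam hP
  set W : ℝ := A' * ((d + 1) ^ d * (κ ^ d)⁻¹) with hW
  have hW0 : 0 ≤ W := by positivity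
  refine le_of_forall_pos_le_add fun η hη => ?_
  set ε : ℝ := η / (W + 1) with hε
  have hε0 : 0 < ε := by positivity
  have hWε : W * ε ≤ η := by
    rw [hε, mul_div_assoc', div_le_iff₀ (by positivity)]
    nlinarith
  have htend : Tendsto (fun s : ℝ => ((d : ℝ) + 1) * s) (𝓝[>] 0) (𝓝[>] 0) := by
    refine tendsto_nhdsWithin_iff.2 ⟨?_, ?_⟩
    · have : Tendsto (fun s : ℝ => ((d : ℝ) + 1) * s) (𝓝 0) (𝓝 (((d : ℝ) + 1) * 0)) :=
        (continuous_const_mul _).tendsto 0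
      rw [mul_zero] at this
      exact this.mono_left nhdsWithin_le_nhds
    · filter_upwards [self_mem_nhdsWithin] with s hs
      have : 0 < s := hs
      exact Set.mem_Ioi.2 (by positivity)
  -- The ball of radius `(d + 1) s` about `x` contains the cone cube at height `s`, so the mean of
  -- `|f - f x|` over that cube is a small multiple of `ε`.
  obtain ⟨s, hs1, hs2⟩ := ((htend.eventually (hx ε hε0)).and (Ioo_mem_nhdsGT ht)).exists
  obtain ⟨hs0, hst⟩ := hs2
  obtain ⟨R, hR⟩ := hfam s hs0 hst.le
  have h1 := hchain f N x e s t R P hN he hs0 hst.le hfam hR hP 0 (by simp)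
  -- The order `0` is below the top order because `n ≥ 1`, so the value at the vertex changes by
  -- `O(t^n)` with no logarithm, uniformly as `s` tends to zero.
  have hw : chainWeight n (0 : Fin d →₀ ℕ).degree s t = t ^ n := by
    simp only [map_zero, chainWeight]
    rw [if_pos (by omega)]
    simp
  rw [← polyFun_eq_coeff_zero, hw, polyFun_sub] at h1
  have hsub : cube (x + s • e) (κ * s) ⊆ Metric.closedBall x ((d + 1) * s) := by
    intro y hy
    rw [Metric.mem_closedBall, dist_eq_norm]
    have e1 := norm_sub_le_of_mem_cube hy
    have e2 : y - x = (y - (x + s • e)) + s • e := by abel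
    rw [e2]
    refine (norm_add_le _ _).trans ?_
    rw [norm_smul, Real.norm_of_nonneg hs0.le]
    have e3 : (d : ℝ) * (κ * s / 2) ≤ d * s := by
      gcongr
      nlinarith
    nlinarith
  have h2 : ‖f x - polyFun R x‖ ≤ A' * (N * s ^ n) + W * ε := by
    have h3 := hpb (C (f x) - R) (totalDegree_sub_le (by simp) hR.deg) (x + s • e) x (κ * s)
      (by positivity) (by
        rw [sub_add_cancel_left, norm_neg, norm_smul, Real.norm_of_nonneg hs0.le]
        rw [inv_mul_cancel_left₀ hκ.ne']
        nlinarith)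
    rw [polyFun_sub, polyFun_C] at h3
    refine le_of_enorm_mul_le (V := (κ * s) ^ d) (by positivity) (by positivity) (h3.trans ?_)
    have h4 : ∫⁻ y in cube (x + s • e) (κ * s), ‖polyFun (C (f x) - R) y‖ₑ ≤
        ENNReal.ofReal (N * s ^ n * (κ * s) ^ d + ε * ((d + 1) * s) ^ d) := by
      calc ∫⁻ y in cube (x + s • e) (κ * s), ‖polyFun (C (f x) - R) y‖ₑ
          ≤ ∫⁻ y in cube (x + s • e) (κ * s), (‖f y - polyFun R y‖ₑ + ‖f y - f x‖ₑ) := by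
            refine lintegral_mono fun y => ?_
            rw [polyFun_sub, polyFun_C, ← sub_sub_sub_cancel_left (polyFun R y) (f x) (f y)]
            exact enorm_sub_le
        _ = (∫⁻ y in cube (x + s • e) (κ * s), ‖f y - polyFun R y‖ₑ) +
            ∫⁻ y in cube (x + s • e) (κ * s), ‖f y - f x‖ₑ :=
            lintegral_add_left' (aemeasurable_enorm_sub_polyFun hR.meas R) _
        _ ≤ ENNReal.ofReal (N * (κ * s) ^ n * (κ * s) ^ d) +
            ENNReal.ofReal (ε * ((d + 1) * s) ^ d) :=
            add_le_add hR.le ((lintegral_mono_set hsub).trans hs1)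
        _ ≤ ENNReal.ofReal (N * s ^ n * (κ * s) ^ d) +
            ENNReal.ofReal (ε * ((d + 1) * s) ^ d) := by
            gcongr
            nlinarith
        _ = _ := by rw [← ENNReal.ofReal_add (by positivity) (by positivity)]
    refine (mul_le_mul_right h4 _).trans ?_
    rw [← ENNReal.ofReal_mul hA']
    apply le_of_eq
    congr 1
    rw [hW, mul_pow, mul_pow]
    field_simp
  have h5 : f x - polyFun P x = (f x - polyFun R x) + (polyFun R x - polyFun P x) := by ring
  have h6 : A' * (N * s ^ n) ≤ A' * (N * t ^ n) := by gcongr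
  rw [h5]
  refine (norm_add_le _ _).trans ?_
  nlinarith

end Chain

/-! ### Interior cones in Lipschitz domains and bounds for approximating polynomials at large
scales. -/

section Domain

open MvPolynomial

/-- Bounded open sets with a uniform interior cone condition; the axis of the cones is locally
constant. -/
structure ConeDomain (D : Set (Euc d)) (κ r Δ : ℝ) : Prop where
  isOpen : IsOpen D
  κ_pos : 0 < κ
  κ_le : κ ≤ 1
  r_pos : 0 < r
  Δ_pos : 0 < Δ
  norm_sub_le : ∀ x ∈ D, ∀ y ∈ D, ‖x - y‖ ≤ Δ
  cone : ∀ a ∈ D, ∃ e : Euc d, ‖e‖ ≤ 1 ∧ ∀ x ∈ D, ‖x - a‖ ≤ r → ∀ t, 0 < t → t ≤ r →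
    cube (x + t • e) (κ * t) ⊆ D

/-- Near the boundary the cone axis is the vertical direction of a chart, common to all nearby
points. Away from the boundary whole balls lie in `D` and the axis can be taken to be zero. -/
theorem exists_coneDomain (hd : 1 ≤ d) {D : Set (Euc d)} (hD : IsBoundedLipschitzDomain D) :
    ∃ κ r Δ, ConeDomain D κ r Δ := by
  obtain ⟨δ, R, hR, hL⟩ := hD
  obtain ⟨Δ, hΔ⟩ := Metric.isBounded_iff.1 hL.isBounded
  have hd0 : (0 : ℝ) < d := by exact_mod_cast hd
  set κ : ℝ := (d * (1 + δ))⁻¹ with hκ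
  have hδ0 : (0 : ℝ) ≤ δ := δ.2
  have hκ0 : 0 < κ := by positivity
  have hd1 : (1 : ℝ) ≤ d := by exact_mod_cast hd
  have hκ1 : κ ≤ 1 := inv_le_one_of_one_le₀ (by nlinarith)
  refine ⟨κ, R / 64, max Δ 1, hL.isOpen, hκ0, hκ1, by positivity, by positivity, fun x hx y hy => ?_,
    fun a ha => ?_⟩
  · rw [← dist_eq_norm]
    exact (hΔ hx hy).trans (le_max_left _ _)
  -- This is the purpose of `κ`. A displacement `h` inside the cube lowers the height by at most
  -- `‖h‖` and raises the graph by at most `δ ‖h‖`, in total less than the vertical shift `t`.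
  have hcube : ∀ (p z : Euc d) (t : ℝ), 0 < t → z ∈ cube p (κ * t) → (1 + δ) * ‖z - p‖ ≤ t / 2 := by
    intro p z t ht hz
    have h1 := norm_sub_le_of_mem_cube hz
    have h2 : (1 + (δ : ℝ)) * (d * (κ * t / 2)) = t / 2 := by
      rw [hκ]; field_simp
    rw [← h2]
    gcongr
  by_cases hb : ∃ b ∈ frontier D, ‖a - b‖ < R / 16
  · obtain ⟨b, hbD, hab⟩ := hb
    obtain ⟨j, Φ, A, hA, hgr⟩ := hL.graph b hbD
    refine ⟨Φ.symm (EuclideanSpace.single j 1), by simp, fun x hx hxa t ht htR z hz => ?_⟩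
    set e := Φ.symm (EuclideanSpace.single j 1) with he
    set h := z - (x + t • e) with hh
    have h1 := hcube _ _ t ht hz
    rw [← hh] at h1
    have hhn : ‖h‖ ≤ t / 2 := by nlinarith [norm_nonneg h]
    have hxb : ‖x - b‖ ≤ R / 8 := by
      have : x - b = (x - a) + (a - b) := by abel
      rw [this]
      refine (norm_add_le _ _).trans ?_
      linarith
    have hmem : ∀ w : Euc d, ‖w‖ ≤ R / 2 → Φ w ∈ cube 0 R := fun w hw =>
      mem_cube_of_norm_sub_le (by simpa using hw)
    have hzb : z - b = (x - b) + t • e + h := by rw [hh]; abel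
    have hzbn : ‖z - b‖ ≤ R / 2 := by
      rw [hzb]
      refine (norm_add₃_le).trans ?_
      rw [norm_smul, Real.norm_of_nonneg ht.le]
      have : ‖e‖ = 1 := by rw [he]; simp
      rw [this]
      linarith
    have hxA := (hgr x (hmem _ (by linarith))).1 hx
    refine (hgr z (hmem _ hzbn)).2 ?_
    have hΦz : Φ (z - b) = Φ (x - b) + t • EuclideanSpace.single j 1 + Φ h := by
      rw [hzb, map_add, map_add, map_smul, he, LinearIsometryEquiv.apply_symm_apply]
    have hj : Φ (z - b) j = Φ (x - b) j + t + Φ h j := by rw [hΦz]; simp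
    have hi : ∀ i : {i : Fin d // i ≠ j}, Φ (z - b) i.1 = Φ (x - b) i.1 + Φ h i.1 := by
      intro i
      rw [hΦz]
      simp [i.2]
    have hlip := hA.dist_le_mul (WithLp.toLp 2 fun i : {i : Fin d // i ≠ j} => Φ (z - b) i.1)
      (WithLp.toLp 2 fun i : {i : Fin d // i ≠ j} => Φ (x - b) i.1)
    have hdist : dist (WithLp.toLp 2 fun i : {i : Fin d // i ≠ j} => Φ (z - b) i.1)
        (WithLp.toLp 2 fun i : {i : Fin d // i ≠ j} => Φ (x - b) i.1) ≤ ‖h‖ := by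
      rw [EuclideanSpace.dist_eq, ← Φ.norm_map h, EuclideanSpace.norm_eq]
      apply Real.sqrt_le_sqrt
      have : ∀ i : {i : Fin d // i ≠ j}, dist (Φ (z - b) i.1) (Φ (x - b) i.1) ^ 2 =
          ‖Φ h i.1‖ ^ 2 := by
        intro i
        rw [hi i, dist_eq_norm, add_sub_cancel_left]
      simp only [this]
      rw [← Finset.sum_subtype (Finset.univ.erase j) (by simp) fun i => ‖Φ h i‖ ^ 2]
      exact Finset.sum_le_sum_of_subset_of_nonneg (Finset.erase_subset _ _)
        fun i _ _ => by positivity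
    have hjn : |Φ h j| ≤ ‖h‖ := by
      rw [← Φ.norm_map h]; exact abs_apply_le_norm _ _
    rw [Real.dist_eq] at hlip
    have hlip2 := (abs_le.1 hlip).2
    have h2 : (δ : ℝ) * dist (WithLp.toLp 2 fun i : {i : Fin d // i ≠ j} => Φ (z - b) i.1)
        (WithLp.toLp 2 fun i : {i : Fin d // i ≠ j} => Φ (x - b) i.1) ≤ δ * ‖h‖ := by gcongr
    have h3 := (abs_le.1 hjn).1
    rw [hj]
    nlinarith
  · push Not at hb
    -- The ball misses the frontier and is connected, so it cannot meet both `D` and the complement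
    -- of the closure.
    have hball : Metric.ball a (R / 16) ⊆ D := by
      have hpre : IsPreconnected (Metric.ball a (R / 16)) :=
        (convex_ball a (R / 16)).isPreconnected
      have hcov : ∀ w ∈ Metric.ball a (R / 16), w ∈ D ∨ w ∈ (closure D)ᶜ := by
        intro w hw
        by_contra hcon
        rw [not_or, Set.notMem_compl_iff] at hcon
        have := hb w (by rw [hL.isOpen.frontier_eq]; exact ⟨hcon.2, hcon.1⟩)
        rw [Metric.mem_ball, dist_comm, dist_eq_norm] at hw
        linarith
      intro w hw
      by_contra hwD
      obtain ⟨v, -, hv1, hv2⟩ := hpre D (closure D)ᶜ hL.isOpen isClosed_closure.isOpen_compl hcov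
        ⟨a, Metric.mem_ball_self (by positivity), ha⟩ ⟨w, hw, (hcov w hw).resolve_left hwD⟩
      exact hv2 (subset_closure hv1)
    refine ⟨0, by simp, fun x hx hxa t ht htR z hz => hball ?_⟩
    have h1 := hcube _ _ t ht hz
    rw [smul_zero, add_zero] at h1
    rw [Metric.mem_ball, dist_eq_norm]
    have : z - a = (z - x) + (x - a) := by abel
    rw [this]
    refine (norm_add_le _ _).trans_lt ?_
    nlinarith [norm_nonneg (z - x)]

/-- A quantitative version of membership in the Zygmund space. -/
structure Good (n : ℕ) (D : Set (Euc d)) (l₀ : ℝ) (f : Euc d → 𝕜) (N : ℝ) : Prop where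
  locInt : LocallyIntegrableOn f D
  approx : ∀ c l, 0 < l → cube c l ⊆ D → ∃ P, ApproxOn n f N c l P
  mass : ∀ c l, l₀ ≤ l → cube c l ⊆ D → ∫⁻ x in cube c (l / 2), ‖f x‖ₑ ≤ ENNReal.ofReal N

theorem side_le (hd : 1 ≤ d) {D : Set (Euc d)} {Δ : ℝ} (hΔ : ∀ x ∈ D, ∀ y ∈ D, ‖x - y‖ ≤ Δ)
    {c : Euc d} {l : ℝ} (hl : 0 < l) (h : cube c l ⊆ D) : l ≤ 2 * Δ := by
  set e : Euc d := EuclideanSpace.single ⟨0, hd⟩ 1 with he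
  have hen : ‖e‖ = 1 := by simp [he]
  have h1 : c + (l / 2) • e ∈ cube c l := mem_cube_of_norm_sub_le (by
    rw [add_sub_cancel_left, norm_smul, hen, Real.norm_of_nonneg (by positivity)]; simp)
  have h2 := hΔ _ (h h1) _ (h (self_mem_cube c hl.le))
  rw [add_sub_cancel_left, norm_smul, hen, Real.norm_of_nonneg (by positivity)] at h2
  linarith

variable (𝕜) in
/-- The coefficients of the approximating polynomials on large cubes are bounded. -/
theorem exists_top_bound (hd : 1 ≤ d) (n : ℕ) {D : Set (Euc d)} {κ r Δ : ℝ}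
    (hD : ConeDomain D κ r Δ) : ∃ A : ℝ, 0 ≤ A ∧
    ∀ (f : Euc d → 𝕜) (N : ℝ), 0 ≤ N → Good n D (κ * r) f N → ∀ c l P, κ * r ≤ l →
      cube c l ⊆ D → ApproxOn n f N c l P → ∀ z ∈ D, ∀ α,
        ‖coeff α (affineSub z 1 P)‖ ≤ A * N := by
  have hκ := hD.κ_pos
  have hr := hD.r_pos
  have hΔ := hD.Δ_pos
  -- Chosen so that `M` times half of the minimal side `κ r` is `d + Δ`, which bounds the distance
  -- from `c` to the points of the unit cube about any `z` in `D`.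
  set M : ℝ := 2 * (d + Δ) / (κ * r) with hM
  obtain ⟨A, hA, hpb⟩ := exists_polyFun_bound 𝕜 d n M (by positivity)
  obtain ⟨A', hA', hcf⟩ := exists_coeff_bound 𝕜 d n
  set B : ℝ := A * (2 ^ d * ((2 * Δ) ^ n + ((κ * r) ^ d)⁻¹)) with hB
  refine ⟨A' * B, by positivity, ?_⟩
  intro f N hN hf c l P hl hc hP z hz α
  have hl0 : 0 < l := (by positivity : 0 < κ * r).trans_le hl
  have hlΔ := side_le hd hD.norm_sub_le hl0 hc
  have hsub : cube c (l / 2) ⊆ cube c l := cube_subset_cube (by simp; linarith)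
  have hint : ∫⁻ x in cube c (l / 2), ‖polyFun P x‖ₑ ≤
      ENNReal.ofReal (N * l ^ n * l ^ d + N) := by
    calc ∫⁻ x in cube c (l / 2), ‖polyFun P x‖ₑ
        ≤ ∫⁻ x in cube c (l / 2), (‖f x - polyFun P x‖ₑ + ‖f x‖ₑ) := by
          refine lintegral_mono fun x => ?_
          have : polyFun P x = f x - (f x - polyFun P x) := by ring
          conv_lhs => rw [this]
          rw [add_comm]
          exact enorm_sub_le
      _ = (∫⁻ x in cube c (l / 2), ‖f x - polyFun P x‖ₑ) + ∫⁻ x in cube c (l / 2), ‖f x‖ₑ :=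
          lintegral_add_left' (aemeasurable_enorm_sub_polyFun
            (hP.meas.mono_measure (Measure.restrict_mono hsub le_rfl)) P) _
      _ ≤ ENNReal.ofReal (N * l ^ n * l ^ d) + ENNReal.ofReal N :=
          add_le_add ((lintegral_mono_set hsub).trans hP.le) (hf.mass c l hl hc)
      _ = _ := by rw [← ENNReal.ofReal_add (by positivity) hN]
  have hsup : ∀ y ∈ cube z 1, ‖polyFun P y‖ ≤ B * N := by
    intro y hy
    have hyc : ‖y - c‖ ≤ M * (l / 2) := by
      have h1 := norm_sub_le_of_mem_cube hy
      have h2 := hD.norm_sub_le z hz c (hc (self_mem_cube c hl0.le))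
      have h3 : y - c = (y - z) + (z - c) := by abel
      rw [h3]
      refine (norm_add_le _ _).trans ?_
      have h4 : M * (κ * r / 2) ≤ M * (l / 2) := by gcongr
      have h5 : M * (κ * r / 2) = d + Δ := by rw [hM]; field_simp
      have hd0 : (0 : ℝ) ≤ d := Nat.cast_nonneg d
      linarith
    have h6 := hpb P hP.deg c y (l / 2) (by positivity) hyc
    have h7 : ‖polyFun P y‖ ≤ A * (2 ^ d * (l ^ n + (l ^ d)⁻¹)) * N := by
      refine le_of_enorm_mul_le (V := (l / 2) ^ d) (by positivity) (by positivity) (h6.trans ?_)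
      refine (mul_le_mul_right hint _).trans ?_
      rw [← ENNReal.ofReal_mul hA]
      apply le_of_eq
      congr 1
      rw [div_pow]
      field_simp
    refine h7.trans ?_
    rw [hB]
    gcongr
  have h8 := hcf P hP.deg z 1 (B * N) one_pos hsup α
  simpa [mul_assoc] using h8

variable (𝕜) in
/-- Comparison of the approximating polynomial on a cube with those on the cubes of a cone with
vertex at its center. -/
theorem exists_cone_bound (n : ℕ) {D : Set (Euc d)} {κ r Δ : ℝ}
    (hD : ConeDomain D κ r Δ) : ∃ A : ℝ, 0 ≤ A ∧
    ∀ (f : Euc d → 𝕜) (N : ℝ) (x e : Euc d) (l t : ℝ) (P P' : MvPolynomial (Fin d) 𝕜),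
      0 ≤ N → ‖e‖ ≤ 1 → 0 < l → l / 4 ≤ t →
      (∀ u, 0 < u → u ≤ t → ∃ R, ApproxOn n f N (x + u • e) (κ * u) R) →
      ApproxOn n f N x l P → ApproxOn n f N (x + t • e) (κ * t) P' →
      ∀ α : Fin d →₀ ℕ, α.degree ≤ n →
        ‖coeff α (affineSub x 1 (P - P'))‖ ≤ A * N * chainWeight n α.degree (l / 4) t := by
  have hκ := hD.κ_pos
  have hκ1 := hD.κ_le
  set M : ℝ := 4 * (d + 1) / κ with hM
  obtain ⟨A₁, hA₁, hcmp⟩ := exists_compare_bound 𝕜 d n M (by positivity)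
  obtain ⟨A₂, hA₂, hcf⟩ := exists_coeff_bound 𝕜 d n
  obtain ⟨A₃, hA₃, hch⟩ := exists_chain_bound 𝕜 d n κ hκ hκ1
  refine ⟨A₂ * A₁ * 4 ^ n + A₃, by positivity, ?_⟩
  intro f N x e l t P P' hN he hl hlt hfam hP hP' α hα
  -- At height `l / 4` the cone cube is still contained in the cube of side `l` about `x`. From
  -- there on the comparison is along the chain.
  obtain ⟨R, hR⟩ := hfam (l / 4) (by positivity) hlt
  have hMl : M * (κ * (l / 4)) = (d + 1) * l := by rw [hM]; field_simp
  have ht : 0 < t := (by positivity : 0 < l / 4).trans_le hlt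
  have hd0 : (0 : ℝ) ≤ d := Nat.cast_nonneg d
  have hen : ‖(l / 4) • e‖ ≤ l / 4 := by
    rw [norm_smul, Real.norm_of_nonneg (by positivity)]
    nlinarith
  have hsup : ∀ y ∈ cube x l, ‖polyFun (P - R) y‖ ≤ A₁ * N * l ^ n := by
    intro y hy
    refine (hcmp f N x (x + (l / 4) • e) (x + (l / 4) • e) l (κ * (l / 4)) (κ * (l / 4)) P R hN hP hR
      hl.le (by positivity) (by positivity) ?_ ?_ ?_ subset_rfl y ?_).trans ?_
    · rw [hMl]; nlinarith
    · rw [hMl]; nlinarith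
    · refine cube_subset_cube ?_
      rw [add_sub_cancel_left]
      nlinarith
    · have h1 := norm_sub_le_of_mem_cube hy
      rw [← sub_sub, hMl]
      refine (norm_sub_le _ _).trans ?_
      nlinarith
    · gcongr
      nlinarith
  have h1 := hcf (P - R) (totalDegree_sub_le hP.deg hR.deg) x l _ hl hsup α
  have h2 : ‖coeff α (affineSub x 1 (P - R))‖ ≤ A₂ * A₁ * N * l ^ (n - α.degree) := by
    have h3 : l ^ n = l ^ (n - α.degree) * l ^ α.degree := by rw [← pow_add]; congr 1; omega
    refine le_of_mul_le_mul_right (h1.trans_eq ?_) (pow_pos hl α.degree)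
    rw [h3]
    ring
  have h4 := hch f N x e (l / 4) t R P' hN he (by positivity) hlt hfam hR hP' α hα
  have e4 : affineSub x 1 (P - P') = affineSub x 1 (P - R) + affineSub x 1 (R - P') := by
    rw [show P - P' = (P - R) + (R - P') by ring]; simp [affineSub]
  rw [e4, coeff_add]
  refine (norm_add_le _ _).trans ?_
  have h5 : l ^ (n - α.degree) ≤ 4 ^ n * chainWeight n α.degree (l / 4) t := by
    have h6 : l ^ (n - α.degree) ≤ (4 * t) ^ (n - α.degree) := by
      gcongr
      linarith
    have h7 : t ^ (n - α.degree) ≤ chainWeight n α.degree (l / 4) t := by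
      have h0 : 0 ≤ Real.log (t / (l / 4)) :=
        Real.log_nonneg ((one_le_div (by positivity)).2 hlt)
      unfold chainWeight
      refine le_mul_of_one_le_right (by positivity) ?_
      split_ifs <;> linarith
    refine h6.trans ?_
    rw [mul_pow]
    gcongr
    · norm_num
    · omega
  have h8 : A₂ * A₁ * N * l ^ (n - α.degree) ≤
      A₂ * A₁ * N * (4 ^ n * chainWeight n α.degree (l / 4) t) := by gcongr
  refine (add_le_add (h2.trans h8) h4).trans_eq ?_
  ring

end Domain

/-! ### Coefficient growth, boundedness, growth off a cube and Hölder continuity. -/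

section Growth

open MvPolynomial

/-- Since `log(1/l) = log(ρ/l) - log ρ` and `ρ` is bounded below, the logarithm of the side is
absorbed by the one in the growth bound when `ρ` is comparable with the domain. -/
theorem log_le_of_le {l ρ₀ ρ : ℝ} (hl : 0 < l) (hρ₀ : 0 < ρ₀) (hρ : ρ₀ ≤ ρ) (hlρ : l ≤ ρ) :
    max 1 (Real.log (1 / l)) ≤ (1 + |Real.log ρ₀|) * (1 + Real.log (ρ / l)) := by
  have hρp : 0 < ρ := hρ₀.trans_le hρ
  have h0 : 0 ≤ Real.log (ρ / l) := Real.log_nonneg ((one_le_div hl).2 hlρ)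
  have h1 : Real.log (1 / l) = Real.log (ρ / l) - Real.log ρ := by
    rw [Real.log_div one_ne_zero hl.ne', Real.log_div hρp.ne' hl.ne', Real.log_one]
    ring
  have h2 : Real.log ρ₀ ≤ Real.log ρ := Real.log_le_log hρ₀ hρ
  have h3 := neg_abs_le (Real.log ρ₀)
  have h4 := abs_nonneg (Real.log ρ₀)
  refine max_le (by nlinarith) ?_
  rw [h1]
  nlinarith

variable (𝕜) in
/-- The coefficients of the approximating polynomials, at the centers of the cubes: those of
order less than `n` are bounded, those of order `n` grow at most logarithmically. -/
theorem exists_center_coeff_bound (hd : 1 ≤ d) (n : ℕ) {D : Set (Euc d)} {κ r Δ : ℝ}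
    (hD : ConeDomain D κ r Δ) : ∃ A : ℝ, 0 ≤ A ∧
    ∀ (f : Euc d → 𝕜) (N : ℝ), 0 ≤ N → Good n D (κ * r) f N → ∀ c l P, 0 < l →
      cube c l ⊆ D → ApproxOn n f N c l P → ∀ α : Fin d →₀ ℕ, α.degree ≤ n →
        ‖coeff α (affineSub c 1 P)‖ ≤
          A * N * if α.degree < n then 1 else max 1 (Real.log (1 / l)) := by
  have hκ := hD.κ_pos
  have hκ1 := hD.κ_le
  have hr := hD.r_pos
  obtain ⟨A₁, hA₁, htop⟩ := exists_top_bound 𝕜 hd n hD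
  obtain ⟨A₂, hA₂, hcone⟩ := exists_cone_bound 𝕜 n hD
  set W : ℝ := r ^ n + 2 + |Real.log (4 * r)| with hW
  have hW1 : 1 ≤ W := by
    have : 0 < r ^ n := by positivity
    have := abs_nonneg (Real.log (4 * r))
    linarith
  refine ⟨A₁ + A₂ * (1 + r) ^ n * W, by positivity, ?_⟩
  intro f N hN hf c l P hl hc hP α hα
  have hcD : c ∈ D := hc (self_mem_cube c hl.le)
  have hif : (1 : ℝ) ≤ if α.degree < n then 1 else max 1 (Real.log (1 / l)) := by
    split_ifs
    · exact le_rfl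
    · exact le_max_left _ _
  set w : ℝ := if α.degree < n then 1 else max 1 (Real.log (1 / l)) with hw
  by_cases hlr : κ * r ≤ l
  · have h1 := htop f N hN hf c l P hlr hc hP c hcD α
    refine h1.trans ?_
    have h2 : A₁ * N ≤ A₁ * N * w := le_mul_of_one_le_right (by positivity) hif
    have h3 : 0 ≤ A₂ * (1 + r) ^ n * W * N * w := by positivity
    nlinarith
  · push Not at hlr
    have hlr4 : l / 4 ≤ r := by nlinarith
    obtain ⟨e, he, hcn⟩ := hD.cone c hcD
    have hfam : ∀ u, 0 < u → u ≤ r → ∃ R, ApproxOn n f N (c + u • e) (κ * u) R := fun u hu hur =>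
      hf.approx _ _ (by positivity) (hcn c hcD (by simp [hr.le]) u hu hur)
    obtain ⟨R, hR⟩ := hfam r hr le_rfl
    have h1 := htop f N hN hf _ _ R le_rfl (hcn c hcD (by simp [hr.le]) r hr le_rfl) hR c hcD α
    have h2 := hcone f N c e l r P R hN he hl hlr4 hfam hP hR α hα
    have h3 : chainWeight n α.degree (l / 4) r ≤ (1 + r) ^ n * W * w := by
      unfold chainWeight
      have h4 : r ^ (n - α.degree) ≤ (1 + r) ^ n :=
        (pow_le_pow_left₀ hr.le (by linarith) _).trans
          (pow_le_pow_right₀ (by linarith) (by omega))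
      rw [mul_assoc]
      refine mul_le_mul h4 ?_ ?_ (by positivity)
      · rw [hw]
        split_ifs with hα'
        · linarith
        · have h5 : Real.log (r / (l / 4)) = Real.log (4 * r) + Real.log (1 / l) := by
            rw [← Real.log_mul (by positivity) (by positivity)]
            congr 1
            field_simp
          have h6 := le_abs_self (Real.log (4 * r))
          have h7 := le_max_left 1 (Real.log (1 / l))
          have h8 := le_max_right 1 (Real.log (1 / l))
          have h9 : 0 < r ^ n := by positivity
          have h10 := abs_nonneg (Real.log (4 * r))
          rw [h5, hW]
          nlinarith
      · have h0 : 0 ≤ Real.log (r / (l / 4)) :=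
          Real.log_nonneg ((one_le_div (by positivity)).2 hlr4)
        split_ifs <;> linarith
    have e4 : affineSub c 1 P = affineSub c 1 (P - R) + affineSub c 1 R := by
      rw [affineSub_sub]; ring
    rw [e4, coeff_add]
    refine (norm_add_le _ _).trans ?_
    have h11 : A₂ * N * chainWeight n α.degree (l / 4) r ≤
        A₂ * N * ((1 + r) ^ n * W * w) := by gcongr
    have h12 : A₁ * N ≤ A₁ * N * w := le_mul_of_one_le_right (by positivity) hif
    nlinarith

variable (𝕜) in
/-- Functions in the Zygmund space are bounded. -/
theorem exists_sup_bound (hd : 1 ≤ d) (n : ℕ) (hn : 1 ≤ n) {D : Set (Euc d)} {κ r Δ : ℝ}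
    (hD : ConeDomain D κ r Δ) : ∃ A : ℝ, 0 ≤ A ∧
    ∀ (f : Euc d → 𝕜) (N : ℝ), 0 ≤ N → Good n D (κ * r) f N → ∀ x ∈ D, LebesguePt f x →
      ‖f x‖ ≤ A * N := by
  have hκ := hD.κ_pos
  have hr := hD.r_pos
  obtain ⟨A₁, hA₁, htop⟩ := exists_top_bound 𝕜 hd n hD
  obtain ⟨A₂, hA₂, hlim⟩ := exists_chain_limit_bound 𝕜 d n hn κ hκ hD.κ_le
  refine ⟨A₁ + A₂ * r ^ n, by positivity, ?_⟩
  intro f N hN hf x hx hL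
  obtain ⟨e, he, hcn⟩ := hD.cone x hx
  have hfam : ∀ u, 0 < u → u ≤ r → ∃ R, ApproxOn n f N (x + u • e) (κ * u) R := fun u hu hur =>
    hf.approx _ _ (by positivity) (hcn x hx (by simp [hr.le]) u hu hur)
  obtain ⟨R, hR⟩ := hfam r hr le_rfl
  have h1 := htop f N hN hf _ _ R le_rfl (hcn x hx (by simp [hr.le]) r hr le_rfl) hR x hx 0
  rw [← polyFun_eq_coeff_zero] at h1
  have h2 := hlim f N x e r R hN he hr hL hfam hR
  have h3 : f x = (f x - polyFun R x) + polyFun R x := by ring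
  rw [h3]
  refine (norm_add_le _ _).trans ?_
  nlinarith

set_option maxHeartbeats 1000000 in
variable (𝕜) in
/-- The growth of a function in the Zygmund space away from a cube, relative to its approximating
polynomial on the cube. -/
theorem exists_growth_bound (hd : 1 ≤ d) (n : ℕ) (hn : 1 ≤ n) {D : Set (Euc d)} {κ r Δ : ℝ}
    (hD : ConeDomain D κ r Δ) : ∃ A : ℝ, 0 ≤ A ∧
    ∀ (f : Euc d → 𝕜) (N : ℝ), 0 ≤ N → Good n D (κ * r) f N → ∀ c l P, 0 < l →
      cube c l ⊆ D → ApproxOn n f N c l P → ∀ x ∈ D, LebesguePt f x →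
      ∀ ρ, l ≤ ρ → ‖x - c‖ ≤ ρ →
        ‖f x - polyFun P x‖ ≤ A * N * ρ ^ n * (1 + Real.log (ρ / l)) := by
  have hκ := hD.κ_pos
  have hκ1 := hD.κ_le
  have hr := hD.r_pos
  have hΔ := hD.Δ_pos
  obtain ⟨A₁, hA₁, hsb⟩ := exists_sup_bound 𝕜 hd n hn hD
  obtain ⟨A₂, hA₂, hcc⟩ := exists_center_coeff_bound 𝕜 hd n hD
  obtain ⟨A₃, hA₃, hcone⟩ := exists_cone_bound 𝕜 n hD
  obtain ⟨A₄, hA₄, hlim⟩ := exists_chain_limit_bound 𝕜 d n hn κ hκ hκ1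
  obtain ⟨A₅, hA₅, hcmp⟩ := exists_compare_bound 𝕜 d n (2 / κ) (by positivity)
  set I : ℝ := ((multiIdx d n).card : ℝ) with hI
  have hI0 : 0 ≤ I := Nat.cast_nonneg _
  clear_value I
  set B₁ : ℝ := (I * A₃ * (1 + Real.log (16 / κ)) + A₅ + A₄) * (4 / κ) ^ n with hB₁
  set B₂ : ℝ := (A₁ + I * A₂ * (1 + Δ) ^ n) * ((κ * r / 4) ^ n)⁻¹ * (1 + |Real.log (κ * r / 4)|)
    with hB₂
  have hlogκ : 0 ≤ Real.log (16 / κ) :=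
    Real.log_nonneg ((one_le_div hκ).2 (by linarith))
  have hB₁0 : 0 ≤ B₁ := by positivity
  have hB₂0 : 0 ≤ B₂ := by positivity
  refine ⟨B₁ + B₂, by positivity, ?_⟩
  intro f N hN hf c l P hl hc hP x hx hL ρ hlρ hxρ
  have hρ : 0 < ρ := hl.trans_le hlρ
  have hcD : c ∈ D := hc (self_mem_cube c hl.le)
  have hlog0 : 0 ≤ Real.log (ρ / l) := Real.log_nonneg ((one_le_div hl).2 hlρ)
  set Lg : ℝ := 1 + Real.log (ρ / l) with hLg
  have hLg1 : 1 ≤ Lg := by linarith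
  -- At small scales the path goes up the cone at `c` to height `t = 4ρ/κ`, across to the cone at
  -- `x` with the same axis, and down to `x`. At large scales the bounds for `f` and for the
  -- coefficients of `P` suffice.
  by_cases hcase : 4 * ρ / κ ≤ r
  · suffices h : ‖f x - polyFun P x‖ ≤ B₁ * N * ρ ^ n * Lg by
      refine h.trans ?_
      have : 0 ≤ B₂ * N * ρ ^ n * Lg := by positivity
      nlinarith
    set t : ℝ := 4 * ρ / κ with ht
    have ht0 : 0 < t := by positivity
    have htρ : ρ ≤ t := by rw [ht, le_div_iff₀ hκ]; nlinarith
    have hκt : κ * t = 4 * ρ := by rw [ht]; field_simp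
    obtain ⟨e, he, hcn⟩ := hD.cone c hcD
    have hxr : ‖x - c‖ ≤ r := hxρ.trans (htρ.trans hcase)
    have hfam : ∀ u, 0 < u → u ≤ t → ∃ R, ApproxOn n f N (c + u • e) (κ * u) R := fun u hu hut =>
      hf.approx _ _ (by positivity) (hcn c hcD (by simp [hr.le]) u hu (hut.trans hcase))
    have hfam' : ∀ u, 0 < u → u ≤ t → ∃ R, ApproxOn n f N (x + u • e) (κ * u) R := fun u hu hut =>
      hf.approx _ _ (by positivity) (hcn x hx hxr u hu (hut.trans hcase))
    obtain ⟨R, hR⟩ := hfam t ht0 le_rfl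
    obtain ⟨R', hR'⟩ := hfam' t ht0 le_rfl
    have hlt : l / 4 ≤ t := by linarith
    have hlogt : Real.log (t / (l / 4)) = Real.log (16 / κ) + Real.log (ρ / l) := by
      rw [← Real.log_mul (by positivity) (by positivity)]
      congr 1
      rw [ht]
      field_simp
      ring
    have h1 : ‖polyFun (P - R) x‖ ≤ I * (A₃ * N * t ^ n * ((1 + Real.log (16 / κ)) * Lg)) := by
      refine (norm_polyFun_le (totalDegree_sub_le hP.deg hR.deg) c x).trans ?_
      rw [hI, ← nsmul_eq_mul]
      refine Finset.sum_le_card_nsmul _ _ _ fun α hα => ?_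
      have hα' := mem_multiIdx.1 hα
      have h2 := hcone f N c e l t P R hN he hl hlt hfam hP hR α hα'
      have h3 := chainWeight_le (n := n) (k := α.degree) (show 0 < l / 4 by positivity) hlt
      have h4 : t ^ n = t ^ (n - α.degree) * t ^ α.degree := by rw [← pow_add]; congr 1; omega
      have h5 : 1 + Real.log (t / (l / 4)) ≤ (1 + Real.log (16 / κ)) * Lg := by
        rw [hlogt, hLg]
        nlinarith
      have h0 : 0 ≤ 1 + Real.log (t / (l / 4)) := by rw [hlogt]; linarith
      calc _ ≤ (A₃ * N * chainWeight n α.degree (l / 4) t) * t ^ α.degree := by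
            have := chainWeight_nonneg (n := n) (k := α.degree) (show 0 < l / 4 by positivity) hlt
            gcongr
            exact hxρ.trans htρ
        _ ≤ (A₃ * N * (t ^ (n - α.degree) * ((1 + Real.log (16 / κ)) * Lg))) * t ^ α.degree := by
            gcongr
            exact h3.trans (by gcongr)
        _ = _ := by rw [h4]; ring
    -- Both cubes have side `κ t = 4ρ` and their centers are at distance at most `ρ`, so the cube of
    -- side `2ρ` about `x + t • e` lies in both.
    have h6 : ‖polyFun (R - R') x‖ ≤ A₅ * N * t ^ n := by
      refine (hcmp f N (c + t • e) (x + t • e) (x + t • e) (κ * t) (κ * t) (κ * t / 2) R R' hN hR hR'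
        (by positivity) (by positivity) (by positivity) ?_ ?_ ?_ ?_ x ?_).trans ?_
      · rw [show 2 / κ * (κ * t / 2) = t by field_simp]; nlinarith
      · rw [show 2 / κ * (κ * t / 2) = t by field_simp]; nlinarith
      · refine cube_subset_cube ?_
        rw [add_sub_add_right_eq_sub]
        linarith
      · refine cube_subset_cube ?_
        rw [sub_self, norm_zero]
        nlinarith
      · rw [show 2 / κ * (κ * t / 2) = t by field_simp, sub_add_cancel_left, norm_neg, norm_smul,
          Real.norm_of_nonneg ht0.le]
        nlinarith
      · gcongr
        nlinarith
    have h7 := hlim f N x e t R' hN he ht0 hL hfam' hR'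
    have h8 : f x - polyFun P x =
        (f x - polyFun R' x) - polyFun (R - R') x - polyFun (P - R) x := by
      rw [polyFun_sub, polyFun_sub]; ring
    have htn : t ^ n = (4 / κ) ^ n * ρ ^ n := by rw [← mul_pow, ht]; congr 1; ring
    rw [h8]
    refine (norm_sub_le _ _).trans ((add_le_add (norm_sub_le _ _) le_rfl).trans ?_)
    have h9 : A₄ * N * t ^ n ≤ A₄ * N * t ^ n * Lg := le_mul_of_one_le_right (by positivity) hLg1
    have h10 : A₅ * N * t ^ n ≤ A₅ * N * t ^ n * Lg := le_mul_of_one_le_right (by positivity) hLg1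
    calc _ ≤ A₄ * N * t ^ n * Lg + A₅ * N * t ^ n * Lg +
          I * (A₃ * N * t ^ n * ((1 + Real.log (16 / κ)) * Lg)) := by linarith
      _ = _ := by rw [hB₁, htn]; ring
  · suffices h : ‖f x - polyFun P x‖ ≤ B₂ * N * ρ ^ n * Lg by
      refine h.trans ?_
      have : 0 ≤ B₁ * N * ρ ^ n * Lg := by positivity
      nlinarith
    push Not at hcase
    have hρ0 : κ * r / 4 ≤ ρ := by
      rw [lt_div_iff₀ hκ] at hcase
      linarith
    have h1 := hsb f N hN hf x hx hL
    have hmax := log_le_of_le hl (by positivity : 0 < κ * r / 4) hρ0 hlρ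
    rw [← hLg] at hmax
    have h2 : ‖polyFun P x‖ ≤ I * (A₂ * N * max 1 (Real.log (1 / l)) * (1 + Δ) ^ n) := by
      refine (norm_polyFun_le hP.deg c x).trans ?_
      rw [hI, ← nsmul_eq_mul]
      refine Finset.sum_le_card_nsmul _ _ _ fun α hα => ?_
      have hα' := mem_multiIdx.1 hα
      have h3 := hcc f N hN hf c l P hl hc hP α hα'
      have h4 : (if α.degree < n then 1 else max 1 (Real.log (1 / l))) ≤
          max 1 (Real.log (1 / l)) := by
        split_ifs
        · exact le_max_left _ _
        · exact le_rfl
      have h5 : ‖x - c‖ ^ α.degree ≤ (1 + Δ) ^ n :=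
        (pow_le_pow_left₀ (norm_nonneg _) ((hD.norm_sub_le x hx c hcD).trans (by linarith)) _).trans
          (pow_le_pow_right₀ (by linarith) hα')
      refine mul_le_mul (h3.trans (by gcongr)) h5 (by positivity) ?_
      have : (0 : ℝ) ≤ max 1 (Real.log (1 / l)) := zero_le_one.trans (le_max_left _ _)
      positivity
    have hρn : 1 ≤ ((κ * r / 4) ^ n)⁻¹ * ρ ^ n := by
      rw [← inv_pow, ← mul_pow]
      refine one_le_pow₀ ?_
      rw [inv_mul_eq_div, one_le_div (by positivity)]
      exact hρ0
    have hm1 := le_max_left 1 (Real.log (1 / l))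
    set mx := max 1 (Real.log (1 / l))
    have hmx0 : 0 ≤ mx := zero_le_one.trans hm1
    refine (norm_sub_le _ _).trans ?_
    calc ‖f x‖ + ‖polyFun P x‖ ≤ A₁ * N * mx + I * (A₂ * N * mx * (1 + Δ) ^ n) := by
          have : A₁ * N ≤ A₁ * N * mx := le_mul_of_one_le_right (by positivity) hm1
          linarith
      _ = ((A₁ + I * A₂ * (1 + Δ) ^ n) * N * mx) * 1 := by ring
      _ ≤ ((A₁ + I * A₂ * (1 + Δ) ^ n) * N * ((1 + |Real.log (κ * r / 4)|) * Lg)) *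
          (((κ * r / 4) ^ n)⁻¹ * ρ ^ n) := by gcongr
      _ = _ := by rw [hB₂]; ring

/-- Trades the logarithm for a power, here the square root, so that all later integrals are of pure
powers. -/
theorem mul_one_add_log_le_sqrt {v : ℝ} (hv : 0 < v) :
    v * (1 + Real.log (1 / v)) ≤ 2 * √v := by
  have hs : 0 < √v := Real.sqrt_pos.2 hv
  have h1 : Real.log (1 / v) = 2 * Real.log (1 / √v) := by
    rw [one_div, one_div, Real.log_inv, Real.log_inv, Real.log_sqrt hv.le]; ring
  have h2 : Real.log (1 / √v) ≤ 1 / √v - 1 := Real.log_le_sub_one_of_pos (by positivity)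
  have h3 : v * (1 / √v) = √v := by
    rw [mul_one_div]; exact Real.div_sqrt
  rw [h1]
  nlinarith

theorem one_add_log_le_sqrt {u : ℝ} (hu : 0 < u) : 1 + Real.log u ≤ 2 * √u := by
  have hs : 0 < √u := Real.sqrt_pos.2 hu
  have h1 : Real.log u = 2 * Real.log (√u) := by
    rw [Real.log_sqrt hu.le]; ring
  have h2 : Real.log (√u) ≤ √u - 1 := Real.log_le_sub_one_of_pos (by positivity)
  rw [h1]
  linarith

set_option maxHeartbeats 1000000 in
variable (𝕜) in
/-- Hölder continuity, inside a cube, of the difference of a function in the Zygmund space and its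
approximating polynomial on the cube. -/
theorem exists_holder_bound (hd : 1 ≤ d) (n : ℕ) (hn : 1 ≤ n) {D : Set (Euc d)} {κ r Δ : ℝ}
    (hD : ConeDomain D κ r Δ) : ∃ A : ℝ, 0 ≤ A ∧
    ∀ (f : Euc d → 𝕜) (N : ℝ), 0 ≤ N → Good n D (κ * r) f N → ∀ c l P, 0 < l →
      cube c l ⊆ D → ApproxOn n f N c l P → ∀ y δ, 0 < δ → cube y (2 * δ) ⊆ cube c l →
      LebesguePt f y → ∀ x, LebesguePt f x → ‖x - y‖ ≤ δ →
        ‖(f x - polyFun P x) - (f y - polyFun P y)‖ ≤ A * N * l ^ n * √(‖x - y‖ / δ) := by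
  obtain ⟨A₁, hA₁, hgr⟩ := exists_growth_bound 𝕜 hd n hn hD
  obtain ⟨A₂, hA₂, hlim⟩ := exists_chain_limit_bound 𝕜 d n hn 1 one_pos le_rfl
  obtain ⟨A₃, hA₃, hch⟩ := exists_chain_bound 𝕜 d n 1 one_pos le_rfl
  obtain ⟨A₄, hA₄, hcmp⟩ := exists_compare_bound 𝕜 d n (d + 1) (by positivity)
  obtain ⟨A₅, hA₅, hcf⟩ := exists_coeff_bound 𝕜 d n
  set I : ℝ := (((multiIdx d n).erase 0).card : ℝ) with hI
  have hI0 : 0 ≤ I := Nat.cast_nonneg _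
  clear_value I
  have hd1 : (1 : ℝ) ≤ d := by exact_mod_cast hd
  have hlogd : 0 ≤ Real.log d := Real.log_nonneg hd1
  set B : ℝ := A₁ * d ^ n * (1 + Real.log d) + 1 with hB
  have hB0 : 0 ≤ B := by positivity
  refine ⟨(A₁ + A₂) + I * A₃ * 2 + I * (A₅ * (A₄ * B)), by positivity, ?_⟩
  intro f N hN hf c l P hl hc hP y δ hδ hyδ hLy x hLx hxy
  rcases eq_or_ne x y with rfl | hne
  · simp
  have hxy0 : 0 < ‖x - y‖ := norm_pos_iff.2 (sub_ne_zero.2 hne)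
  set s : ℝ := 2 * ‖x - y‖ with hs
  have hs0 : 0 < s := by positivity
  set t : ℝ := 2 * δ with ht
  have ht0 : 0 < t := by positivity
  have hst : s ≤ t := by rw [hs, ht]; linarith
  set v : ℝ := s / t with hv
  have hvx : ‖x - y‖ / δ = v := by rw [hv, hs, ht]; field_simp
  have hv0 : 0 < v := by positivity
  have hv1 : v ≤ 1 := (div_le_one ht0).2 hst
  have hsv : s = v * t := by rw [hv]; field_simp
  have hvs : v ≤ √v := Real.le_sqrt_of_sq_le (by nlinarith)
  rw [hvx]
  have htl : t ≤ l := le_of_cube_subset hd ht0.le hyδ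
  have hcubes : ∀ u, u ≤ t → cube y u ⊆ D := fun u hu =>
    (cube_subset_cube (by simpa using by linarith)).trans (hyδ.trans hc)
  have hfam0 : ∀ u, 0 < u → u ≤ t → ∃ R, ApproxOn n f N y u R := fun u hu hut =>
    hf.approx y u hu (hcubes u hut)
  have hfam : ∀ u, 0 < u → u ≤ t → ∃ R, ApproxOn n f N (y + u • (0 : Euc d)) (1 * u) R := by
    simpa using hfam0
  obtain ⟨R, hR⟩ := hfam0 s hs0 hst
  obtain ⟨R', hR'⟩ := hfam0 t ht0 le_rfl
  have hxt : x ∈ cube y t := mem_cube_of_norm_sub_le (by rw [ht]; linarith)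
  have hxD : x ∈ D := hcubes t le_rfl hxt
  have hsn : s ^ n ≤ l ^ n * √v := by
    rw [hsv, mul_pow]
    have h1 : v ^ n ≤ v := by
      calc v ^ n ≤ v ^ 1 := pow_le_pow_of_le_one hv0.le hv1 hn
        _ = v := pow_one v
    have h2 : t ^ n ≤ l ^ n := by gcongr
    calc v ^ n * t ^ n ≤ √v * l ^ n := by
          gcongr
          exact h1.trans hvs
      _ = _ := by ring
  have ha : ‖f y - polyFun R y‖ ≤ A₂ * N * s ^ n :=
    hlim f N y 0 s R hN (by simp) hs0 hLy (fun u hu hus => hfam u hu (hus.trans hst))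
      (by simpa using hR)
  have hb : ‖f x - polyFun R x‖ ≤ A₁ * N * s ^ n := by
    have := hgr f N hN hf y s R hs0 (hcubes s hst) hR x hxD hLx s le_rfl (by rw [hs]; linarith)
    simpa [div_self hs0.ne'] using this
  -- The constant term drops out of the difference. A term of order `k ≥ 1` contributes at most
  -- `t^(n-k) (1 + log(1/v)) s^k` up to constants, where `s = v t`; the factor `v^k ≤ v` absorbs the
  -- logarithm.
  have hcc : ‖polyFun (R - R') x - polyFun (R - R') y‖ ≤ I * (A₃ * N * l ^ n * (2 * √v)) := by
    refine (norm_polyFun_sub_le (totalDegree_sub_le hR.deg hR'.deg) y x).trans ?_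
    rw [hI, ← nsmul_eq_mul]
    refine Finset.sum_le_card_nsmul _ _ _ fun α hα => ?_
    obtain ⟨hα0, hα1⟩ := Finset.mem_erase.1 hα
    have hα' := mem_multiIdx.1 hα1
    have hα1' : 1 ≤ α.degree := Nat.one_le_iff_ne_zero.2 fun h =>
      hα0 (by simpa using (Finsupp.degree_eq_zero_iff α).1 h)
    have h2 := hch f N y 0 s t R R' hN (by simp) hs0 hst hfam (by simpa using hR)
      (by simpa using hR') α hα'
    have h3 := chainWeight_le (n := n) (k := α.degree) hs0 hst
    have h4 : t ^ n = t ^ (n - α.degree) * t ^ α.degree := by rw [← pow_add]; congr 1; omega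
    have hts : t / s = 1 / v := by rw [hv, one_div_div]
    have hlog : 0 ≤ Real.log (1 / v) := Real.log_nonneg ((one_le_div hv0).2 hv1)
    have h5 : v ^ α.degree ≤ v := by
      calc v ^ α.degree ≤ v ^ 1 := pow_le_pow_of_le_one hv0.le hv1 hα1'
        _ = v := pow_one v
    have h6 := mul_one_add_log_le_sqrt hv0
    rw [hts] at h3
    have hcw := chainWeight_nonneg (n := n) (k := α.degree) hs0 hst
    calc _ ≤ (A₃ * N * chainWeight n α.degree s t) * s ^ α.degree := by
          gcongr
          rw [hs]; linarith
      _ ≤ (A₃ * N * (t ^ (n - α.degree) * (1 + Real.log (1 / v)))) * s ^ α.degree := by gcongr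
      _ = A₃ * N * t ^ n * (v ^ α.degree * (1 + Real.log (1 / v))) := by
          rw [hsv, mul_pow, h4]; ring
      _ ≤ A₃ * N * l ^ n * (v * (1 + Real.log (1 / v))) := by gcongr
      _ ≤ A₃ * N * l ^ n * (2 * √v) := by gcongr
  -- The polynomial `P` belongs to the large cube. By the growth bound it also approximates `f` on
  -- the small cube of side `t`, but with error `N l^n` instead of `N t^n`; `N'` is the resulting
  -- constant, so that `N' t^n = B N l^n`.
  set N' : ℝ := B * N * l ^ n / t ^ n with hN'
  have hN'0 : 0 ≤ N' := by positivity
  have hNN' : N ≤ N' := by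
    rw [hN', le_div_iff₀ (by positivity)]
    have h1 : t ^ n ≤ l ^ n := by gcongr
    have h2 : 1 ≤ B := by
      have : 0 ≤ A₁ * d ^ n * (1 + Real.log d) := by positivity
      linarith
    calc N * t ^ n ≤ N * l ^ n := by gcongr
      _ ≤ B * (N * l ^ n) := le_mul_of_one_le_left (by positivity) h2
      _ = _ := by ring
  have hPt : ApproxOn n f N' y t P := by
    refine ⟨hP.deg, hP.meas.mono_measure (Measure.restrict_mono hyδ le_rfl), ?_⟩
    have h1 : ∀ᵐ z ∂volume.restrict (cube y t),
        ‖f z - polyFun P z‖ₑ ≤ ENNReal.ofReal (N' * t ^ n) := by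
      have h2 : ∀ᵐ z ∂volume.restrict (cube y t), LebesguePt f z :=
        ae_mono (Measure.restrict_mono (hyδ.trans hc) le_rfl) (ae_lebesguePt hD.isOpen hf.locInt)
      filter_upwards [h2, ae_restrict_mem (measurableSet_cube y t)] with z hz hzy
      have hzc : z ∈ cube c l := hyδ hzy
      have h3 := hgr f N hN hf c l P hl hc hP z (hc hzc) hz (d * l)
        (le_mul_of_one_le_left hl.le hd1)
        ((norm_sub_le_of_mem_cube hzc).trans (by nlinarith))
      rw [← ofReal_norm]
      refine ENNReal.ofReal_le_ofReal (h3.trans ?_)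
      rw [mul_div_cancel_right₀ _ hl.ne', hN', div_mul_cancel₀ _ (by positivity), hB, mul_pow]
      have : 0 ≤ N * l ^ n := by positivity
      nlinarith
    refine (lintegral_mono_ae h1).trans ?_
    rw [lintegral_const, Measure.restrict_apply_univ, volume_cube _ _ ht0.le,
      ← ENNReal.ofReal_mul (by positivity)]
  have hR'N : ApproxOn n f N' y t R' :=
    ⟨hR'.deg, hR'.meas, hR'.le.trans (ENNReal.ofReal_le_ofReal (by gcongr))⟩
  have hN't : N' * t ^ n = B * N * l ^ n := by
    rw [hN', div_mul_cancel₀ _ (by positivity)]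
  have hsup : ∀ z ∈ cube y t, ‖polyFun (R' - P) z‖ ≤ A₄ * (B * N * l ^ n) := by
    intro z hz
    refine (hcmp f N' y y y t t t R' P hN'0 hR'N hPt ht0.le ht0.le ht0 (by nlinarith)
      (by nlinarith) subset_rfl subset_rfl z ?_).trans ?_
    · have := norm_sub_le_of_mem_cube hz
      nlinarith
    · rw [mul_assoc, hN't]
  have hdd : ‖polyFun (R' - P) x - polyFun (R' - P) y‖ ≤
      I * (A₅ * (A₄ * (B * N * l ^ n)) * √v) := by
    refine (norm_polyFun_sub_le (totalDegree_sub_le hR'.deg hP.deg) y x).trans ?_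
    rw [hI, ← nsmul_eq_mul]
    refine Finset.sum_le_card_nsmul _ _ _ fun α hα => ?_
    obtain ⟨hα0, hα1⟩ := Finset.mem_erase.1 hα
    have hα1' : 1 ≤ α.degree := Nat.one_le_iff_ne_zero.2 fun h =>
      hα0 (by simpa using (Finsupp.degree_eq_zero_iff α).1 h)
    have h1 := hcf (R' - P) (totalDegree_sub_le hR'.deg hP.deg) y t _ ht0 hsup α
    have h5 : v ^ α.degree ≤ √v := by
      calc v ^ α.degree ≤ v ^ 1 := pow_le_pow_of_le_one hv0.le hv1 hα1'
        _ = v := pow_one v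
        _ ≤ √v := hvs
    calc _ ≤ ‖coeff α (affineSub y 1 (R' - P))‖ * s ^ α.degree := by
          gcongr
          rw [hs]; linarith
      _ = (‖coeff α (affineSub y 1 (R' - P))‖ * t ^ α.degree) * v ^ α.degree := by
          rw [hsv, mul_pow]; ring
      _ ≤ (A₅ * (A₄ * (B * N * l ^ n))) * √v := by gcongr
  -- Three scales about `y`: `s = 2‖x - y‖` with polynomial `R`, `t = 2δ` with `R'`, and the given
  -- cube with `P`.
  have hsplit : (f x - polyFun P x) - (f y - polyFun P y) =
      (f x - polyFun R x) - (f y - polyFun R y) +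
      (polyFun (R - R') x - polyFun (R - R') y) + (polyFun (R' - P) x - polyFun (R' - P) y) := by
    simp only [polyFun_sub]; ring
  rw [hsplit]
  refine norm_add₃_le.trans ?_
  have h1 := norm_sub_le (f x - polyFun R x) (f y - polyFun R y)
  have h2 : A₁ * N * s ^ n + A₂ * N * s ^ n ≤ (A₁ + A₂) * N * (l ^ n * √v) := by
    rw [← add_mul, ← add_mul]
    gcongr
  calc _ ≤ (A₁ + A₂) * N * (l ^ n * √v) + I * (A₃ * N * l ^ n * (2 * √v)) +
        I * (A₅ * (A₄ * (B * N * l ^ n)) * √v) := by linarith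
    _ = _ := by ring

end Growth

/-! ### Uniform Taylor expansion on the unit sphere. -/

section Taylor

open MvPolynomial

/-- Uniform Taylor expansion at the points of the unit sphere. -/
theorem exists_taylor_sphere (n : ℕ) {F : Euc d → 𝕜} (hF : ContDiffOn ℝ (n + 1) F {0}ᶜ) :
    ∃ A : ℝ, 0 ≤ A ∧ ∀ u : Euc d, ‖u‖ = 1 → ∃ P : MvPolynomial (Fin d) 𝕜, P.totalDegree ≤ n ∧
      ∀ h : Euc d, ‖h‖ ≤ 1 / 2 → ‖F (u + h) - polyFun P h‖ ≤ A * ‖h‖ ^ (n + 1) := by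
  have hat : ∀ x : Euc d, x ≠ 0 → ContDiffAt ℝ (n + 1) F x := fun x hx =>
    hF.contDiffAt (isOpen_compl_singleton.mem_nhds hx)
  have hcont : ContinuousOn (iteratedFDeriv ℝ (n + 1) F) {0}ᶜ := fun x hx =>
    (((hat x hx).iteratedFDeriv_right (i := n + 1) (m := 0) (by simp)).continuousAt).continuousWithinAt
  -- Contains every segment of length at most `1/2` from the sphere and avoids the origin, so the
  -- derivative of order `n + 1` is bounded on it.
  have hK : IsCompact (Metric.closedBall (0 : Euc d) 2 ∩ {x | 1 / 2 ≤ ‖x‖}) :=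
    (isCompact_closedBall _ _).inter_right (isClosed_le continuous_const continuous_norm)
  have hsub : Metric.closedBall (0 : Euc d) 2 ∩ {x | 1 / 2 ≤ ‖x‖} ⊆ {0}ᶜ := by
    rintro x ⟨-, hx⟩ h0
    rw [Set.mem_singleton_iff] at h0
    rw [h0] at hx
    simp only [norm_zero, Set.mem_ofPred_eq] at hx
    norm_num at hx
  obtain ⟨A, hA⟩ := hK.exists_bound_of_continuousOn (hcont.mono hsub)
  refine ⟨max A 0, le_max_right _ _, fun u hu => ?_⟩
  choose p hp1 hp2 using fun k : ℕ => exists_poly_of_multilinear (iteratedFDeriv ℝ k F u)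
  refine ⟨∑ k ∈ Finset.range (n + 1), C (((Nat.factorial k : ℝ)⁻¹ : ℝ) : 𝕜) * p k, ?_, fun h hh => ?_⟩
  · refine totalDegree_finsetSum_le fun k hk => totalDegree_C_mul_le _ ((hp1 k).trans ?_)
    exact Nat.lt_succ_iff.1 (Finset.mem_range.1 hk)
  have hseg : ∀ t ∈ Set.Icc (0 : ℝ) 1, u + t • h ∈
      Metric.closedBall (0 : Euc d) 2 ∩ {x | 1 / 2 ≤ ‖x‖} := by
    intro t ht
    have h1 : ‖t • h‖ ≤ 1 / 2 := by
      rw [norm_smul, Real.norm_of_nonneg ht.1]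
      nlinarith [ht.2, norm_nonneg h]
    refine ⟨?_, ?_⟩
    · rw [mem_closedBall_zero_iff]
      refine (norm_add_le _ _).trans ?_
      linarith
    · have := norm_sub_norm_le u (-(t • h))
      rw [norm_neg, sub_neg_eq_add] at this
      simp only [Set.mem_ofPred_eq]
      linarith
  rw [map_add_eq_sum_add_integral_iteratedFDeriv (n := n) fun t ht => hat _ (hsub (hseg t ht))]
  have hsum : polyFun (∑ k ∈ Finset.range (n + 1), C (((Nat.factorial k : ℝ)⁻¹ : ℝ) : 𝕜) * p k) h =
      ∑ k ∈ Finset.range (n + 1), ((Nat.factorial k : ℝ)⁻¹) • iteratedFDeriv ℝ k F u fun _ => h := by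
    rw [polyFun_sum]
    refine Finset.sum_congr rfl fun k _ => ?_
    rw [polyFun_mul, polyFun_C, hp2, RCLike.real_smul_eq_coe_mul]
  rw [hsum, add_sub_cancel_left, norm_smul]
  have hfac : ‖((Nat.factorial n : ℝ)⁻¹)‖ ≤ 1 := by
    rw [norm_inv, Real.norm_of_nonneg (by positivity)]
    exact inv_le_one_of_one_le₀ (by exact_mod_cast Nat.one_le_iff_ne_zero.2 (Nat.factorial_ne_zero n))
  have hint : ‖∫ t in (0 : ℝ)..1, (1 - t) ^ n • iteratedFDeriv ℝ (n + 1) F (u + t • h) fun _ => h‖ ≤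
      max A 0 * ‖h‖ ^ (n + 1) * |1 - 0| := by
    refine intervalIntegral.norm_integral_le_of_norm_le_const fun t ht => ?_
    rw [Set.uIoc_of_le zero_le_one] at ht
    have ht' : t ∈ Set.Icc (0 : ℝ) 1 := ⟨ht.1.le, ht.2⟩
    rw [norm_smul]
    have h1 : ‖(1 - t) ^ n‖ ≤ 1 := by
      rw [norm_pow]
      refine pow_le_one₀ (norm_nonneg _) ?_
      rw [Real.norm_of_nonneg (by linarith [ht.2])]
      linarith [ht.1]
    have h2 := (iteratedFDeriv ℝ (n + 1) F (u + t • h)).le_opNorm fun _ => h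
    rw [Finset.prod_const, Finset.card_univ, Fintype.card_fin] at h2
    have h3 : ‖iteratedFDeriv ℝ (n + 1) F (u + t • h)‖ ≤ max A 0 :=
      (hA _ (hseg t ht')).trans (le_max_left _ _)
    calc _ ≤ 1 * (‖iteratedFDeriv ℝ (n + 1) F (u + t • h)‖ * ‖h‖ ^ (n + 1)) := by gcongr
      _ ≤ _ := by rw [one_mul]; gcongr
  calc _ ≤ 1 * (max A 0 * ‖h‖ ^ (n + 1) * |1 - 0|) := by gcongr
    _ = _ := by simp

end Taylor

/-! ### Size, regularity, homogeneity and Taylor expansion of the kernel. -/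

section Kernel

variable {n : ℕ} {Ω : Euc d → 𝕜}

theorem IsCZNumerator.exists_bound (hd : 1 ≤ d) (hΩ : IsCZNumerator (n + 1) Ω) :
    ∃ A : ℝ, 0 ≤ A ∧ ∀ x, ‖czKernel Ω x‖ ≤ A / ‖x‖ ^ d := by
  obtain ⟨A, hA⟩ := (isCompact_sphere (0 : Euc d) 1).exists_bound_of_continuousOn
    (hΩ.contDiffOn.continuousOn.mono fun x hx h0 => by
      rw [Set.mem_singleton_iff] at h0
      simp [h0] at hx)
  refine ⟨max A 0, le_max_right _ _, fun x => ?_⟩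
  rcases eq_or_ne x 0 with rfl | hx
  -- At the origin both sides vanish by the convention for division by zero, because `0 ^ d = 0` for
  -- `d ≥ 1`.
  · simp [czKernel, show d ≠ 0 by omega]
  · have hx0 : 0 < ‖x‖ := norm_pos_iff.2 hx
    have h1 : Ω x = Ω (‖x‖⁻¹ • x) := (hΩ.homogeneous _ (by positivity) x).symm
    rw [czKernel, norm_div, RCLike.norm_ofReal, abs_of_nonneg (by positivity), h1]
    gcongr
    refine (hA _ ?_).trans (le_max_left _ _)
    simp [norm_smul, hx0.ne']

theorem IsCZNumerator.continuousOn_kernel (hΩ : IsCZNumerator (n + 1) Ω) :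
    ContinuousOn (czKernel Ω) {0}ᶜ := by
  refine hΩ.contDiffOn.continuousOn.div ?_ fun x hx => ?_
  · exact (RCLike.continuous_ofReal.comp (by fun_prop)).continuousOn
  · simpa using fun h : x = 0 => absurd h hx

theorem IsCZNumerator.measurable_kernel (hΩ : IsCZNumerator (n + 1) Ω) :
    Measurable (czKernel Ω) :=
  measurable_of_continuousOn_compl_singleton 0 hΩ.continuousOn_kernel

theorem contDiffOn_norm_pow_ofReal (k : ℕ) :
    ContDiffOn ℝ k (fun x : Euc d => ((‖x‖ ^ d : ℝ) : 𝕜)) {0}ᶜ := by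
  have h1 : ContDiffOn ℝ k (fun x : Euc d => ‖x‖ ^ d) {0}ᶜ := fun x hx =>
    ((contDiffAt_norm ℝ (n := k) hx).pow d).contDiffWithinAt
  exact (RCLike.ofRealCLM (K := 𝕜)).contDiff.comp_contDiffOn h1

theorem IsCZNumerator.contDiffOn_kernel (hΩ : IsCZNumerator (n + 1) Ω) :
    ContDiffOn ℝ (n + 1) (czKernel Ω) {0}ᶜ := by
  have h1 : ContDiffOn ℝ (n + 1) (fun x : Euc d => ((‖x‖ ^ d : ℝ) : 𝕜)) {0}ᶜ := by
    exact_mod_cast contDiffOn_norm_pow_ofReal (𝕜 := 𝕜) (d := d) (n + 1)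
  have h2 : ContDiffOn ℝ (n + 1) Ω {0}ᶜ := by exact_mod_cast hΩ.contDiffOn
  refine (h2.mul (h1.inv fun x hx => ?_)).congr fun x hx => ?_
  · simpa using fun h : x = 0 => absurd h hx
  · simp [czKernel, div_eq_mul_inv]

theorem IsCZNumerator.kernel_smul (hΩ : IsCZNumerator (n + 1) Ω) {t : ℝ} (ht : 0 < t) (x : Euc d) :
    czKernel Ω (t • x) = ((t ^ d : ℝ) : 𝕜)⁻¹ * czKernel Ω x := by
  rw [czKernel, czKernel, hΩ.homogeneous t ht, norm_smul, Real.norm_of_nonneg ht.le, mul_pow]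
  push_cast
  rw [mul_comm ((t : 𝕜) ^ d), ← div_div, div_eq_mul_inv _ ((t : 𝕜) ^ d), mul_comm]

/-- Taylor expansion of the kernel, uniform with respect to the center. -/
theorem IsCZNumerator.exists_taylor (hΩ : IsCZNumerator (n + 1) Ω) :
    ∃ A : ℝ, 0 ≤ A ∧ ∀ z : Euc d, z ≠ 0 → ∃ P : MvPolynomial (Fin d) 𝕜, P.totalDegree ≤ n ∧
      ∀ h : Euc d, ‖h‖ ≤ ‖z‖ / 2 →
        ‖czKernel Ω (z + h) - polyFun P h‖ ≤ A * ‖h‖ ^ (n + 1) / ‖z‖ ^ (d + n + 1) := by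
  obtain ⟨A, hA, hT⟩ := exists_taylor_sphere n hΩ.contDiffOn_kernel
  refine ⟨A, hA, fun z hz => ?_⟩
  have hz0 : 0 < ‖z‖ := norm_pos_iff.2 hz
  obtain ⟨P, hP, hPT⟩ := hT (‖z‖⁻¹ • z) (by simp [norm_smul, hz0.ne'])
  -- The kernel is homogeneous of degree `-d`, so the expansion at `z` is the rescaled expansion at
  -- `z / ‖z‖`.
  refine ⟨MvPolynomial.C (((‖z‖ ^ d : ℝ) : 𝕜)⁻¹) * affineSub 0 ‖z‖⁻¹ P,
    totalDegree_C_mul_le _ ((totalDegree_affineSub_le _ _ _).trans hP), fun h hh => ?_⟩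
  have hn : ‖‖z‖⁻¹ • h‖ = ‖h‖ / ‖z‖ := by
    rw [norm_smul, norm_inv, norm_norm, div_eq_inv_mul]
  have h1 := hPT (‖z‖⁻¹ • h) (by rw [hn, div_le_iff₀ hz0]; linarith)
  have h2 : z + h = ‖z‖ • (‖z‖⁻¹ • z + ‖z‖⁻¹ • h) := by
    rw [← smul_add, smul_inv_smul₀ hz0.ne']
  rw [h2, hΩ.kernel_smul hz0, polyFun_mul, polyFun_C, polyFun_affineSub, zero_add, ← mul_sub,
    norm_mul, norm_inv, RCLike.norm_ofReal, abs_of_nonneg (by positivity)]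
  calc _ ≤ (‖z‖ ^ d)⁻¹ * (A * (‖h‖ / ‖z‖) ^ (n + 1)) := by
        rw [hn] at h1
        gcongr
    _ = _ := by
        rw [div_pow, show ‖z‖ ^ (d + n + 1) = ‖z‖ ^ d * ‖z‖ ^ (n + 1) by rw [add_assoc, pow_add]]
        field_simp

end Kernel

/-! ### Integrals in polar coordinates and cancellation of the kernel. -/

section Radial

variable (d) in
/-- Twice the area of the unit sphere. -/
def sphereConst : ℝ := d * volume.real (Metric.ball (0 : Euc d) 1) * 2

theorem sphereConst_nonneg : 0 ≤ sphereConst d := by unfold sphereConst; positivity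

variable [Nonempty (Fin d)]

/-- Integration of radial functions. -/
theorem radial_integral {S : Set ℝ} (hS : MeasurableSet S) {h g : ℝ → ℝ}
    (hg : ∀ r ∈ S, 0 < r → r ^ (d - 1) * h r = g r) (hgi : IntegrableOn g (S ∩ Set.Ioi 0)) :
    IntegrableOn (fun x : Euc d => h ‖x‖) {x | ‖x‖ ∈ S} ∧
      ∫ x : Euc d in {x | ‖x‖ ∈ S}, h ‖x‖ =
        d * volume.real (Metric.ball (0 : Euc d) 1) * ∫ r in S ∩ Set.Ioi 0, g r := by
  have hSm : MeasurableSet {x : Euc d | ‖x‖ ∈ S} := measurable_norm hS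
  have hind : ∀ x : Euc d, {x : Euc d | ‖x‖ ∈ S}.indicator (fun x : Euc d => h ‖x‖) x =
      (S.indicator h) ‖x‖ := fun x => by
    by_cases hx : ‖x‖ ∈ S <;> simp [Set.indicator, hx]
  have heq : ∀ r ∈ Set.Ioi (0 : ℝ), r ^ (d - 1) • S.indicator h r = S.indicator g r := by
    intro r hr
    by_cases hrS : r ∈ S
    · rw [Set.indicator_of_mem hrS, Set.indicator_of_mem hrS, smul_eq_mul, hg r hrS hr]
    · rw [Set.indicator_of_notMem hrS, Set.indicator_of_notMem hrS, smul_zero]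
  constructor
  · rw [← integrable_indicator_iff hSm]
    rw [show {x : Euc d | ‖x‖ ∈ S}.indicator (fun x : Euc d => h ‖x‖) =
      fun x => (S.indicator h) ‖x‖ from funext hind]
    rw [integrable_fun_norm_addHaar, finrank_euclideanSpace, Fintype.card_fin,
      integrableOn_congr_fun heq measurableSet_Ioi]
    rw [IntegrableOn, integrable_indicator_iff hS, IntegrableOn, Measure.restrict_restrict hS]
    exact hgi
  · rw [← integral_indicator hSm]
    simp only [hind]
    rw [integral_fun_norm_addHaar, finrank_euclideanSpace, Fintype.card_fin,
      setIntegral_congr_fun measurableSet_Ioi heq, setIntegral_indicator hS, Set.inter_comm]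
    simp [mul_assoc]

theorem pow_pred_mul_div_pow {r : ℝ} (hr : 0 < r) (a : ℝ) : r ^ (d - 1) * (a / r ^ d) = a / r := by
  have hd : d = (d - 1) + 1 := by
    have := Fin.pos_iff_nonempty.2 ‹Nonempty (Fin d)›
    omega
  conv_lhs => rw [hd]
  rw [Nat.add_sub_cancel, pow_succ]
  field_simp

/-- In polar coordinates this is the integral of `r^(-1/2)` over `(0, δ)`, equal to `2√δ`; this is
the origin of the factor `2` in `sphereConst`. -/
theorem integral_ball_sqrt {δ : ℝ} (hδ : 0 < δ) :
    IntegrableOn (fun x : Euc d => √‖x‖ / ‖x‖ ^ d) {x | ‖x‖ < δ} ∧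
      ∫ x : Euc d in {x | ‖x‖ < δ}, √‖x‖ / ‖x‖ ^ d = sphereConst d * √δ := by
  have hset : Set.Iio δ ∩ Set.Ioi (0 : ℝ) = Set.Ioo 0 δ := by ext; simp [and_comm]
  have hI : IntervalIntegrable (fun r : ℝ => r ^ (-(1 / 2) : ℝ)) volume 0 δ :=
    intervalIntegral.intervalIntegrable_rpow' (by norm_num)
  have hI' : IntegrableOn (fun r : ℝ => r ^ (-(1 / 2) : ℝ)) (Set.Iio δ ∩ Set.Ioi 0) := by
    rw [hset]
    exact ((intervalIntegrable_iff_integrableOn_Ioc_of_le hδ.le).1 hI).mono_set Set.Ioo_subset_Ioc_self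
  obtain ⟨h1, h2⟩ := radial_integral (d := d) measurableSet_Iio (h := fun r => √r / r ^ d)
    (g := fun r : ℝ => r ^ (-(1 / 2) : ℝ)) (S := Set.Iio δ) (fun r _ hr => by
      rw [pow_pred_mul_div_pow hr, Real.sqrt_eq_rpow, ← Real.rpow_sub_one hr.ne']
      norm_num) hI'
  refine ⟨h1, ?_⟩
  have h3 : ∫ r in Set.Iio δ ∩ Set.Ioi 0, r ^ (-(1 / 2) : ℝ) = 2 * √δ := by
    rw [hset, ← integral_Ioc_eq_integral_Ioo, ← intervalIntegral.integral_of_le hδ.le,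
      integral_rpow (Or.inl (by norm_num)), Real.sqrt_eq_rpow]
    rw [Real.zero_rpow (by norm_num)]
    norm_num
    ring
  refine h2.trans ?_
  rw [h3, sphereConst]
  ring

/-- In polar coordinates this is the integral of `r^(-3/2)` over `[δ, ∞)`. The integrand is what
remains when growth of order `n + 1/2` meets a Taylor remainder with decay of order `d + n + 1`. -/
theorem integral_far_sqrt {δ : ℝ} (hδ : 0 < δ) :
    IntegrableOn (fun x : Euc d => (√‖x‖)⁻¹ / ‖x‖ ^ d) {x | δ ≤ ‖x‖} ∧
      ∫ x : Euc d in {x | δ ≤ ‖x‖}, (√‖x‖)⁻¹ / ‖x‖ ^ d = sphereConst d * (√δ)⁻¹ := by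
  have hset : Set.Ici δ ∩ Set.Ioi (0 : ℝ) = Set.Ici δ :=
    Set.inter_eq_left.2 fun x hx => hδ.trans_le hx
  have hI' : IntegrableOn (fun r : ℝ => r ^ (-(3 / 2) : ℝ)) (Set.Ici δ ∩ Set.Ioi 0) := by
    rw [hset, integrableOn_Ici_iff_integrableOn_Ioi]
    exact integrableOn_Ioi_rpow_of_lt (by norm_num) hδ
  obtain ⟨h1, h2⟩ := radial_integral (d := d) measurableSet_Ici (h := fun r => (√r)⁻¹ / r ^ d)
    (g := fun r : ℝ => r ^ (-(3 / 2) : ℝ)) (S := Set.Ici δ) (fun r _ hr => by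
      rw [pow_pred_mul_div_pow hr, Real.sqrt_eq_rpow, ← Real.rpow_neg hr.le,
        ← Real.rpow_sub_one hr.ne']
      norm_num) hI'
  refine ⟨h1, ?_⟩
  have h3 : ∫ r in Set.Ici δ ∩ Set.Ioi 0, r ^ (-(3 / 2) : ℝ) = 2 * (√δ)⁻¹ := by
    rw [hset, integral_Ici_eq_integral_Ioi, integral_Ioi_rpow_of_lt (by norm_num) hδ,
      Real.sqrt_eq_rpow, ← Real.rpow_neg hδ.le]
    norm_num
    ring
  refine h2.trans ?_
  rw [h3, sphereConst]
  ring

/-- The kernel has zero integral on annuli. -/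
theorem IsCZNumerator.integral_annulus {n : ℕ} {Ω : Euc d → 𝕜} (hΩ : IsCZNumerator (n + 1) Ω)
    (ε δ : ℝ) : ∫ x : Euc d in {x | ε < ‖x‖ ∧ ‖x‖ < δ}, czKernel Ω x = 0 := by
  have hm : MeasurableSet {x : Euc d | ε < ‖x‖ ∧ ‖x‖ < δ} :=
    (measurableSet_lt measurable_const measurable_norm).inter
      (measurableSet_lt measurable_norm measurable_const)
  set μ := (volume : Measure (Euc d))
  set h : ℝ → 𝕜 := (Set.Ioo ε δ).indicator fun r => ((r ^ d : ℝ) : 𝕜)⁻¹ with hh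
  rw [← integral_indicator hm]
  set F := {x : Euc d | ε < ‖x‖ ∧ ‖x‖ < δ}.indicator (czKernel Ω) with hF
  have hFeq : ∀ x : Euc d, x ≠ 0 → F x = Ω (‖x‖⁻¹ • x) * h ‖x‖ := by
    intro x hx
    have hx0 : 0 < ‖x‖ := norm_pos_iff.2 hx
    rw [hΩ.homogeneous _ (by positivity), hF, hh]
    by_cases hxA : ε < ‖x‖ ∧ ‖x‖ < δ
    · rw [Set.indicator_of_mem (show x ∈ {x : Euc d | ε < ‖x‖ ∧ ‖x‖ < δ} from hxA),
        Set.indicator_of_mem (show ‖x‖ ∈ Set.Ioo ε δ from hxA), czKernel, div_eq_mul_inv]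
    · rw [Set.indicator_of_notMem (show x ∉ {x : Euc d | ε < ‖x‖ ∧ ‖x‖ < δ} from hxA),
        Set.indicator_of_notMem (show ‖x‖ ∉ Set.Ioo ε δ from hxA), mul_zero]
  calc ∫ x, F x ∂μ = ∫ x : ({(0)}ᶜ : Set (Euc d)), F x.1 ∂(μ.comap (↑)) := by
        rw [integral_subtype_comap (measurableSet_singleton _).compl fun x => F x,
          restrict_compl_singleton]
    _ = ∫ x : ({(0)}ᶜ : Set (Euc d)),
          (fun p : Metric.sphere (0 : Euc d) 1 × Set.Ioi (0 : ℝ) => Ω p.1 * h p.2)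
            (homeomorphUnitSphereProd (Euc d) x) ∂(μ.comap (↑)) := by
        refine integral_congr_ae (Eventually.of_forall fun x => ?_)
        simpa using hFeq x.1 x.2
    _ = ∫ p : Metric.sphere (0 : Euc d) 1 × Set.Ioi (0 : ℝ), Ω p.1 * h p.2
          ∂(μ.toSphere.prod (.volumeIoiPow (Module.finrank ℝ (Euc d) - 1))) :=
        μ.measurePreserving_homeomorphUnitSphereProd.integral_comp
          (Homeomorph.measurableEmbedding _)
          (fun p : Metric.sphere (0 : Euc d) 1 × Set.Ioi (0 : ℝ) => Ω p.1 * h p.2)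
    _ = 0 := by
        -- The integral of a product over a product measure factors without integrability
        -- assumptions, so no restriction on `ε` and `δ` is needed.
        rw [integral_prod_mul (f := fun u : Metric.sphere (0 : Euc d) 1 => Ω u)
          (g := fun r : Set.Ioi (0 : ℝ) => h r), hΩ.integral_sphere, zero_mul]

end Radial

/-! ### Existence of principal values. -/

section PrincipalValue

theorem integrableOn_comp_sub_left {F : Type*} [NormedAddCommGroup F] [NormedSpace ℝ F]
    {φ : Euc d → F} {S : Set (Euc d)} (hS : MeasurableSet S) (hφ : IntegrableOn φ S) (y : Euc d) :
    IntegrableOn (fun x => φ (y - x)) {x | y - x ∈ S} := by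
  have hm : MeasurableSet {x | y - x ∈ S} := (measurable_const.sub measurable_id) hS
  rw [← integrable_indicator_iff hm]
  exact ((integrable_indicator_iff hS).2 hφ).comp_sub_left y

theorem setIntegral_comp_sub_left {F : Type*} [NormedAddCommGroup F] [NormedSpace ℝ F]
    (φ : Euc d → F) {S : Set (Euc d)} (hS : MeasurableSet S) (y : Euc d) :
    ∫ x in {x | y - x ∈ S}, φ (y - x) = ∫ x in S, φ x := by
  have hm : MeasurableSet {x | y - x ∈ S} := (measurable_const.sub measurable_id) hS
  rw [← integral_indicator hm, ← integral_indicator hS]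
  exact integral_sub_left_eq_self (S.indicator φ) volume y

theorem measurableSet_le_norm_sub (ε : ℝ) (y : Euc d) : MeasurableSet {x : Euc d | ε ≤ ‖y - x‖} :=
  measurableSet_le measurable_const (by fun_prop)

theorem measurableSet_lt_norm_sub (ε : ℝ) (y : Euc d) : MeasurableSet {x : Euc d | ε < ‖y - x‖} :=
  measurableSet_lt measurable_const (by fun_prop)

theorem measurableSet_norm_sub_lt (ε : ℝ) (y : Euc d) : MeasurableSet {x : Euc d | ‖y - x‖ < ε} :=
  measurableSet_lt (by fun_prop) measurable_const

variable {n : ℕ} {Ω : Euc d → 𝕜}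

theorem IsCZNumerator.integrableOn_far (hd : 1 ≤ d) (hΩ : IsCZNumerator (n + 1) Ω)
    {f : Euc d → 𝕜} (hf : Integrable f) (y : Euc d) {ε : ℝ} (hε : 0 < ε) :
    IntegrableOn (fun x => f x * czKernel Ω (y - x)) {x | ε ≤ ‖y - x‖} := by
  obtain ⟨A, hA, hK⟩ := hΩ.exists_bound hd
  refine (hf.integrableOn).mul_bdd (c := A / ε ^ d) ?_ ?_
  · exact (hΩ.measurable_kernel.comp (measurable_const.sub measurable_id)).aestronglyMeasurable
  · filter_upwards [ae_restrict_mem (measurableSet_le_norm_sub ε y)] with x hx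
    refine (hK _).trans ?_
    have hx' : ε ≤ ‖y - x‖ := hx
    gcongr

/-- Existence and size of the principal value at a point where the function is Hölder
continuous. -/
theorem IsCZNumerator.exists_pv_bound (hd : 1 ≤ d) (hΩ : IsCZNumerator (n + 1) Ω) :
    ∃ A : ℝ, 0 ≤ A ∧ ∀ (f : Euc d → 𝕜) (y : Euc d) (δ : ℝ) (v : 𝕜) (B : ℝ), Integrable f →
      0 < δ → 0 ≤ B → (∀ᵐ x, ‖y - x‖ < δ → ‖f x - v‖ ≤ B * √(‖y - x‖ / δ)) →
      PVExists Ω f y ∧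
        ‖czOp Ω f y - ∫ x in {x | δ ≤ ‖y - x‖}, f x * czKernel Ω (y - x)‖ ≤ A * B := by
  have : Nonempty (Fin d) := ⟨⟨0, hd⟩⟩
  obtain ⟨A, hA, hK⟩ := hΩ.exists_bound hd
  refine ⟨A * sphereConst d, mul_nonneg hA sphereConst_nonneg, ?_⟩
  intro f y δ v B hf hδ hB hfv
  have hKm : Measurable fun x => czKernel Ω (y - x) :=
    hΩ.measurable_kernel.comp (measurable_const.sub measurable_id)
  set S : Set (Euc d) := {x | ‖y - x‖ < δ} with hS
  have hSm : MeasurableSet S := measurableSet_norm_sub_lt δ y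
  set G : Euc d → 𝕜 := fun x => (f x - v) * czKernel Ω (y - x) with hG
  have hGm : AEStronglyMeasurable G volume :=
    (hf.1.sub aestronglyMeasurable_const).mul hKm.aestronglyMeasurable
  set φ : Euc d → ℝ := fun x => A * B / √δ * (√‖x‖ / ‖x‖ ^ d) with hφ
  obtain ⟨hr1, hr2⟩ := integral_ball_sqrt (d := d) hδ
  have hball : MeasurableSet {x : Euc d | ‖x‖ < δ} := measurableSet_lt measurable_norm measurable_const
  have hφi : IntegrableOn (fun x => φ (y - x)) S :=
    integrableOn_comp_sub_left hball (hr1.const_mul _) y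
  have hφv : ∫ x in S, φ (y - x) = A * sphereConst d * B := by
    have h1 := setIntegral_comp_sub_left φ hball y
    refine h1.trans ?_
    rw [hφ, integral_const_mul, hr2]
    have : √δ ≠ 0 := (Real.sqrt_pos.2 hδ).ne'
    field_simp
  have hGφ : ∀ᵐ x ∂volume.restrict S, ‖G x‖ ≤ φ (y - x) := by
    filter_upwards [ae_restrict_of_ae hfv, ae_restrict_mem hSm] with x hx hxS
    rw [hG, hφ]
    simp only [norm_mul]
    calc _ ≤ B * √(‖y - x‖ / δ) * (A / ‖y - x‖ ^ d) :=
          mul_le_mul (hx hxS) (hK _) (norm_nonneg _) (by positivity)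
      _ = _ := by rw [Real.sqrt_div (norm_nonneg _)]; ring
  have hGi : IntegrableOn G S := Integrable.mono' hφi hGm.restrict hGφ
  -- Inside the ball of radius `δ` the constant `v` may be subtracted from `f`, because the kernel
  -- has zero integral on annuli. What remains is absolutely integrable, and the limit is taken by
  -- dominated convergence.
  have htrunc : ∀ ε, 0 < ε → ε < δ → czTrunc Ω f y ε =
      (∫ x, ({x | ε < ‖y - x‖} ∩ S).indicator G x) +
        ∫ x in {x | δ ≤ ‖y - x‖}, f x * czKernel Ω (y - x) := by
    intro ε hε hεδ
    have hεm := measurableSet_lt_norm_sub ε y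
    have hint : IntegrableOn (fun x => f x * czKernel Ω (y - x)) {x | ε < ‖y - x‖} :=
      (hΩ.integrableOn_far hd hf y hε).mono_set fun x (hx : ε < ‖y - x‖) => hx.le
    rw [czTrunc, ← integral_inter_add_sdiff hSm hint, integral_indicator (hεm.inter hSm)]
    congr 1
    · have hKi : IntegrableOn (fun x => czKernel Ω (y - x)) ({x | ε < ‖y - x‖} ∩ S) := by
        refine Measure.integrableOn_of_bounded (M := A / ε ^ d) ?_ hKm.aestronglyMeasurable ?_
        · refine (measure_mono (t := Metric.ball y δ) ?_).trans_lt measure_ball_lt_top |>.ne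
          rintro x ⟨-, hx⟩
          rw [Metric.mem_ball, dist_comm, dist_eq_norm]
          exact hx
        · filter_upwards [ae_restrict_mem (hεm.inter hSm)] with x hx
          have hx1 : ε < ‖y - x‖ := hx.1
          refine (hK _).trans ?_
          gcongr
      have hsplit : ∀ x, f x * czKernel Ω (y - x) = G x + v * czKernel Ω (y - x) := by
        intro x; rw [hG]; ring
      simp only [hsplit]
      rw [integral_add (hGi.mono_set Set.inter_subset_right) (hKi.const_mul v), integral_const_mul]
      have hz : ∫ x in {x | ε < ‖y - x‖} ∩ S, czKernel Ω (y - x) = 0 := by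
        have h1 := setIntegral_comp_sub_left (czKernel Ω)
          (S := {x : Euc d | ε < ‖x‖ ∧ ‖x‖ < δ})
          ((measurableSet_lt measurable_const measurable_norm).inter
            (measurableSet_lt measurable_norm measurable_const)) y
        rw [hΩ.integral_annulus ε δ] at h1
        exact h1
      rw [hz, mul_zero, add_zero]
    · congr 2
      ext x
      simp only [Set.mem_sdiff, Set.mem_ofPred_eq, hS, not_lt]
      exact ⟨fun h => h.2, fun h => ⟨hεδ.trans_le h, h⟩⟩
  have hlim : Tendsto (fun ε : ℝ => ∫ x, ({x | ε < ‖y - x‖} ∩ S).indicator G x) (𝓝[>] 0)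
      (𝓝 (∫ x, S.indicator G x)) := by
    refine tendsto_integral_filter_of_dominated_convergence (fun x => S.indicator (fun x => ‖G x‖) x)
      ?_ ?_ ?_ ?_
    · exact Eventually.of_forall fun ε =>
        hGm.indicator ((measurableSet_lt_norm_sub ε y).inter hSm)
    · refine Eventually.of_forall fun ε => Eventually.of_forall fun x => ?_
      by_cases hx : x ∈ S
      · rw [Set.indicator_of_mem hx]
        exact norm_indicator_le_norm_self G x
      · rw [Set.indicator_of_notMem hx, Set.indicator_of_notMem fun h => hx h.2, norm_zero]
    · exact (integrable_indicator_iff hSm).2 hGi.norm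
    · have hne : ∀ᵐ x : Euc d, x ≠ y := by
        rw [ae_iff]
        simp
      filter_upwards [hne] with x hx
      have hpos : 0 < ‖y - x‖ := norm_pos_iff.2 (sub_ne_zero.2 hx.symm)
      refine tendsto_const_nhds.congr' ?_
      filter_upwards [Ioo_mem_nhdsGT hpos] with ε hε
      by_cases hxS : x ∈ S
      · rw [Set.indicator_of_mem hxS, Set.indicator_of_mem (show x ∈ {x | ε < ‖y - x‖} ∩ S from ⟨hε.2, hxS⟩)]
      · rw [Set.indicator_of_notMem hxS, Set.indicator_of_notMem fun h => hxS h.2]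
  have hlim2 : Tendsto (czTrunc Ω f y) (𝓝[>] 0)
      (𝓝 ((∫ x, S.indicator G x) +
        ∫ x in {x | δ ≤ ‖y - x‖}, f x * czKernel Ω (y - x))) := by
    refine (hlim.add_const _).congr' ?_
    filter_upwards [Ioo_mem_nhdsGT hδ] with ε hε
    exact (htrunc ε hε.1 hε.2).symm
  refine ⟨⟨fun ε hε => (hΩ.integrableOn_far hd hf y hε).mono_set
    fun x (hx : ε < ‖y - x‖) => hx.le, _, hlim2⟩, ?_⟩
  rw [czOp, hlim2.limUnder_eq, add_sub_cancel_right, integral_indicator hSm, ← hφv]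
  exact norm_integral_le_of_norm_le hφi hGφ

end PrincipalValue

/-! ### Integration of functions that blow up at the boundary of a cube. -/

section Layers

/-- Bernoulli's inequality for `(1 - t)^d`. -/
theorem volume_cube_diff_le (c : Euc d) {l t : ℝ} (hl : 0 ≤ l) (ht0 : 0 ≤ t) (ht1 : t ≤ 1) :
    volume (cube c l \ cube c (l * (1 - t))) ≤ ENNReal.ofReal (d * t * l ^ d) := by
  have hsub : cube c (l * (1 - t)) ⊆ cube c l := cube_subset_cube (by
    rw [sub_self, norm_zero]; nlinarith)
  have h0 : 0 ≤ l * (1 - t) := mul_nonneg hl (by linarith)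
  rw [measure_sdiff hsub (measurableSet_cube _ _).nullMeasurableSet
    (by rw [volume_cube _ _ h0]; exact ENNReal.ofReal_ne_top), volume_cube _ _ hl,
    volume_cube _ _ h0, ← ENNReal.ofReal_sub _ (by positivity)]
  refine ENNReal.ofReal_le_ofReal ?_
  have hb := one_add_mul_le_pow (show (-2 : ℝ) ≤ -t by linarith) d
  rw [mul_pow]
  have hl' : 0 ≤ l ^ d := by positivity
  have : 1 + -t = 1 - t := by ring
  rw [this] at hb
  nlinarith

/-- Integration of a function which blows up at the boundary of a cube like the inverse square
root of the distance. -/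
theorem lintegral_cube_le_of_layers (hd : 1 ≤ d) (c : Euc d) {l B : ℝ} (hl : 0 < l) (hB : 0 ≤ B)
    (F : Euc d → ℝ≥0∞)
    (hF : ∀ᵐ y ∂volume.restrict (cube c l), ∀ j : ℕ, y ∈ cube c (l * (1 - (1 / 4) ^ j)) →
      F y ≤ ENNReal.ofReal (B * 2 ^ j)) :
    ∫⁻ y in cube c l, F y ≤ ENNReal.ofReal (4 * d * B * l ^ d) := by
  set Q : ℕ → Set (Euc d) := fun j => cube c (l * (1 - (1 / 4) ^ j)) with hQ
  have hQm : ∀ j, MeasurableSet (Q j) := fun j => measurableSet_cube _ _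
  have hq : ∀ j : ℕ, (0 : ℝ) ≤ (1 / 4) ^ j ∧ (1 / 4 : ℝ) ^ j ≤ 1 := fun j =>
    ⟨by positivity, pow_le_one₀ (by norm_num) (by norm_num)⟩
  have hvol : ∀ j, volume (cube c l \ Q j) ≤ ENNReal.ofReal (d * (1 / 4) ^ j * l ^ d) := fun j =>
    volume_cube_diff_le c hl.le (hq j).1 (hq j).2
  have hnull : ∀ᵐ y ∂volume.restrict (cube c l), y ∈ ⋃ j, Q j := by
    rw [ae_restrict_iff' (measurableSet_cube _ _), ae_iff]
    have hle : ∀ j : ℕ, volume {y | ¬(y ∈ cube c l → y ∈ ⋃ j, Q j)} ≤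
        ENNReal.ofReal (d * (1 / 4) ^ j * l ^ d) := fun j => by
      refine (measure_mono fun y hy => ?_).trans (hvol j)
      simp only [Set.mem_ofPred_eq, Classical.not_imp, Set.mem_iUnion, not_exists] at hy
      exact ⟨hy.1, hy.2 j⟩
    refine le_antisymm ?_ zero_le
    refine ge_of_tendsto' (x := atTop) (f := fun j : ℕ => ENNReal.ofReal (d * (1 / 4) ^ j * l ^ d)) ?_ hle
    have h1 : Tendsto (fun j : ℕ => (d : ℝ) * (1 / 4) ^ j * l ^ d) atTop (𝓝 (d * 0 * l ^ d)) :=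
      ((tendsto_pow_atTop_nhds_zero_of_lt_one (by norm_num) (by norm_num)).const_mul _).mul_const _
    simpa using ENNReal.tendsto_ofReal h1
  -- The cube `Q 0` has side zero, so almost every point enters the increasing family at a positive
  -- index.
  have hnull0 : ∀ᵐ y ∂volume.restrict (cube c l), y ∉ Q 0 := by
    refine ae_restrict_of_ae ?_
    have : volume (Q 0) = 0 := by
      rw [hQ]
      simp only [pow_zero, sub_self, mul_zero]
      rw [volume_cube _ _ le_rfl, zero_pow (by omega)]
      simp
    rw [ae_iff]
    simpa using this
  -- A point that first enters the family at index `k + 1` lies outside `Q k`, a set of relative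
  -- measure at most `d 4^(-k)`, and `F ≤ B 2^(k+1)` there; the products form a geometric series.
  have hpt : ∀ᵐ y ∂volume.restrict (cube c l), F y ≤
      ∑' j : ℕ, (cube c l \ Q j).indicator (fun _ => ENNReal.ofReal (B * 2 ^ (j + 1))) y := by
    filter_upwards [hF, hnull, hnull0, ae_restrict_mem (measurableSet_cube c l)] with y h1 h2 h3 h4
    classical
    have hex : ∃ j, y ∈ Q j := by simpa using h2
    obtain ⟨k, hk⟩ : ∃ k, Nat.find hex = k + 1 := by
      refine Nat.exists_eq_succ_of_ne_zero fun h0 => h3 ?_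
      have := Nat.find_spec hex
      rwa [h0] at this
    have hmem : y ∈ Q (k + 1) := hk ▸ Nat.find_spec hex
    have hnot : y ∉ Q k := Nat.find_min hex (by omega)
    refine (h1 (k + 1) hmem).trans ?_
    refine le_trans ?_ (ENNReal.le_tsum k)
    rw [Set.indicator_of_mem (show y ∈ cube c l \ Q k from ⟨h4, hnot⟩)]
  refine (lintegral_mono_ae hpt).trans ?_
  rw [lintegral_tsum fun j => (measurable_const.indicator
    ((measurableSet_cube c l).diff (hQm j))).aemeasurable]
  have hterm : ∀ j : ℕ, ∫⁻ y in cube c l,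
      (cube c l \ Q j).indicator (fun _ => ENNReal.ofReal (B * 2 ^ (j + 1))) y ≤
      ENNReal.ofReal (2 * d * B * l ^ d) * ENNReal.ofReal ((1 / 2) ^ j) := fun j => by
    refine (lintegral_mono' Measure.restrict_le_self le_rfl).trans ?_
    rw [lintegral_indicator_const ((measurableSet_cube c l).diff (hQm j))]
    refine (mul_le_mul_right (hvol j) _).trans ?_
    rw [← ENNReal.ofReal_mul (by positivity), ← ENNReal.ofReal_mul (by positivity)]
    apply le_of_eq
    congr 1
    have : (1 / 4 : ℝ) ^ j = (1 / 2) ^ j * (1 / 2) ^ j := by rw [← mul_pow]; norm_num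
    rw [this, pow_succ]
    have h2 : (2 : ℝ) ^ j * (1 / 2) ^ j = 1 := by rw [← mul_pow]; norm_num
    calc _ = (2 * d * B * l ^ d * (1 / 2) ^ j) * ((2 : ℝ) ^ j * (1 / 2) ^ j) := by ring
      _ = _ := by rw [h2, mul_one]
  refine (ENNReal.tsum_le_tsum hterm).trans ?_
  rw [ENNReal.tsum_mul_left, ← ENNReal.ofReal_tsum_of_nonneg (fun j => by positivity)
    (summable_geometric_of_lt_one (by norm_num) (by norm_num)),
    tsum_geometric_of_lt_one (by norm_num) (by norm_num), ← ENNReal.ofReal_mul (by positivity)]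
  apply le_of_eq
  congr 1
  ring

end Layers

/-! ### Oscillation of the singular integral over a cube: far, intermediate and local parts. -/

section Oscillation

variable {n : ℕ} {Ω : Euc d → 𝕜}

/-- The contribution to the singular integral of the points far from a cube is close to a
polynomial on the cube. -/
theorem IsCZNumerator.exists_far_bound (hd : 1 ≤ d) (hΩ : IsCZNumerator (n + 1) Ω) :
    ∃ A : ℝ, 0 ≤ A ∧ ∀ (h : Euc d → 𝕜) (c : Euc d) (l N : ℝ), Integrable h → 0 < l → 0 ≤ N →
      (∀ᵐ x, l ≤ ‖c - x‖ → ‖h x‖ ≤ N * ‖c - x‖ ^ n * √(‖c - x‖ / l)) →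
      ∃ S : MvPolynomial (Fin d) 𝕜, S.totalDegree ≤ n ∧ ∀ y ∈ cube c l,
        ‖(∫ x in {x | d * l ≤ ‖c - x‖}, h x * czKernel Ω (y - x)) - polyFun S y‖ ≤
          A * N * l ^ n := by
  have : Nonempty (Fin d) := ⟨⟨0, hd⟩⟩
  have hd1 : (1 : ℝ) ≤ d := by exact_mod_cast hd
  obtain ⟨A, hA, hT⟩ := hΩ.exists_taylor
  obtain ⟨m, L, hm, hL, hrep⟩ := exists_interpolation 𝕜 d n
  choose b hb using fun u : Euc d => (isCompact_cube (0 : Euc d) 1).exists_bound_of_continuousOn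
    (continuous_polyFun (L u)).continuousOn
  set W : ℝ := 1 + ∑ u ∈ m, |b u| with hW
  have hW0 : 0 ≤ W := by positivity
  set A' : ℝ := W * (A * d ^ (n + 1)) with hA'
  have hA'0 : 0 ≤ A' := by positivity
  refine ⟨A' * sphereConst d, mul_nonneg hA'0 sphereConst_nonneg, ?_⟩
  intro h c l N hh hl hN hbd
  set Far : Set (Euc d) := {x | d * l ≤ ‖c - x‖} with hFar
  have hFm : MeasurableSet Far := measurableSet_le_norm_sub _ _
  set H : Euc d → 𝕜 := fun y => ∫ x in Far, h x * czKernel Ω (y - x) with hH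
  have hfar : ∀ y ∈ cube c l, ∀ x ∈ Far, l / 2 ≤ ‖y - x‖ := by
    intro y hy x hx
    have h1 := norm_sub_le_of_mem_cube hy
    have h2 : d * l ≤ ‖c - x‖ := hx
    have h3 : ‖c - x‖ ≤ ‖c - y‖ + ‖y - x‖ := norm_sub_le_norm_sub_add_norm_sub _ _ _
    rw [norm_sub_rev c y] at h3
    nlinarith
  have hint : ∀ y ∈ cube c l, IntegrableOn (fun x => h x * czKernel Ω (y - x)) Far := fun y hy =>
    (hΩ.integrableOn_far hd hh y (by positivity : 0 < l / 2)).mono_set fun x hx => hfar y hy x hx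
  have hnode : ∀ u ∈ m, c + l • u ∈ cube c l := by
    intro u hu i
    have := hm u hu i
    simp only [PiLp.zero_apply, sub_zero] at this
    simp only [PiLp.add_apply, PiLp.smul_apply, smul_eq_mul, add_sub_cancel_left, abs_mul,
      abs_of_pos hl]
    nlinarith
  -- The polynomial interpolates the far part at the nodes of the cube. It is thus an explicit
  -- integral over `x`, and the Taylor polynomials of the kernel need not be chosen measurably in
  -- `x`.
  refine ⟨∑ u ∈ m, MvPolynomial.C (H (c + l • u)) * affineSub (-(l⁻¹ • c)) l⁻¹ (L u), ?_, ?_⟩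
  · exact MvPolynomial.totalDegree_finsetSum_le fun u _ =>
      totalDegree_C_mul_le _ ((totalDegree_affineSub_le _ _ _).trans (hL u))
  intro y hy
  set w : Euc d := l⁻¹ • (y - c) with hw
  have hwl : l • w = y - c := by rw [hw, smul_inv_smul₀ hl.ne']
  have hwc : w ∈ cube (0 : Euc d) 1 := by
    intro i
    have := hy i
    simp only [hw, PiLp.smul_apply, PiLp.sub_apply, smul_eq_mul, PiLp.zero_apply, sub_zero, abs_mul,
      abs_inv, abs_of_pos hl]
    rw [inv_mul_le_iff₀ hl]
    linarith
  have hS : polyFun (∑ u ∈ m, MvPolynomial.C (H (c + l • u)) * affineSub (-(l⁻¹ • c)) l⁻¹ (L u)) y =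
      ∫ x in Far, ∑ u ∈ m, polyFun (L u) w * (h x * czKernel Ω (c + l • u - x)) := by
    rw [integral_finsetSum _ fun u hu => (hint _ (hnode u hu)).const_mul _, polyFun_sum]
    refine Finset.sum_congr rfl fun u _ => ?_
    rw [integral_const_mul, polyFun_mul, polyFun_C, polyFun_affineSub, mul_comm]
    congr 2
    rw [hw, smul_sub]
    abel
  rw [hS, ← integral_sub (hint y hy)
    (integrable_finsetSum _ fun u hu => (hint _ (hnode u hu)).const_mul _)]
  obtain ⟨hr1, hr2⟩ := integral_far_sqrt (d := d) (δ := d * l) (by positivity)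
  have hmS : MeasurableSet {x : Euc d | d * l ≤ ‖x‖} :=
    measurableSet_le measurable_const measurable_norm
  set φ : Euc d → ℝ := fun z => A' * N * l ^ n * √l * ((√‖z‖)⁻¹ / ‖z‖ ^ d) with hφ
  have hφi : IntegrableOn (fun x => φ (c - x)) Far :=
    integrableOn_comp_sub_left hmS (hr1.const_mul _) c
  have hφv : ∫ x in Far, φ (c - x) ≤ A' * sphereConst d * N * l ^ n := by
    have h1 : ∫ x in Far, φ (c - x) = ∫ x in {x : Euc d | d * l ≤ ‖x‖}, φ x :=
      setIntegral_comp_sub_left φ hmS c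
    rw [h1, hφ, integral_const_mul, hr2]
    have h2 : √l * (√(d * l))⁻¹ ≤ 1 := by
      rw [← div_eq_mul_inv]
      refine div_le_one_of_le₀ (Real.sqrt_le_sqrt ?_) (Real.sqrt_nonneg _)
      nlinarith
    have h3 : 0 ≤ A' * N * l ^ n * sphereConst d :=
      mul_nonneg (by positivity) sphereConst_nonneg
    calc _ = A' * N * l ^ n * sphereConst d * (√l * (√(d * l))⁻¹) := by ring
      _ ≤ A' * N * l ^ n * sphereConst d * 1 := by gcongr
      _ = _ := by ring
  refine (norm_integral_le_of_norm_le hφi ?_).trans hφv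
  filter_upwards [ae_restrict_of_ae hbd, ae_restrict_mem hFm] with x hx hxF
  have hxF' : d * l ≤ ‖c - x‖ := hxF
  set z : Euc d := c - x with hz
  have hlz : l ≤ ‖z‖ := le_trans (by nlinarith) hxF'
  have hz0 : 0 < ‖z‖ := hl.trans_le hlz
  obtain ⟨P, hP, hPT⟩ := hT z (norm_pos_iff.1 hz0)
  have herr : ∀ v : Euc d, ‖v‖ ≤ d * (l / 2) →
      ‖czKernel Ω (z + v) - polyFun P v‖ ≤ A * (d * l) ^ (n + 1) / ‖z‖ ^ (d + n + 1) := by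
    intro v hv
    refine (hPT v (by linarith)).trans ?_
    gcongr
    nlinarith
  set e : ℝ := A * (d * l) ^ (n + 1) / ‖z‖ ^ (d + n + 1) with he
  have he0 : 0 ≤ e := by positivity
  have hy1 : ‖czKernel Ω (y - x) - polyFun P (y - c)‖ ≤ e := by
    have := herr (y - c) (norm_sub_le_of_mem_cube hy)
    rwa [show z + (y - c) = y - x by rw [hz]; abel] at this
  have hu1 : ∀ u ∈ m, ‖czKernel Ω (c + l • u - x) - polyFun P (l • u)‖ ≤ e := by
    intro u hu
    have h1 := norm_sub_le_of_mem_cube (hnode u hu)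
    rw [add_sub_cancel_left] at h1
    have := herr (l • u) h1
    rwa [show z + l • u = c + l • u - x by rw [hz]; abel] at this
  have hPrep : polyFun P (y - c) = ∑ u ∈ m, polyFun P (l • u) * polyFun (L u) w := by
    have h1 := hrep (affineSub 0 l P) ((totalDegree_affineSub_le _ _ _).trans hP)
    have h2 := congrArg (fun R => polyFun R w) h1
    simp only [polyFun_affineSub, zero_add, polyFun_sum, polyFun_mul, polyFun_C] at h2
    rw [← hwl, h2]
  -- Interpolation reproduces polynomials of degree at most `n`, so for each `x` the Taylor
  -- polynomial of the kernel cancels and only remainders are left.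
  have hid : h x * czKernel Ω (y - x) -
      ∑ u ∈ m, polyFun (L u) w * (h x * czKernel Ω (c + l • u - x)) =
      h x * ((czKernel Ω (y - x) - polyFun P (y - c)) -
        ∑ u ∈ m, polyFun (L u) w * (czKernel Ω (c + l • u - x) - polyFun P (l • u))) := by
    have h1 : ∑ u ∈ m, polyFun (L u) w * (czKernel Ω (c + l • u - x) - polyFun P (l • u)) =
        (∑ u ∈ m, polyFun (L u) w * czKernel Ω (c + l • u - x)) - polyFun P (y - c) := by
      rw [hPrep, ← Finset.sum_sub_distrib]
      exact Finset.sum_congr rfl fun u _ => by ring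
    have h2 : ∑ u ∈ m, polyFun (L u) w * (h x * czKernel Ω (c + l • u - x)) =
        h x * ∑ u ∈ m, polyFun (L u) w * czKernel Ω (c + l • u - x) := by
      rw [Finset.mul_sum]
      exact Finset.sum_congr rfl fun u _ => by ring
    rw [h1, h2]
    ring
  rw [hid, norm_mul]
  have hbr : ‖(czKernel Ω (y - x) - polyFun P (y - c)) -
      ∑ u ∈ m, polyFun (L u) w * (czKernel Ω (c + l • u - x) - polyFun P (l • u))‖ ≤ W * e := by
    refine (norm_sub_le _ _).trans ?_
    rw [hW, add_mul, one_mul, Finset.sum_mul]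
    refine add_le_add hy1 ((norm_sum_le _ _).trans (Finset.sum_le_sum fun u hu => ?_))
    rw [norm_mul]
    exact mul_le_mul ((hb u w hwc).trans (le_abs_self _)) (hu1 u hu) (norm_nonneg _) (abs_nonneg _)
  refine (mul_le_mul (hx hlz) hbr (norm_nonneg _) (by positivity)).trans (le_of_eq ?_)
  rw [hφ, he, hA']
  simp only
  have hsz : 0 < √‖z‖ := Real.sqrt_pos.2 hz0
  have hsl : 0 < √l := Real.sqrt_pos.2 hl
  have e1 : √‖z‖ * √‖z‖ = ‖z‖ := Real.mul_self_sqrt hz0.le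
  have e2 : √l * √l = l := Real.mul_self_sqrt hl.le
  rw [Real.sqrt_div hz0.le, show ‖z‖ ^ (d + n + 1) = ‖z‖ ^ d * ‖z‖ ^ n * ‖z‖ by
    rw [pow_succ, pow_add], mul_pow]
  rw [pow_succ l n]
  field_simp
  rw [pow_two, e1, pow_two, e2]
  ring

/-- The oscillation of the singular integral over a cube. -/
theorem IsCZNumerator.exists_osc_bound (hd : 1 ≤ d) (hΩ : IsCZNumerator (n + 1) Ω) :
    ∃ A : ℝ, 0 ≤ A ∧ ∀ (D : Set (Euc d)) (g : Euc d → 𝕜) (c : Euc d) (l N : ℝ),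
      MeasurableSet D → Integrable (D.indicator g) → 0 < l → 0 ≤ N → cube c l ⊆ D →
      (∀ᵐ x ∂volume.restrict D, ∀ ρ, l ≤ ρ → ‖x - c‖ ≤ ρ → ‖g x‖ ≤ N * ρ ^ n * √(ρ / l)) →
      (∀ᵐ y ∂volume.restrict (cube c l), ∀ δ, 0 < δ → cube y (2 * δ) ⊆ cube c l →
        ∀ᵐ x ∂volume.restrict D, ‖x - y‖ ≤ δ → ‖g x - g y‖ ≤ N * l ^ n * √(‖x - y‖ / δ)) →
      ∃ S : MvPolynomial (Fin d) 𝕜, S.totalDegree ≤ n ∧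
        ∫⁻ y in cube c l, ‖czOp Ω (D.indicator g) y - polyFun S y‖ₑ ≤
          ENNReal.ofReal (A * N * l ^ n * l ^ d) := by
  have : Nonempty (Fin d) := ⟨⟨0, hd⟩⟩
  have hd1 : (1 : ℝ) ≤ d := by exact_mod_cast hd
  obtain ⟨A₁, hA₁, hpv⟩ := hΩ.exists_pv_bound hd
  obtain ⟨A₂, hA₂, hfar⟩ := hΩ.exists_far_bound hd
  obtain ⟨A₃, hA₃, hK⟩ := hΩ.exists_bound hd
  set A₄ : ℝ := d ^ n * √d * A₃ * (sphereConst d * √(2 * d)) with hA₄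
  have hA₄0 : 0 ≤ A₄ := mul_nonneg (by positivity) (mul_nonneg sphereConst_nonneg (by positivity))
  refine ⟨4 * d * ((A₁ + A₂ + A₄) * 2), by positivity, ?_⟩
  intro D g c l N hDm hint hl hN hcD hgrow hhold
  set h := D.indicator g with hh
  have hR : l ≤ d * l := by nlinarith
  rw [ae_restrict_iff' hDm] at hgrow
  have hgrow' : ∀ᵐ x, ∀ ρ, l ≤ ρ → ‖x - c‖ ≤ ρ → ‖h x‖ ≤ N * ρ ^ n * √(ρ / l) := by
    filter_upwards [hgrow] with x hx ρ h1 h2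
    by_cases hxD : x ∈ D
    · rw [hh, Set.indicator_of_mem hxD]
      exact hx hxD ρ h1 h2
    · rw [hh, Set.indicator_of_notMem hxD, norm_zero]
      have := hl.trans_le h1
      positivity
  obtain ⟨S, hS, hSb⟩ := hfar h c l N hint hl hN (by
    filter_upwards [hgrow'] with x hx h1
    exact hx _ h1 (by rw [norm_sub_rev]))
  refine ⟨S, hS, ?_⟩
  have hpt : ∀ᵐ y ∂volume.restrict (cube c l), ∀ δ, 0 < δ → cube y (2 * δ) ⊆ cube c l →
      ‖czOp Ω h y - polyFun S y‖ ≤ (A₁ + A₂ + A₄) * N * l ^ n * √(l / δ) := by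
    filter_upwards [hhold, ae_restrict_mem (measurableSet_cube c l)] with y hy hyc δ hδ hsub
    have hδl : 2 * δ ≤ l := le_of_cube_subset hd (by positivity) hsub
    have hy' := hy δ hδ hsub
    rw [ae_restrict_iff' hDm] at hy'
    obtain ⟨-, hop⟩ := hpv h y δ (g y) (N * l ^ n) hint hδ (by positivity) (by
      filter_upwards [hy'] with x hx hxy
      rw [norm_sub_rev] at hxy ⊢
      have hxD : x ∈ D := hcD (hsub (mem_cube_of_norm_sub_le (by linarith)))
      rw [hh, Set.indicator_of_mem hxD, norm_sub_rev, norm_sub_rev y x]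
      exact hx hxD hxy.le)
    set near : Set (Euc d) := {x | δ ≤ ‖y - x‖} ∩ {x | ‖c - x‖ < d * l} with hnear
    have hnm : MeasurableSet {x : Euc d | ‖c - x‖ < d * l} := measurableSet_norm_sub_lt _ _
    -- Points with `‖c - x‖ ≥ d l` are automatically at distance at least `δ` from `y`, since `‖y -
    -- c‖ ≤ d l / 2` and `2δ ≤ l`.
    have hsplit : ∫ x in {x | δ ≤ ‖y - x‖}, h x * czKernel Ω (y - x) =
        (∫ x in near, h x * czKernel Ω (y - x)) +
          ∫ x in {x | d * l ≤ ‖c - x‖}, h x * czKernel Ω (y - x) := by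
      rw [← integral_inter_add_sdiff hnm (hΩ.integrableOn_far hd hint y hδ)]
      congr 3
      ext x
      simp only [Set.mem_sdiff, Set.mem_ofPred_eq, not_lt]
      refine ⟨fun h => h.2, fun h2 => ⟨?_, h2⟩⟩
      have h1 := norm_sub_le_of_mem_cube hyc
      have h3 : ‖c - x‖ ≤ ‖c - y‖ + ‖y - x‖ := norm_sub_le_norm_sub_add_norm_sub _ _ _
      rw [norm_sub_rev c y] at h3
      nlinarith
    have hnb : ‖∫ x in near, h x * czKernel Ω (y - x)‖ ≤ A₄ * N * l ^ n * √(l / δ) := by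
      obtain ⟨hr1, hr2⟩ := integral_ball_sqrt (d := d) (δ := 2 * d * l) (by positivity)
      have hmS : MeasurableSet {x : Euc d | ‖x‖ < 2 * d * l} :=
        measurableSet_lt measurable_norm measurable_const
      have hsδ : 0 < √δ := Real.sqrt_pos.2 hδ
      set a : ℝ := N * (d * l) ^ n * √d * (A₃ / √δ) with ha
      have ha0 : 0 ≤ a := by positivity
      set φ : Euc d → ℝ := fun z => a * (√‖z‖ / ‖z‖ ^ d) with hφ
      set Ball : Set (Euc d) := {x | ‖y - x‖ < 2 * d * l} with hBall
      have hφi : IntegrableOn (fun x => φ (y - x)) Ball :=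
        integrableOn_comp_sub_left hmS (hr1.const_mul _) y
      have hφv : ∫ x in Ball, φ (y - x) = a * (sphereConst d * √(2 * d * l)) := by
        refine (setIntegral_comp_sub_left φ hmS y).trans ?_
        rw [hφ, integral_const_mul, hr2]
      have hnB : near ⊆ Ball := by
        rintro x ⟨-, hx⟩
        have hx' : ‖c - x‖ < d * l := hx
        have h1 := norm_sub_le_of_mem_cube hyc
        have h3 : ‖y - x‖ ≤ ‖y - c‖ + ‖c - x‖ := norm_sub_le_norm_sub_add_norm_sub _ _ _
        change ‖y - x‖ < 2 * d * l
        nlinarith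
      have hφn : ∫ x in near, φ (y - x) ≤ ∫ x in Ball, φ (y - x) :=
        setIntegral_mono_set hφi (Eventually.of_forall fun x => by
          simp only [hφ, Pi.zero_apply]; positivity) (Eventually.of_forall hnB)
      refine (norm_integral_le_of_norm_le (hφi.mono_set hnB) ?_).trans (hφn.trans ?_)
      · filter_upwards [ae_restrict_of_ae hgrow', ae_restrict_mem
          ((measurableSet_le_norm_sub δ y).inter hnm)] with x hx hxn
        have hx1 : δ ≤ ‖y - x‖ := hxn.1
        have hx2 : ‖c - x‖ < d * l := hxn.2
        have h1 := hx (d * l) hR (by rw [norm_sub_rev]; exact hx2.le)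
        rw [mul_div_cancel_right₀ _ hl.ne'] at h1
        rw [norm_mul, hφ, ha]
        simp only
        -- Inserting this factor makes the bound `‖y - x‖^(-d)` integrable up to `y`. The price is a
        -- factor `√(l/δ)` in place of a logarithm.
        have h2 : 1 ≤ √‖y - x‖ / √δ := by
          rw [one_le_div hsδ]
          exact Real.sqrt_le_sqrt hx1
        calc _ ≤ N * (d * l) ^ n * √d * (A₃ / ‖y - x‖ ^ d) := by
              refine mul_le_mul h1 (hK _) (norm_nonneg _) (by positivity)
          _ ≤ N * (d * l) ^ n * √d * (A₃ / ‖y - x‖ ^ d * (√‖y - x‖ / √δ)) := by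
              gcongr
              exact le_mul_of_one_le_right (by positivity) h2
          _ = _ := by ring
      · rw [hφv, ha, hA₄, Real.sqrt_div hl.le, Real.sqrt_mul (by positivity) l, mul_pow]
        apply le_of_eq
        ring
    have hSy := hSb y hyc
    have h1 : 1 ≤ √(l / δ) := by
      rw [Real.one_le_sqrt, one_le_div hδ]
      linarith
    have hid : czOp Ω h y - polyFun S y =
        (czOp Ω h y - ∫ x in {x | δ ≤ ‖y - x‖}, h x * czKernel Ω (y - x)) +
        (∫ x in near, h x * czKernel Ω (y - x)) +
        ((∫ x in {x | d * l ≤ ‖c - x‖}, h x * czKernel Ω (y - x)) - polyFun S y) := by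
      rw [hsplit]; ring
    rw [hid]
    refine norm_add₃_le.trans ?_
    have e1 : A₁ * (N * l ^ n) ≤ A₁ * (N * l ^ n) * √(l / δ) :=
      le_mul_of_one_le_right (by positivity) h1
    have e2 : A₂ * N * l ^ n ≤ A₂ * N * l ^ n * √(l / δ) :=
      le_mul_of_one_le_right (by positivity) h1
    linarith
  refine (lintegral_cube_le_of_layers hd c hl (B := (A₁ + A₂ + A₄) * N * l ^ n * 2)
    (by positivity) _ ?_).trans (le_of_eq (by congr 1; ring))
  filter_upwards [hpt] with y hy j hyj
  rw [← ofReal_norm]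
  refine ENNReal.ofReal_le_ofReal ?_
  have h4 : (0 : ℝ) < (1 / 4) ^ j := by positivity
  have hsub : cube y (2 * (l * (1 / 4) ^ j / 2)) ⊆ cube c l := by
    intro z hz i
    have h1 := hz i
    have h2 := hyj i
    have h3 : |z i - c i| ≤ |z i - y i| + |y i - c i| := abs_sub_le _ _ _
    linarith
  refine (hy (l * (1 / 4) ^ j / 2) (by positivity) hsub).trans ?_
  rw [mul_assoc ((A₁ + A₂ + A₄) * N * l ^ n)]
  gcongr
  -- In the `j`-th layer the distance to the boundary is at least `l 4^(-j) / 2`, so `√(l/δ) = √2 ·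
  -- 2^j`, rounded up to `2 · 2^j`.
  have h5 : l / (l * (1 / 4) ^ j / 2) = 2 * (2 ^ j) ^ 2 := by
    have : ((1 / 4 : ℝ)) ^ j * (2 ^ j) ^ 2 = 1 := by
      rw [← pow_mul, mul_comm j 2, pow_mul, ← mul_pow]; norm_num
    rw [div_eq_iff (by positivity)]
    linear_combination (-l) * this
  rw [h5]
  refine Real.sqrt_le_iff.2 ⟨by positivity, ?_⟩
  have : (0 : ℝ) ≤ (2 ^ j) ^ 2 := by positivity
  nlinarith

end Oscillation

/-! ### Passage between the Zygmund norm and its quantitative form. -/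

section Membership

variable {n : ℕ} {D : Set (Euc d)} {f : Euc d → 𝕜}

theorem aestronglyMeasurable_cube (hf : LocallyIntegrableOn f D) {c : Euc d} {l : ℝ}
    (hc : cube c l ⊆ D) : AEStronglyMeasurable f (volume.restrict (cube c l)) :=
  (hf.integrableOn_compact_subset hc (isCompact_cube c l)).1

theorem laverage_cube_le_iff {F : Euc d → ℝ≥0∞} {c : Euc d} {l B : ℝ} (hl : 0 < l) (hB : 0 ≤ B) :
    ⨍⁻ x in cube c l, F x ∂volume ≤ ENNReal.ofReal B ↔
      ∫⁻ x in cube c l, F x ≤ ENNReal.ofReal (B * l ^ d) := by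
  have h0 : ENNReal.ofReal (l ^ d) ≠ 0 := by
    rw [Ne, ENNReal.ofReal_eq_zero, not_le]; positivity
  rw [setLAverage_eq, volume_cube c l hl.le, ENNReal.div_le_iff h0 ENNReal.ofReal_ne_top,
    ENNReal.ofReal_mul hB]

theorem exists_approxOn_of_seminorm_lt (hf : LocallyIntegrableOn f D) {N : ℝ}
    (hN : 0 ≤ N) (h : zygmundSeminorm n D f < ENNReal.ofReal N) (c : Euc d) (l : ℝ) (hl : 0 < l)
    (hc : cube c l ⊆ D) : ∃ P, ApproxOn n f N c l P := by
  have h1 : (⨅ (P : MvPolynomial (Fin d) 𝕜) (_ : P.totalDegree ≤ n),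
      (⨍⁻ x in cube c l, ‖f x - polyFun P x‖ₑ ∂volume) / ENNReal.ofReal (l ^ n)) <
      ENNReal.ofReal N :=
    lt_of_le_of_lt (le_iSup_of_le c (le_iSup_of_le l (le_iSup_of_le hl
      (le_iSup (fun _ : cube c l ⊆ D => _) hc)))) h
  simp only [iInf_lt_iff] at h1
  obtain ⟨P, hP, hlt⟩ := h1
  refine ⟨P, hP, aestronglyMeasurable_cube hf hc, ?_⟩
  have h0 : ENNReal.ofReal (l ^ n) ≠ 0 := by
    rw [Ne, ENNReal.ofReal_eq_zero, not_le]; positivity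
  rw [ENNReal.div_lt_iff (Or.inl h0) (Or.inl ENNReal.ofReal_ne_top),
    ← ENNReal.ofReal_mul hN] at hlt
  exact (laverage_cube_le_iff hl (by positivity)).1 hlt.le

theorem seminorm_le_of_approxOn {N : ℝ} (hN : 0 ≤ N)
    (h : ∀ c l, 0 < l → cube c l ⊆ D → ∃ P, ApproxOn n f N c l P) :
    zygmundSeminorm n D f ≤ ENNReal.ofReal N := by
  refine iSup₂_le fun c l => iSup₂_le fun hl hc => ?_
  obtain ⟨P, hP⟩ := h c l hl hc
  refine iInf₂_le_of_le P hP.deg ?_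
  have h0 : ENNReal.ofReal (l ^ n) ≠ 0 := by
    rw [Ne, ENNReal.ofReal_eq_zero, not_le]; positivity
  rw [ENNReal.div_le_iff h0 ENNReal.ofReal_ne_top, ← ENNReal.ofReal_mul hN]
  exact (laverage_cube_le_iff hl (by positivity)).2 hP.le

theorem good_of_norm_lt (hf : LocallyIntegrableOn f D) {N : ℝ} (hN : 0 ≤ N)
    (h : zygmundNorm n D f < ENNReal.ofReal N) (l₀ : ℝ) (hl₀ : 0 < l₀) : Good n D l₀ f N := by
  refine ⟨hf, exists_approxOn_of_seminorm_lt hf hN (lt_of_le_of_lt le_self_add h), ?_⟩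
  intro c l hl hc
  have h1 : ∫⁻ x in D, ‖f x‖ₑ ≤ ENNReal.ofReal N := (le_add_self.trans_lt h).le
  refine (lintegral_mono_set ?_).trans h1
  have : 0 < l := hl₀.trans_le hl
  exact (cube_subset_cube (by rw [sub_self, norm_zero]; linarith)).trans hc

/-- Membership gives only local integrability. The halves of all cubes of side at least `l₀` lie in
the compact set of points at distance at least `l₀ / 4` from the complement of `D`, where `f` is
integrable; this is why `Good` measures mass on half cubes. -/
theorem exists_good_of_memZygmund (hb : Bornology.IsBounded D) (hf : MemZygmund n D f) (l₀ : ℝ)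
    (hl₀ : 0 < l₀) : ∃ N, 0 ≤ N ∧ Good n D l₀ f N := by
  set K : Set (Euc d) := {x | ENNReal.ofReal (l₀ / 4) ≤ Metric.infEDist x Dᶜ} with hK
  have hKD : K ⊆ D := by
    intro x hx
    by_contra hxD
    have h1 : Metric.infEDist x Dᶜ = 0 := Metric.infEDist_zero_of_mem hxD
    have h2 : ENNReal.ofReal (l₀ / 4) ≤ Metric.infEDist x Dᶜ := hx
    rw [h1, nonpos_iff_eq_zero, ENNReal.ofReal_eq_zero] at h2
    linarith
  have hKc : IsCompact K := Metric.isCompact_of_isClosed_isBounded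
    (isClosed_le continuous_const Metric.continuous_infEDist) (hb.subset hKD)
  have hint : IntegrableOn f K := hf.1.integrableOn_compact_subset hKD hKc
  have hfin : ∫⁻ x in K, ‖f x‖ₑ < ∞ := hint.2
  set N₁ : ℝ := (zygmundSeminorm n D f).toReal + 1 with hN₁
  set N₂ : ℝ := (∫⁻ x in K, ‖f x‖ₑ).toReal with hN₂
  have h1 : 0 ≤ (zygmundSeminorm n D f).toReal := ENNReal.toReal_nonneg
  have h2 : 0 ≤ N₂ := ENNReal.toReal_nonneg
  refine ⟨N₁ + N₂, by positivity, hf.1, ?_, ?_⟩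
  · refine exists_approxOn_of_seminorm_lt hf.1 (by positivity) ?_
    rw [← ENNReal.ofReal_toReal hf.2.ne]
    exact ENNReal.ofReal_lt_ofReal_iff (by positivity) |>.2 (by linarith)
  · intro c l hl hc
    have hsub : cube c (l / 2) ⊆ K := by
      intro x hx
      refine Metric.le_infEDist.2 fun w hw => ?_
      by_contra hlt
      push Not at hlt
      rw [edist_dist, ENNReal.ofReal_lt_ofReal_iff (by positivity), dist_comm, dist_eq_norm] at hlt
      refine hw (hc fun i => ?_)
      have e1 := hx i
      have e2 : |w i - x i| ≤ ‖w - x‖ := by simpa using abs_apply_le_norm (w - x) i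
      have e3 : |w i - c i| ≤ |w i - x i| + |x i - c i| := abs_sub_le _ _ _
      linarith
    refine (lintegral_mono_set hsub).trans ?_
    rw [← ENNReal.ofReal_toReal hfin.ne]
    exact ENNReal.ofReal_le_ofReal (by linarith)

end Membership

/-! ### Linearity of the principal value at points where it exists. -/

section Linearity

variable {Ω f g : Euc d → 𝕜} {y : Euc d}

theorem PVExists.tendsto (h : PVExists Ω f y) :
    Tendsto (czTrunc Ω f y) (𝓝[>] 0) (𝓝 (czOp Ω f y)) := by
  obtain ⟨v, hv⟩ := h.2
  rwa [czOp, hv.limUnder_eq]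

theorem PVExists.of_tendsto
    (h : ∀ ε : ℝ, 0 < ε → IntegrableOn (fun x => f x * czKernel Ω (y - x)) {x | ε < ‖y - x‖})
    {v : 𝕜} (hv : Tendsto (czTrunc Ω f y) (𝓝[>] 0) (𝓝 v)) :
    PVExists Ω f y ∧ czOp Ω f y = v :=
  ⟨⟨h, v, hv⟩, hv.limUnder_eq⟩

theorem PVExists.add (hf : PVExists Ω f y) (hg : PVExists Ω g y) :
    PVExists Ω (fun x => f x + g x) y ∧
      czOp Ω (fun x => f x + g x) y = czOp Ω f y + czOp Ω g y := by
  refine PVExists.of_tendsto (fun ε hε => ?_) ((hf.tendsto.add hg.tendsto).congr' ?_)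
  · simp only [add_mul]
    exact (hf.1 ε hε).add (hg.1 ε hε)
  · filter_upwards [self_mem_nhdsWithin] with ε hε
    simp only [czTrunc, add_mul]
    exact (integral_add (hf.1 ε hε) (hg.1 ε hε)).symm

theorem PVExists.const_mul (hf : PVExists Ω f y) (a : 𝕜) :
    PVExists Ω (fun x => a * f x) y ∧ czOp Ω (fun x => a * f x) y = a * czOp Ω f y := by
  refine PVExists.of_tendsto (fun ε hε => ?_) ((hf.tendsto.const_mul a).congr' ?_)
  · simp only [mul_assoc]
    exact (hf.1 ε hε).const_mul a
  · filter_upwards [self_mem_nhdsWithin] with ε hε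
    simp only [czTrunc, mul_assoc]
    exact (integral_const_mul _ _).symm

theorem czOp_zero : PVExists Ω (fun _ => 0) y ∧ czOp Ω (fun _ => 0) y = 0 := by
  refine PVExists.of_tendsto (fun ε hε => ?_) (tendsto_const_nhds.congr fun ε => ?_)
  · simp
  · simp [czTrunc]

theorem PVExists.sum {ι : Type*} (s : Finset ι) (F : ι → Euc d → 𝕜)
    (h : ∀ i ∈ s, PVExists Ω (F i) y) :
    PVExists Ω (fun x => ∑ i ∈ s, F i x) y ∧
      czOp Ω (fun x => ∑ i ∈ s, F i x) y = ∑ i ∈ s, czOp Ω (F i) y := by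
  classical
  induction s using Finset.induction_on with
  | empty => simpa using czOp_zero
  | insert i s hi ih =>
    have h1 := ih fun j hj => h j (Finset.mem_insert_of_mem hj)
    have h2 := (h i (Finset.mem_insert_self i s)).add h1.1
    simp only [Finset.sum_insert hi]
    exact ⟨h2.1, by rw [h2.2, h1.2]⟩

end Linearity

/-! ### Measurability of the restricted singular integral. -/

section Measurability

variable {n : ℕ} {Ω : Euc d → 𝕜}

theorem IsCZNumerator.aestronglyMeasurable_trunc (hΩ : IsCZNumerator (n + 1) Ω) {h : Euc d → 𝕜}
    (hh : AEStronglyMeasurable h volume) (ε : ℝ) :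
    StronglyMeasurable fun y => czTrunc Ω h y ε := by
  obtain ⟨h', hm, hae⟩ := hh
  have h1 : (fun y => czTrunc Ω h y ε) = fun y => ∫ x, {p : Euc d × Euc d | ε < ‖p.1 - p.2‖}.indicator
      (fun p => h' p.2 * czKernel Ω (p.1 - p.2)) (y, x) := by
    funext y
    rw [czTrunc, ← integral_indicator (measurableSet_lt_norm_sub ε y)]
    refine integral_congr_ae ?_
    filter_upwards [hae] with x hx
    by_cases hxy : ε < ‖y - x‖
    · rw [Set.indicator_of_mem (show x ∈ {x | ε < ‖y - x‖} from hxy),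
        Set.indicator_of_mem (show (y, x) ∈ {p : Euc d × Euc d | ε < ‖p.1 - p.2‖} from hxy), hx]
    · rw [Set.indicator_of_notMem (show x ∉ {x | ε < ‖y - x‖} from hxy),
        Set.indicator_of_notMem (show (y, x) ∉ {p : Euc d × Euc d | ε < ‖p.1 - p.2‖} from hxy)]
  rw [h1]
  refine StronglyMeasurable.integral_prod_right ?_
  refine StronglyMeasurable.indicator ?_ (measurableSet_lt measurable_const (by fun_prop))
  exact (hm.comp_measurable measurable_snd).mul
    (hΩ.measurable_kernel.comp (measurable_fst.sub measurable_snd)).stronglyMeasurable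

/-- Where the principal value exists it is the limit of the truncations along `ε = 1/(k+1)`, and
these are parameter integrals of jointly measurable functions. -/
theorem IsCZNumerator.aestronglyMeasurable_restricted (hΩ : IsCZNumerator (n + 1) Ω)
    {D : Set (Euc d)} (hD : MeasurableSet D) {f : Euc d → 𝕜} (hf : Integrable (D.indicator f))
    (hpv : ∀ᵐ y ∂volume.restrict D, PVExists Ω (D.indicator f) y) :
    AEStronglyMeasurable (restrictedCZ Ω D f) (volume.restrict D) := by
  have h1 : AEStronglyMeasurable (czOp Ω (D.indicator f)) (volume.restrict D) := by
    refine aestronglyMeasurable_of_tendsto_ae (u := atTop)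
      (f := fun (k : ℕ) y => czTrunc Ω (D.indicator f) y (1 / ((k : ℝ) + 1)))
      (fun k => (hΩ.aestronglyMeasurable_trunc hf.1 _).aestronglyMeasurable) ?_
    filter_upwards [hpv] with y hy
    refine hy.tendsto.comp (tendsto_nhdsWithin_iff.2 ⟨tendsto_one_div_add_atTop_nhds_zero_nat, ?_⟩)
    exact Eventually.of_forall fun k => Set.mem_Ioi.2 (by positivity)
  refine h1.congr ?_
  filter_upwards [ae_restrict_mem hD] with y hy
  rw [restrictedCZ, Set.indicator_of_mem hy]

end Measurability

/-! ### Integrability on the whole domain. -/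

section Bounds

open MvPolynomial

/-- Boundedness at Lebesgue points and finite volume upgrade local integrability to integrability on
`D`. -/
theorem Good.integrable {n : ℕ} (hd : 1 ≤ d) (hn : 1 ≤ n) {D : Set (Euc d)} {κ r Δ : ℝ}
    (hD : ConeDomain D κ r Δ) {f : Euc d → 𝕜} {N : ℝ} (hN : 0 ≤ N)
    (hf : Good n D (κ * r) f N) : Integrable (D.indicator f) := by
  obtain ⟨A, hA, hs⟩ := exists_sup_bound 𝕜 hd n hn hD
  rw [integrable_indicator_iff hD.isOpen.measurableSet]
  have hvol : volume D ≠ ∞ := by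
    have : Bornology.IsBounded D := Metric.isBounded_iff.2 ⟨Δ, fun x hx y hy => by
      rw [dist_eq_norm]; exact hD.norm_sub_le x hx y hy⟩
    exact this.measure_lt_top.ne
  have : IsFiniteMeasure (volume.restrict D) := ⟨by simpa using hvol.lt_top⟩
  refine ⟨hf.locInt.aestronglyMeasurable, HasFiniteIntegral.of_bounded (C := A * N) ?_⟩
  filter_upwards [ae_lebesguePt hD.isOpen hf.locInt, ae_restrict_mem hD.isOpen.measurableSet]
    with x hx hxD
  exact hs f N hN hf x hxD hx

end Bounds

/-! ### Pointwise existence and interior bounds for the singular integral. -/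

section Pointwise

open MvPolynomial

variable {n : ℕ} {D : Set (Euc d)} {κ r Δ : ℝ} {Ω : Euc d → 𝕜}

theorem ConeDomain.isBounded (hD : ConeDomain D κ r Δ) : Bornology.IsBounded D :=
  Metric.isBounded_iff.2 ⟨Δ, fun x hx y hy => by
    rw [dist_eq_norm]; exact hD.norm_sub_le x hx y hy⟩

theorem ConeDomain.volume_lt_top (hD : ConeDomain D κ r Δ) : volume D < ∞ :=
  hD.isBounded.measure_lt_top

/-- At distance at least `δ` from the boundary, `f` itself is Hölder continuous at `y`: so is `f -
P` on the cube about `y`, and the coefficients of `P` are bounded. The rest of the integral is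
estimated by the supremum of `f`, the size of the kernel and the volume of `D`. The constant depends
on `δ`. -/
theorem IsCZNumerator.exists_pointwise_bound (hd : 1 ≤ d) (hn : 1 ≤ n)
    (hΩ : IsCZNumerator (n + 1) Ω) (hD : ConeDomain D κ r Δ) (δ : ℝ) (hδ : 0 < δ) :
    ∃ A : ℝ, 0 ≤ A ∧ ∀ (f : Euc d → 𝕜) (N : ℝ), 0 ≤ N → Good n D (κ * r) f N →
      ∀ y, LebesguePt f y → cube y (2 * δ) ⊆ D →
        PVExists Ω (D.indicator f) y ∧ ‖czOp Ω (D.indicator f) y‖ ≤ A * N := by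
  obtain ⟨A₁, hA₁, hhol⟩ := exists_holder_bound 𝕜 hd n hn hD
  obtain ⟨A₂, hA₂, hcc⟩ := exists_center_coeff_bound 𝕜 hd n hD
  obtain ⟨A₃, hA₃, hK⟩ := hΩ.exists_bound hd
  obtain ⟨A₄, hA₄, hs⟩ := exists_sup_bound 𝕜 hd n hn hD
  obtain ⟨A₅, hA₅, hpv⟩ := hΩ.exists_pv_bound hd
  set I : ℝ := (((multiIdx d n).erase 0).card : ℝ) with hI
  set M : ℝ := max 1 (Real.log (1 / (2 * δ))) with hM
  have hM1 : 1 ≤ M := le_max_left _ _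
  set B : ℝ := A₁ * (2 * δ) ^ n + I * (A₂ * M * (1 + δ) ^ n) with hB
  have hB0 : 0 ≤ B := by positivity
  set V : ℝ := (volume D).toReal with hV
  refine ⟨A₅ * B + A₄ * (A₃ / δ ^ d) * V, by positivity, ?_⟩
  intro f N hN hf y hy hsub
  have hDm := hD.isOpen.measurableSet
  have hleb : ∀ᵐ x, x ∈ D → LebesguePt f x :=
    (ae_restrict_iff' hDm).1 (ae_lebesguePt hD.isOpen hf.locInt)
  have hint := hf.integrable hd hn hD hN
  obtain ⟨P, hP⟩ := hf.approx y (2 * δ) (by positivity) hsub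
  have hyD : y ∈ D := hsub (self_mem_cube y (by positivity))
  obtain ⟨h1, h2⟩ := hpv (D.indicator f) y δ (f y) (B * N) hint hδ (by positivity) (by
    filter_upwards [hleb] with x hx hxy
    rw [norm_sub_rev] at hxy
    have hxD : x ∈ D := hsub (mem_cube_of_norm_sub_le (by linarith))
    rw [Set.indicator_of_mem hxD]
    have e1 := hhol f N hN hf y (2 * δ) P (by positivity) hsub hP y δ hδ subset_rfl hy x (hx hxD)
      hxy.le
    have e2 : ‖polyFun P x - polyFun P y‖ ≤ I * (A₂ * M * (1 + δ) ^ n) * N * √(‖x - y‖ / δ) := by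
      refine (norm_polyFun_sub_le hP.deg y x).trans ?_
      have : ∀ s ∈ (multiIdx d n).erase 0, ‖coeff s (affineSub y 1 P)‖ * ‖x - y‖ ^ s.degree ≤
          A₂ * M * (1 + δ) ^ n * N * √(‖x - y‖ / δ) := by
        intro s hs
        rw [Finset.mem_erase, mem_multiIdx] at hs
        have c1 : ‖coeff s (affineSub y 1 P)‖ ≤ A₂ * N * M := by
          refine (hcc f N hN hf y (2 * δ) P (by positivity) hsub hP s hs.2).trans ?_
          gcongr
          split_ifs
          exacts [hM1, le_rfl]
        set t := ‖x - y‖ / δ with ht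
        have ht0 : 0 ≤ t := by positivity
        have ht1 : t ≤ 1 := (div_le_one hδ).2 hxy.le
        have c2 : ‖x - y‖ = δ * t := by rw [ht]; field_simp
        have hk : s.degree ≠ 0 := fun h => hs.1 ((Finsupp.degree_eq_zero_iff s).1 h)
        have c3 : t ^ s.degree ≤ √t := by
          refine (pow_le_of_le_one ht0 ht1 hk).trans ?_
          exact Real.le_sqrt_of_sq_le (by nlinarith)
        have c4 : δ ^ s.degree ≤ (1 + δ) ^ n :=
          (pow_le_pow_left₀ hδ.le (by linarith) _).trans (pow_le_pow_right₀ (by linarith) hs.2)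
        rw [c2, mul_pow]
        calc ‖coeff s (affineSub y 1 P)‖ * (δ ^ s.degree * t ^ s.degree)
            ≤ (A₂ * N * M) * ((1 + δ) ^ n * √t) := by gcongr
          _ = _ := by ring
      refine (Finset.sum_le_sum this).trans (le_of_eq ?_)
      rw [Finset.sum_const, nsmul_eq_mul]
      ring
    have e3 : f x - f y = ((f x - polyFun P x) - (f y - polyFun P y)) +
      (polyFun P x - polyFun P y) := by ring
    rw [e3]
    refine (norm_add_le _ _).trans ((add_le_add e1 e2).trans (le_of_eq ?_))
    rw [hB, norm_sub_rev y x]; ring)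
  refine ⟨h1, ?_⟩
  have h3 : ‖∫ x in {x | δ ≤ ‖y - x‖}, D.indicator f x * czKernel Ω (y - x)‖ ≤
      A₄ * N * (A₃ / δ ^ d) * V := by
    have e1 : (fun x => D.indicator f x * czKernel Ω (y - x)) =
        D.indicator fun x => f x * czKernel Ω (y - x) := by
      funext x
      by_cases hx : x ∈ D <;> simp [hx]
    rw [e1, setIntegral_indicator hDm]
    have hfin : volume ({x | δ ≤ ‖y - x‖} ∩ D) < ∞ :=
      (measure_mono Set.inter_subset_right).trans_lt hD.volume_lt_top
    refine (norm_setIntegral_le_of_norm_le_const_ae' (C := A₄ * N * (A₃ / δ ^ d)) hfin ?_).trans ?_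
    · filter_upwards [hleb] with x hx hxS
      rw [norm_mul]
      have hx1 : δ ≤ ‖y - x‖ := hxS.1
      have := hs f N hN hf x hxS.2 (hx hxS.2)
      gcongr
      refine (hK (y - x)).trans ?_
      gcongr
    · gcongr
      exact ENNReal.toReal_mono hD.volume_lt_top.ne (measure_mono Set.inter_subset_right)
  have h4 := norm_add_le (czOp Ω (D.indicator f) y -
    ∫ x in {x | δ ≤ ‖y - x‖}, D.indicator f x * czKernel Ω (y - x))
    (∫ x in {x | δ ≤ ‖y - x‖}, D.indicator f x * czKernel Ω (y - x))
  rw [sub_add_cancel] at h4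
  calc _ ≤ _ := h4
    _ ≤ A₅ * (B * N) + A₄ * N * (A₃ / δ ^ d) * V := add_le_add h2 h3
    _ = _ := by ring

theorem exists_cube_subset (hD : IsOpen D) {x : Euc d} (hx : x ∈ D) :
    ∃ δ, 0 < δ ∧ cube x δ ⊆ D := by
  obtain ⟨ε, hε, hb⟩ := Metric.isOpen_iff.1 hD x hx
  refine ⟨ε / (d + 1), by positivity, fun z hz => hb ?_⟩
  rw [Metric.mem_ball, dist_eq_norm]
  refine (norm_sub_le_of_mem_cube hz).trans_lt ?_
  have : (d : ℝ) * (ε / (d + 1) / 2) = ε * (d / (d + 1)) / 2 := by ring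
  have h1 : (d : ℝ) / (d + 1) ≤ 1 := by rw [div_le_one (by positivity)]; linarith
  rw [this]
  nlinarith

theorem Good.pvExists (hd : 1 ≤ d) (hn : 1 ≤ n) (hΩ : IsCZNumerator (n + 1) Ω)
    (hD : ConeDomain D κ r Δ) {f : Euc d → 𝕜} {N : ℝ} (hN : 0 ≤ N)
    (hf : Good n D (κ * r) f N) : ∀ᵐ y ∂volume.restrict D, PVExists Ω (D.indicator f) y := by
  filter_upwards [ae_lebesguePt hD.isOpen hf.locInt, ae_restrict_mem hD.isOpen.measurableSet]
    with y hy hyD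
  obtain ⟨δ, hδ, hsub⟩ := exists_cube_subset hD.isOpen hyD
  obtain ⟨A, -, h⟩ := hΩ.exists_pointwise_bound hd hn hD (δ / 2) (by positivity)
  exact (h f N hN hf y hy (by rwa [mul_div_cancel₀ _ (two_ne_zero' ℝ)])).1

theorem good_polyFun (hD : ConeDomain D κ r Δ) {P : MvPolynomial (Fin d) 𝕜}
    (hP : P.totalDegree ≤ n) (l₀ : ℝ) (hl₀ : 0 < l₀) : ∃ N, 0 ≤ N ∧ Good n D l₀ (polyFun P) N := by
  have hloc : LocallyIntegrableOn (polyFun P : Euc d → 𝕜) D :=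
    (continuous_polyFun P).locallyIntegrable.locallyIntegrableOn D
  refine exists_good_of_memZygmund hD.isBounded ⟨hloc, ?_⟩ l₀ hl₀
  refine (seminorm_le_of_approxOn (N := 0) le_rfl fun c l hl hc =>
    ⟨P, hP, aestronglyMeasurable_cube hloc hc, by simp⟩).trans_lt ENNReal.ofReal_lt_top

end Pointwise

/-! ### Linear combinations of approximations and of restricted principal values. -/

section Linear

open MvPolynomial

variable {n : ℕ} {f g : Euc d → 𝕜} {N M : ℝ} {c : Euc d} {l : ℝ} {P Q : MvPolynomial (Fin d) 𝕜}

theorem ApproxOn.congr (hf : ApproxOn n f N c l P) (h : f =ᵐ[volume.restrict (cube c l)] g) :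
    ApproxOn n g N c l P := by
  refine ⟨hf.deg, hf.meas.congr h, le_of_eq_of_le (lintegral_congr_ae ?_) hf.le⟩
  filter_upwards [h] with x hx
  rw [hx]

theorem ApproxOn.mono (hf : ApproxOn n f N c l P) (hl : 0 < l) (h : N ≤ M) :
    ApproxOn n f M c l P :=
  ⟨hf.deg, hf.meas, hf.le.trans (ENNReal.ofReal_le_ofReal (by gcongr))⟩

theorem ApproxOn.add (hf : ApproxOn n f N c l P) (hg : ApproxOn n g M c l Q) (hl : 0 < l)
    (hN : 0 ≤ N) (hM : 0 ≤ M) : ApproxOn n (fun x => f x + g x) (N + M) c l (P + Q) := by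
  refine ⟨totalDegree_add_le hf.deg hg.deg, hf.meas.add hg.meas, ?_⟩
  calc ∫⁻ x in cube c l, ‖f x + g x - polyFun (P + Q) x‖ₑ
      ≤ ∫⁻ x in cube c l, (‖f x - polyFun P x‖ₑ + ‖g x - polyFun Q x‖ₑ) := by
        refine lintegral_mono fun x => ?_
        rw [polyFun_add, add_sub_add_comm]
        exact enorm_add_le _ _
    _ ≤ _ := by
        rw [lintegral_add_left' (aemeasurable_enorm_sub_polyFun hf.meas P),
          show (N + M) * l ^ n * l ^ d = N * l ^ n * l ^ d + M * l ^ n * l ^ d by ring,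
          ENNReal.ofReal_add (by positivity) (by positivity)]
        exact add_le_add hf.le hg.le

theorem ApproxOn.const_mul (hf : ApproxOn n f N c l P) (a : 𝕜) :
    ApproxOn n (fun x => a * f x) (‖a‖ * N) c l (C a * P) := by
  refine ⟨totalDegree_C_mul_le _ hf.deg, hf.meas.const_mul a, ?_⟩
  have : ∀ x, ‖a * f x - polyFun (C a * P) x‖ₑ = ‖a‖ₑ * ‖f x - polyFun P x‖ₑ := fun x => by
    rw [polyFun_mul, polyFun_C, ← mul_sub, enorm_mul]
  simp only [this]
  rw [lintegral_const_mul'' _ (aemeasurable_enorm_sub_polyFun hf.meas P),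
    show ‖a‖ * N * l ^ n * l ^ d = ‖a‖ * (N * l ^ n * l ^ d) by ring,
    ENNReal.ofReal_mul (norm_nonneg a), ofReal_norm]
  gcongr
  exact hf.le

theorem ApproxOn.sum {ι : Type*} (s : Finset ι) (F : ι → Euc d → 𝕜) (N : ι → ℝ)
    (S : ι → MvPolynomial (Fin d) 𝕜) (hl : 0 < l) (hN : ∀ i ∈ s, 0 ≤ N i)
    (h : ∀ i ∈ s, ApproxOn n (F i) (N i) c l (S i)) :
    ApproxOn n (fun x => ∑ i ∈ s, F i x) (∑ i ∈ s, N i) c l (∑ i ∈ s, S i) := by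
  classical
  induction s using Finset.induction_on with
  | empty => exact ⟨by simp, by simpa using aestronglyMeasurable_const, by simp⟩
  | insert i s hi ih =>
    simp only [Finset.sum_insert hi]
    refine (h i (Finset.mem_insert_self i s)).add (ih (fun j hj => hN j (Finset.mem_insert_of_mem hj))
      fun j hj => h j (Finset.mem_insert_of_mem hj)) hl (hN i (Finset.mem_insert_self i s)) ?_
    exact Finset.sum_nonneg fun j hj => hN j (Finset.mem_insert_of_mem hj)

variable {D : Set (Euc d)} {Ω : Euc d → 𝕜} {y : Euc d}

theorem pv_indicator_add (hf : PVExists Ω (D.indicator f) y) (hg : PVExists Ω (D.indicator g) y) :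
    PVExists Ω (D.indicator fun x => f x + g x) y ∧
      czOp Ω (D.indicator fun x => f x + g x) y =
        czOp Ω (D.indicator f) y + czOp Ω (D.indicator g) y := by
  have : (D.indicator fun x => f x + g x) = fun x => D.indicator f x + D.indicator g x := by
    funext x
    by_cases hx : x ∈ D <;> simp [hx]
  rw [this]
  exact hf.add hg

theorem pv_indicator_const_mul (hf : PVExists Ω (D.indicator f) y) (a : 𝕜) :
    PVExists Ω (D.indicator fun x => a * f x) y ∧
      czOp Ω (D.indicator fun x => a * f x) y = a * czOp Ω (D.indicator f) y := by
  have : (D.indicator fun x => a * f x) = fun x => a * D.indicator f x := by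
    funext x
    by_cases hx : x ∈ D <;> simp [hx]
  rw [this]
  exact hf.const_mul a

theorem pv_indicator_sum {ι : Type*} (s : Finset ι) (F : ι → Euc d → 𝕜)
    (h : ∀ i ∈ s, PVExists Ω (D.indicator (F i)) y) :
    PVExists Ω (D.indicator fun x => ∑ i ∈ s, F i x) y ∧
      czOp Ω (D.indicator fun x => ∑ i ∈ s, F i x) y =
        ∑ i ∈ s, czOp Ω (D.indicator (F i)) y := by
  have : (D.indicator fun x => ∑ i ∈ s, F i x) = fun x => ∑ i ∈ s, D.indicator (F i) x := by
    funext x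
    by_cases hx : x ∈ D <;> simp [hx]
  rw [this]
  exact PVExists.sum s _ h

end Linear

/-! ### Sufficiency of the two conditions. -/

section Sufficiency

open MvPolynomial

variable {n : ℕ} {D : Set (Euc d)} {κ r Δ : ℝ} {Ω : Euc d → 𝕜}

theorem cube_subset_of_mem {c y : Euc d} {a b l : ℝ} (hy : y ∈ cube c a) (h : a + b ≤ l) :
    cube y b ⊆ cube c l := by
  intro z hz i
  have h1 := hz i
  have h2 := hy i
  have h3 := abs_sub_le (z i) (y i) (c i)
  linarith

theorem totalDegree_monomial_one_le {s : Fin d →₀ ℕ} (hs : s ∈ multiIdx d n) :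
    (monomial s (1 : 𝕜)).totalDegree ≤ n := by
  rw [mem_multiIdx, Finsupp.degree_apply] at hs
  exact (totalDegree_monomial_le s _).trans hs

theorem IsCZNumerator.locallyIntegrableOn_restricted (hd : 1 ≤ d) (hn : 1 ≤ n)
    (hΩ : IsCZNumerator (n + 1) Ω) (hD : ConeDomain D κ r Δ) {f : Euc d → 𝕜} {N : ℝ} (hN : 0 ≤ N)
    (hf : Good n D (κ * r) f N) : LocallyIntegrableOn (restrictedCZ Ω D f) D := by
  have hDm := hD.isOpen.measurableSet
  have hmeas := hΩ.aestronglyMeasurable_restricted hDm (hf.integrable hd hn hD hN)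
    (hf.pvExists hd hn hΩ hD hN)
  intro x hx
  obtain ⟨δ, hδ, hsub⟩ := exists_cube_subset hD.isOpen hx
  obtain ⟨A, hA, hb⟩ := hΩ.exists_pointwise_bound hd hn hD (δ / 4) (by positivity)
  refine ⟨cube x (δ / 2), ?_, ?_⟩
  · refine mem_nhdsWithin_of_mem_nhds (Filter.mem_of_superset
      (Metric.ball_mem_nhds x (show 0 < δ / 4 by positivity)) fun z hz => ?_)
    rw [Metric.mem_ball, dist_eq_norm] at hz
    exact mem_cube_of_norm_sub_le (by linarith)
  · have hs : cube x (δ / 2) ⊆ D :=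
      (cube_subset_cube (by rw [sub_self, norm_zero]; linarith)).trans hsub
    have : IsFiniteMeasure (volume.restrict (cube x (δ / 2))) :=
      ⟨by simpa using (isCompact_cube x (δ / 2)).measure_lt_top⟩
    refine ⟨hmeas.mono_measure (Measure.restrict_mono hs le_rfl),
      HasFiniteIntegral.of_bounded (C := A * N) ?_⟩
    filter_upwards [ae_restrict_of_ae_restrict_of_subset hs (ae_lebesguePt hD.isOpen hf.locInt),
      ae_restrict_mem (measurableSet_cube x (δ / 2))] with y hy hyx
    rw [restrictedCZ, Set.indicator_of_mem (hs hyx)]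
    exact (hb f N hN hf y hy ((cube_subset_of_mem hyx (by linarith)).trans hsub)).2

/-- Points of the half cube stay at a fixed distance from the boundary of `D`, where the pointwise
bound is uniform. -/
theorem IsCZNumerator.exists_mass_bound (hd : 1 ≤ d) (hn : 1 ≤ n)
    (hΩ : IsCZNumerator (n + 1) Ω) (hD : ConeDomain D κ r Δ) : ∃ A : ℝ, 0 ≤ A ∧
      ∀ (f : Euc d → 𝕜) (N : ℝ), 0 ≤ N → Good n D (κ * r) f N → ∀ c l, κ * r ≤ l → cube c l ⊆ D →
        ∫⁻ x in cube c (l / 2), ‖restrictedCZ Ω D f x‖ₑ ≤ ENNReal.ofReal (A * N) := by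
  have hκr : 0 < κ * r := mul_pos hD.κ_pos hD.r_pos
  have hΔ := hD.Δ_pos
  obtain ⟨A, hA, hb⟩ := hΩ.exists_pointwise_bound hd hn hD (κ * r / 4) (by positivity)
  refine ⟨A * Δ ^ d, by positivity, fun f N hN hf c l hl hc => ?_⟩
  have hl0 : 0 < l := hκr.trans_le hl
  have hs : cube c (l / 2) ⊆ D :=
    (cube_subset_cube (by rw [sub_self, norm_zero]; linarith)).trans hc
  have hlΔ := side_le hd hD.norm_sub_le hl0 hc
  calc ∫⁻ x in cube c (l / 2), ‖restrictedCZ Ω D f x‖ₑ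
      ≤ ∫⁻ x in cube c (l / 2), ENNReal.ofReal (A * N) := by
        refine lintegral_mono_ae ?_
        filter_upwards [ae_restrict_of_ae_restrict_of_subset hs (ae_lebesguePt hD.isOpen hf.locInt),
          ae_restrict_mem (measurableSet_cube c (l / 2))] with y hy hyx
        rw [restrictedCZ, Set.indicator_of_mem (hs hyx), ← ofReal_norm]
        exact ENNReal.ofReal_le_ofReal
          (hb f N hN hf y hy ((cube_subset_of_mem hyx (by linarith)).trans hc)).2
    _ = ENNReal.ofReal (A * N * (l / 2) ^ d) := by
        rw [setLIntegral_const, volume_cube _ _ (by positivity), ← ENNReal.ofReal_mul (by positivity)]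
    _ ≤ _ := by
        refine ENNReal.ofReal_le_ofReal ?_
        rw [mul_right_comm]
        gcongr
        linarith

theorem coeff_sub_homogeneousComponent (R : MvPolynomial (Fin d) 𝕜) (s : Fin d →₀ ℕ) :
    coeff s (R - homogeneousComponent n R) = if s.degree = n then 0 else coeff s R := by
  rw [coeff_sub, coeff_homogeneousComponent]
  split_ifs <;> simp

theorem polyFun_affineSub_neg (c x : Euc d) (P : MvPolynomial (Fin d) 𝕜) :
    polyFun (affineSub (-c) 1 P) x = polyFun P (x - c) := by
  rw [polyFun_affineSub, one_smul, neg_add_eq_sub]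

theorem norm_polyFun_le_of_coeff {R : MvPolynomial (Fin d) 𝕜} (hR : R.totalDegree ≤ n) {B ρ : ℝ}
    (hB : 0 ≤ B) (hcoef : ∀ s : Fin d →₀ ℕ, s.degree ≤ n → ‖coeff s R‖ ≤ B) (hρ : 1 ≤ ρ) {x : Euc d}
    (hx : ‖x‖ ≤ ρ) : ‖polyFun R x‖ ≤ (multiIdx d n).card * (B * ρ ^ n) := by
  rw [polyFun_eq_sum hR, ← nsmul_eq_mul]
  refine norm_sum_le_of_le _ (fun s hs => ?_) |>.trans (le_of_eq (Finset.sum_const _))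
  rw [mem_multiIdx] at hs
  rw [norm_mul]
  refine mul_le_mul (hcoef s hs) ?_ (norm_nonneg _) hB
  exact (norm_monomial_le _ _).trans
    ((pow_le_pow_left₀ (norm_nonneg _) hx _).trans (pow_le_pow_right₀ hρ hs))

theorem affineSub_zero_one (L : MvPolynomial (Fin d) 𝕜) : affineSub 0 1 L = L := by
  ext t
  rw [coeff_affineSub_zero]
  simp

/-- The core of both implications, independent of (i) and (ii): the growth and Hölder bounds for `f
- P`, with logarithms replaced by square roots, are the hypotheses of
`IsCZNumerator.exists_osc_bound`. -/
theorem IsCZNumerator.exists_approx_sub (hd : 1 ≤ d) (hn : 1 ≤ n)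
    (hΩ : IsCZNumerator (n + 1) Ω) (hD : ConeDomain D κ r Δ) : ∃ A : ℝ, 0 ≤ A ∧
      ∀ (f : Euc d → 𝕜) (N : ℝ), 0 ≤ N → Good n D (κ * r) f N → ∀ c l P, 0 < l →
        cube c l ⊆ D → ApproxOn n f N c l P →
        ∃ S, ApproxOn n (restrictedCZ Ω D fun x => f x - polyFun P x) (A * N) c l S := by
  have hκr : 0 < κ * r := mul_pos hD.κ_pos hD.r_pos
  obtain ⟨A₁, hA₁, hosc⟩ := hΩ.exists_osc_bound hd
  obtain ⟨A₂, hA₂, hgr⟩ := exists_growth_bound 𝕜 hd n hn hD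
  obtain ⟨A₃, hA₃, hhol⟩ := exists_holder_bound 𝕜 hd n hn hD
  refine ⟨A₁ * (2 * A₂ + A₃), by positivity, fun f N hN hf c l P hl hc hP => ?_⟩
  have hDm := hD.isOpen.measurableSet
  have hleb := ae_lebesguePt hD.isOpen hf.locInt
  obtain ⟨M, hM, hGP⟩ := good_polyFun hD hP.deg (κ * r) hκr
  have hint : Integrable (D.indicator fun x => f x - polyFun P x) := by
    have := (hf.integrable hd hn hD hN).sub (hGP.integrable hd hn hD hM)
    rwa [show D.indicator f - D.indicator (polyFun P) = D.indicator fun x => f x - polyFun P x from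
      (Set.indicator_sub D f (polyFun P)).symm] at this
  obtain ⟨S, hS, hle⟩ := hosc D (fun x => f x - polyFun P x) c l ((2 * A₂ + A₃) * N) hDm hint hl
    (by positivity) hc (by
      filter_upwards [hleb, ae_restrict_mem hDm] with x hx hxD ρ h1 h2
      refine (hgr f N hN hf c l P hl hc hP x hxD hx ρ h1 h2).trans ?_
      have hρ : 0 < ρ := hl.trans_le h1
      have := one_add_log_le_sqrt (show 0 < ρ / l by positivity)
      calc A₂ * N * ρ ^ n * (1 + Real.log (ρ / l)) ≤ A₂ * N * ρ ^ n * (2 * √(ρ / l)) := by gcongr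
        _ = 2 * A₂ * N * ρ ^ n * √(ρ / l) := by ring
        _ ≤ _ := by gcongr; linarith) (by
      filter_upwards [ae_restrict_of_ae_restrict_of_subset hc hleb] with y hy δ hδ hsub
      filter_upwards [hleb] with x hx hxy
      refine (hhol f N hN hf c l P hl hc hP y δ hδ hsub hy x hx hxy).trans ?_
      gcongr
      linarith)
  refine ⟨S, hS, ?_, ?_⟩
  · refine (hΩ.aestronglyMeasurable_restricted hDm hint ?_).mono_measure
      (Measure.restrict_mono hc le_rfl)
    filter_upwards [hf.pvExists hd hn hΩ hD hN, hGP.pvExists hd hn hΩ hD hM] with y h1 h2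
    have := (pv_indicator_add h1 (pv_indicator_const_mul h2 (-1)).1).1
    simpa only [neg_one_mul, ← sub_eq_add_neg] using this
  · refine le_trans (le_of_eq (setLIntegral_congr_fun (measurableSet_cube c l) fun x hx => ?_))
      (hle.trans (le_of_eq (by ring_nf)))
    simp only [restrictedCZ, Set.indicator_of_mem (hc hx)]

theorem IsCZNumerator.pvExists_polyFun (hd : 1 ≤ d) (hn : 1 ≤ n)
    (hΩ : IsCZNumerator (n + 1) Ω) (hD : ConeDomain D κ r Δ) {Q : MvPolynomial (Fin d) 𝕜}
    (hQ : Q.totalDegree ≤ n) : ∀ᵐ y ∂volume.restrict D, PVExists Ω (D.indicator (polyFun Q)) y := by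
  obtain ⟨N', hN', hG⟩ := good_polyFun hD hQ (κ * r) (mul_pos hD.κ_pos hD.r_pos)
  exact hG.pvExists hd hn hΩ hD hN'

/-- Linearity at almost every point. The part `L` is expanded in the fixed finite set of monomials,
so that (i) yields constants independent of the cube. -/
theorem IsCZNumerator.restricted_decompose (hd : 1 ≤ d) (hn : 1 ≤ n)
    (hΩ : IsCZNumerator (n + 1) Ω) (hD : ConeDomain D κ r Δ) {f : Euc d → 𝕜} {N : ℝ} (hN : 0 ≤ N)
    (hf : Good n D (κ * r) f N) {P T L : MvPolynomial (Fin d) 𝕜} (hP : P.totalDegree ≤ n)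
    (hT : T.totalDegree ≤ n) (hL : L.totalDegree ≤ n)
    (hsum : ∀ x : Euc d, polyFun P x = polyFun T x + polyFun L x) :
    restrictedCZ Ω D f =ᵐ[volume.restrict D] fun x =>
      restrictedCZ Ω D (fun x => f x - polyFun P x) x + restrictedCZ Ω D (polyFun T) x +
        ∑ s ∈ multiIdx d n, coeff s L * restrictedCZ Ω D (polyFun (monomial s (1 : 𝕜))) x := by
  have hmon : ∀ᵐ y ∂volume.restrict D, ∀ s ∈ multiIdx d n,
      PVExists Ω (D.indicator (polyFun (monomial s (1 : 𝕜)))) y :=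
    (Finset.eventually_all _).2 fun s hs =>
      hΩ.pvExists_polyFun hd hn hD (totalDegree_monomial_one_le hs)
  filter_upwards [hf.pvExists hd hn hΩ hD hN, hΩ.pvExists_polyFun hd hn hD hP,
    hΩ.pvExists_polyFun hd hn hD hT, hmon, ae_restrict_mem hD.isOpen.measurableSet]
    with y h1 h2 h3 h4 hy
  have e1 := pv_indicator_add h1 (pv_indicator_const_mul h2 (-1)).1
  simp only [neg_one_mul, ← sub_eq_add_neg] at e1
  have e2 := pv_indicator_sum (multiIdx d n) (fun s x => coeff s L * polyFun (monomial s 1) x)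
    (fun s hs => (pv_indicator_const_mul (h4 s hs) (coeff s L)).1)
  have e3 := pv_indicator_add e1.1 h3
  have e4 : (fun x => f x - polyFun P x + polyFun T x +
      ∑ s ∈ multiIdx d n, coeff s L * polyFun (monomial s 1) x) = f := by
    funext x
    have : ∑ s ∈ multiIdx d n, coeff s L * polyFun (monomial s 1) x = polyFun L x := by
      rw [polyFun_eq_sum hL]
      refine Finset.sum_congr rfl fun s _ => ?_
      rw [polyFun, eval_monomial, one_mul, Finsupp.prod_fintype _ _ (fun _ => pow_zero _)]
    rw [this, hsum]
    ring
  have e5 := (pv_indicator_add e3.1 e2.1).2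
  rw [e4, e3.2, e2.2] at e5
  simp only [restrictedCZ, Set.indicator_of_mem hy]
  rw [e5]
  congr 1
  exact Finset.sum_congr rfl fun s hs => (pv_indicator_const_mul (h4 s hs) (coeff s L)).2

theorem coe_mul_ofReal_mul_div (K : ℝ≥0) {X m t : ℝ} (hX : 0 ≤ X) (hm : 0 < m) :
    (K : ℝ≥0∞) * ENNReal.ofReal (X * m) * ENNReal.ofReal (t / m) = ENNReal.ofReal (K * X * t) := by
  rw [← ENNReal.ofReal_coe_nnreal, ← ENNReal.ofReal_mul K.coe_nonneg, ← ENNReal.ofReal_mul (by positivity)]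
  congr 1
  field_simp

/-- The logarithm in the size of the coefficients of `T` cancels against the denominator in (ii). -/
theorem approxOn_of_homogeneous (hD : ConeDomain D κ r Δ) {c : Euc d} {l : ℝ} (hl : 0 < l)
    (hc : cube c l ⊆ D) {T : MvPolynomial (Fin d) 𝕜} (hT : T.IsHomogeneous n)
    (hloc : LocallyIntegrableOn (restrictedCZ Ω D (polyFun (affineSub (-c) 1 T))) D) {K : ℝ≥0}
    (h : ∃ S : MvPolynomial (Fin d) 𝕜, S.totalDegree ≤ n ∧
      (⨍⁻ x in cube c l, ‖restrictedCZ Ω D (fun z => polyFun T (z - c)) x - polyFun S x‖ₑ ∂volume) ≤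
        K * eLpNorm (fun z => polyFun T (z - c)) ⊤ (volume.restrict D) *
          ENNReal.ofReal (l ^ n / max 1 (Real.log (1 / l)))) {B : ℝ} (hB : 0 ≤ B)
    (hcoef : ∀ s : Fin d →₀ ℕ, s.degree ≤ n → ‖coeff s T‖ ≤ B * max 1 (Real.log (1 / l))) :
    ∃ S, ApproxOn n (restrictedCZ Ω D (polyFun (affineSub (-c) 1 T)))
      (K * ((multiIdx d n).card * (B * (1 + Δ) ^ n))) c l S := by
  obtain ⟨S, hS, hle⟩ := h
  have hΔ := hD.Δ_pos
  have hcD : c ∈ D := hc (self_mem_cube c hl.le)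
  have hfun : (polyFun (affineSub (-c) 1 T) : Euc d → 𝕜) = fun x => polyFun T (x - c) := by
    funext x
    exact polyFun_affineSub_neg c x T
  refine ⟨S, hS, aestronglyMeasurable_cube hloc hc, ?_⟩
  rw [← laverage_cube_le_iff hl (by positivity), hfun]
  refine hle.trans ?_
  generalize max 1 (Real.log (1 / l)) = m, le_max_left 1 (Real.log (1 / l)) = hm1 at *
  have hm : 0 < m := one_pos.trans_le hm1
  have h1 : eLpNorm (fun z => polyFun T (z - c)) ⊤ (volume.restrict D) ≤
      ENNReal.ofReal ((multiIdx d n).card * (B * (1 + Δ) ^ n) * m) := by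
    rw [eLpNorm_exponent_top]
    refine eLpNormEssSup_le_of_ae_bound ?_
    filter_upwards [ae_restrict_mem hD.isOpen.measurableSet] with z hz
    exact (norm_polyFun_le_of_coeff hT.totalDegree_le (by positivity) hcoef
      (by linarith : 1 ≤ 1 + Δ) ((hD.norm_sub_le z hz c hcD).trans (by linarith))).trans
      (le_of_eq (by ring))
  refine (mul_le_mul' (mul_le_mul' le_rfl h1) le_rfl).trans (le_of_eq ?_)
  rw [coe_mul_ofReal_mul_div K (by positivity) hm]

theorem IsCZNumerator.exists_good_restricted (hd : 1 ≤ d) (hn : 1 ≤ n)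
    (hΩ : IsCZNumerator (n + 1) Ω) (hD : ConeDomain D κ r Δ)
    (hi : ∀ P : MvPolynomial (Fin d) 𝕜, P.totalDegree ≤ n →
      MemZygmund n D (restrictedCZ Ω D (polyFun P)))
    (hii : ∃ C : ℝ≥0, ∀ (x₀ : EuclideanSpace ℝ (Fin d)) (l : ℝ), 0 < l → cube x₀ l ⊆ D →
        ∀ P : MvPolynomial (Fin d) 𝕜, P.IsHomogeneous n →
          ∃ S : MvPolynomial (Fin d) 𝕜, S.totalDegree ≤ n ∧
            (⨍⁻ x in cube x₀ l,
                ‖restrictedCZ Ω D (fun z => polyFun P (z - x₀)) x - polyFun S x‖ₑ ∂volume) ≤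
              C * eLpNorm (fun z => polyFun P (z - x₀)) ⊤ (volume.restrict D) *
                ENNReal.ofReal (l ^ n / max 1 (Real.log (1 / l)))) :
    ∃ A : ℝ, 0 ≤ A ∧ ∀ (f : Euc d → 𝕜) (N : ℝ), 0 ≤ N → Good n D (κ * r) f N →
      Good n D (κ * r) (restrictedCZ Ω D f) (A * N) := by
  have hκr : 0 < κ * r := mul_pos hD.κ_pos hD.r_pos
  have hΔ := hD.Δ_pos
  have hDm := hD.isOpen.measurableSet
  obtain ⟨K, hii⟩ := hii
  obtain ⟨A₁, hA₁, hsub⟩ := hΩ.exists_approx_sub hd hn hD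
  obtain ⟨A₂, hA₂, hmass⟩ := hΩ.exists_mass_bound hd hn hD
  obtain ⟨A₃, hA₃, hcc⟩ := exists_center_coeff_bound 𝕜 hd n hD
  obtain ⟨A₄, hA₄, hcf⟩ := exists_coeff_bound 𝕜 d n
  obtain ⟨M, hM⟩ := hD.isBounded.exists_norm_le
  have hmono : ∀ s : Fin d →₀ ℕ, ∃ B, 0 ≤ B ∧ (s ∈ multiIdx d n →
      Good n D (κ * r) (restrictedCZ Ω D (polyFun (monomial s (1 : 𝕜)))) B) := by
    intro s
    by_cases hs : s ∈ multiIdx d n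
    · obtain ⟨B, hB, hG⟩ := exists_good_of_memZygmund hD.isBounded (hi (monomial s 1)
        (totalDegree_monomial_one_le hs)) (κ * r) hκr
      exact ⟨B, hB, fun _ => hG⟩
    · exact ⟨0, le_rfl, fun h => absurd h hs⟩
  choose B hB0 hB using hmono
  set I : ℝ := ((multiIdx d n).card : ℝ) with hI
  -- Bounds the coefficients about the origin of the lower order part, whose coefficients about `c`
  -- are bounded. Points of the unit cube at the origin are at distance at most `d + |M|` from `c`.
  set A₅ : ℝ := A₄ * (I * (A₃ * (1 + (d + |M|)) ^ n)) with hA₅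
  have hA₅0 : 0 ≤ A₅ := by positivity
  set A₆ : ℝ := K * (I * (A₃ * (1 + Δ) ^ n)) with hA₆
  have hK0 : (0 : ℝ) ≤ K := K.coe_nonneg
  have hA₆0 : 0 ≤ A₆ := by positivity
  have hBs : 0 ≤ ∑ s ∈ multiIdx d n, A₅ * B s :=
    Finset.sum_nonneg fun s _ => mul_nonneg hA₅0 (hB0 s)
  refine ⟨A₁ + A₂ + A₆ + ∑ s ∈ multiIdx d n, A₅ * B s, by positivity, fun f N hN hf => ?_⟩
  refine ⟨hΩ.locallyIntegrableOn_restricted hd hn hD hN hf, fun c l hl hc => ?_,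
    fun c l hl hc => (hmass f N hN hf c l hl hc).trans (ENNReal.ofReal_le_ofReal ?_)⟩
  swap
  · gcongr
    linarith
  obtain ⟨P, hP⟩ := hf.approx c l hl hc
  have hcD : c ∈ D := hc (self_mem_cube c hl.le)
  obtain ⟨S₁, hS₁⟩ := hsub f N hN hf c l P hl hc hP
  set R := affineSub c 1 P with hR
  have hRdeg : R.totalDegree ≤ n := (totalDegree_affineSub_le _ _ _).trans hP.deg
  -- The only part of `P` whose coefficients may grow logarithmically; after its removal the
  -- coefficients at `c` are bounded by `A₃ N`.
  set T := homogeneousComponent n R with hT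
  have hThom : T.IsHomogeneous n := homogeneousComponent_isHomogeneous n R
  have hTdeg : T.totalDegree ≤ n := hThom.totalDegree_le
  set L := affineSub (-c) 1 (R - T) with hL
  have hLdeg : L.totalDegree ≤ n :=
    (totalDegree_affineSub_le _ _ _).trans (totalDegree_sub_le hRdeg hTdeg)
  have hcoef : ∀ s, ‖coeff s L‖ ≤ A₅ * N := by
    intro s
    have h := hcf L hLdeg 0 1 (I * (A₃ * N * (1 + (d + |M|)) ^ n)) one_pos (fun x hx => by
      rw [hL, polyFun_affineSub_neg]
      refine norm_polyFun_le_of_coeff (totalDegree_sub_le hRdeg hTdeg) (by positivity)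
        (fun s hs => ?_) (le_add_of_nonneg_right (by positivity)) ?_
      · rw [hT, coeff_sub_homogeneousComponent]
        split_ifs with h
        · rw [norm_zero]; positivity
        · have := hcc f N hN hf c l P hl hc hP s hs
          rwa [if_pos (lt_of_le_of_ne hs h), mul_one] at this
      · have h1 := norm_sub_le_of_mem_cube hx
        have h2 := (hM c hcD).trans (le_abs_self M)
        have h3 := norm_sub_le x c
        rw [sub_zero] at h1
        have : (0 : ℝ) ≤ d := Nat.cast_nonneg d
        linarith) s
    rw [one_pow, mul_one, affineSub_zero_one] at h
    exact h.trans (le_of_eq (by rw [hA₅]; ring))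
  set T' := affineSub (-c) 1 T with hT'
  have hT'deg : T'.totalDegree ≤ n := (totalDegree_affineSub_le _ _ _).trans hTdeg
  obtain ⟨S₂, hS₂⟩ : ∃ S, ApproxOn n (restrictedCZ Ω D (polyFun T')) (A₆ * N) c l S := by
    obtain ⟨S, hS⟩ := approxOn_of_homogeneous hD hl hc hThom (hi T' hT'deg).1
      (hii c l hl hc T hThom) (B := A₃ * N) (by positivity) fun s hs => by
        rw [hT, coeff_homogeneousComponent]
        split_ifs with h
        · have := hcc f N hN hf c l P hl hc hP s hs
          rwa [if_neg (by omega)] at this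
        · rw [norm_zero]; positivity
    exact ⟨S, hS.mono hl (le_of_eq (by rw [hA₆]; ring))⟩
  choose! S₃ hS₃ using fun s (hs : s ∈ multiIdx d n) => (hB s hs).approx c l hl hc
  have hsum := ApproxOn.sum (n := n) (c := c) (multiIdx d n)
    (fun s x => coeff s L * restrictedCZ Ω D (polyFun (monomial s (1 : 𝕜))) x)
    (fun s => ‖coeff s L‖ * B s) (fun s => C (coeff s L) * S₃ s) hl
    (fun s _ => mul_nonneg (norm_nonneg _) (hB0 s)) (fun s hs => (hS₃ s hs).const_mul _)
  have htot := (hS₁.add hS₂ hl (by positivity) (by positivity)).add hsum hl (by positivity)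
    (Finset.sum_nonneg fun s _ => mul_nonneg (norm_nonneg _) (hB0 s))
  refine ⟨_, (htot.mono hl (M := (A₁ + A₂ + A₆ + ∑ s ∈ multiIdx d n, A₅ * B s) * N) ?_).congr ?_⟩
  · have : ∑ s ∈ multiIdx d n, ‖coeff s L‖ * B s ≤ (∑ s ∈ multiIdx d n, A₅ * B s) * N := by
      rw [Finset.sum_mul]
      refine Finset.sum_le_sum fun s _ => ?_
      rw [mul_right_comm]
      exact mul_le_mul_of_nonneg_right (hcoef s) (hB0 s)
    have h2 : 0 ≤ A₂ * N := by positivity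
    linarith
  · refine ae_restrict_of_ae_restrict_of_subset hc ?_
    exact (hΩ.restricted_decompose hd hn hD hN hf hP.deg hT'deg hLdeg fun x => by
      rw [hL, hT', polyFun_affineSub_neg, polyFun_affineSub_neg, polyFun_sub,
        hR, polyFun_affineSub_one_sub]
      ring).symm

theorem IsCZNumerator.bounded_of_conditions (hd : 1 ≤ d) (hn : 1 ≤ n)
    (hΩ : IsCZNumerator (n + 1) Ω) (hD : ConeDomain D κ r Δ)
    (hi : ∀ P : MvPolynomial (Fin d) 𝕜, P.totalDegree ≤ n →
      MemZygmund n D (restrictedCZ Ω D (polyFun P)))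
    (hii : ∃ C : ℝ≥0, ∀ (x₀ : EuclideanSpace ℝ (Fin d)) (l : ℝ), 0 < l → cube x₀ l ⊆ D →
        ∀ P : MvPolynomial (Fin d) 𝕜, P.IsHomogeneous n →
          ∃ S : MvPolynomial (Fin d) 𝕜, S.totalDegree ≤ n ∧
            (⨍⁻ x in cube x₀ l,
                ‖restrictedCZ Ω D (fun z => polyFun P (z - x₀)) x - polyFun S x‖ₑ ∂volume) ≤
              C * eLpNorm (fun z => polyFun P (z - x₀)) ⊤ (volume.restrict D) *
                ENNReal.ofReal (l ^ n / max 1 (Real.log (1 / l)))) :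
    IsBoundedOnZygmund n Ω D := by
  have hκr : 0 < κ * r := mul_pos hD.κ_pos hD.r_pos
  have hDm := hD.isOpen.measurableSet
  obtain ⟨A, hA, hgood⟩ := hΩ.exists_good_restricted hd hn hD hi hii
  obtain ⟨A', hA', hsup⟩ := exists_sup_bound 𝕜 hd n hn hD
  set V : ℝ := (volume D).toReal with hV
  have hV0 : 0 ≤ V := ENNReal.toReal_nonneg
  set B : ℝ := A + A' * A * V with hB
  have hB0 : 0 ≤ B := by positivity
  have hmain : ∀ (f : Euc d → 𝕜) (N : ℝ), 0 ≤ N → Good n D (κ * r) f N →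
      zygmundSeminorm n D (restrictedCZ Ω D f) ≤ ENNReal.ofReal (A * N) ∧
        zygmundNorm n D (restrictedCZ Ω D f) ≤ ENNReal.ofReal (B * N) := by
    intro f N hN hf
    have hG := hgood f N hN hf
    have h1 := seminorm_le_of_approxOn (by positivity) hG.approx
    refine ⟨h1, ?_⟩
    have h2 : ∫⁻ x in D, ‖restrictedCZ Ω D f x‖ₑ ≤ ENNReal.ofReal (A' * (A * N) * V) := by
      calc ∫⁻ x in D, ‖restrictedCZ Ω D f x‖ₑ ≤ ∫⁻ x in D, ENNReal.ofReal (A' * (A * N)) := by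
            refine lintegral_mono_ae ?_
            filter_upwards [ae_lebesguePt hD.isOpen hG.locInt, ae_restrict_mem hDm] with x hx hxD
            rw [← ofReal_norm]
            exact ENNReal.ofReal_le_ofReal (hsup _ _ (by positivity) hG x hxD hx)
        _ = _ := by
            rw [setLIntegral_const, ENNReal.ofReal_mul (p := A' * (A * N)) (by positivity), hV,
              ENNReal.ofReal_toReal hD.volume_lt_top.ne]
    rw [zygmundNorm, show B * N = A * N + A' * (A * N) * V by rw [hB]; ring,
      ENNReal.ofReal_add (by positivity) (by positivity)]
    exact add_le_add h1 h2
  -- The summand `1` keeps the constant positive, so that the case of infinite norm is trivial.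
  refine ⟨(B + 1).toNNReal, fun f hf => ⟨?_, ?_⟩⟩
  · obtain ⟨N, hN, hG⟩ := exists_good_of_memZygmund hD.isBounded hf (κ * r) hκr
    exact ⟨hΩ.locallyIntegrableOn_restricted hd hn hD hN hG,
      (hmain f N hN hG).1.trans_lt ENNReal.ofReal_lt_top⟩
  · rcases eq_or_ne (zygmundNorm n D f) ∞ with h | h
    · rw [h, ENNReal.mul_top]
      · exact le_top
      · rw [Ne, ENNReal.coe_eq_zero, Real.toNNReal_eq_zero, not_le]
        positivity
    · set w := (zygmundNorm n D f).toReal with hw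
      have hw0 : 0 ≤ w := ENNReal.toReal_nonneg
      -- The infimum over polynomials need not be attained and `good_of_norm_lt` asks for a strict
      -- bound; the slack `ε` tends to zero afterwards.
      have key : ∀ ε : ℝ, 0 < ε →
          zygmundNorm n D (restrictedCZ Ω D f) ≤ ENNReal.ofReal (B * (w + ε)) := by
        intro ε hε
        refine (hmain f (w + ε) (by positivity) (good_of_norm_lt hf.1 (by positivity) ?_ _ hκr)).2
        rw [← ENNReal.ofReal_toReal h, ENNReal.ofReal_lt_ofReal_iff (by positivity)]
        linarith
      have hlim : Tendsto (fun ε : ℝ => ENNReal.ofReal (B * (w + ε))) (𝓝[>] 0)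
          (𝓝 (ENNReal.ofReal (B * (w + 0)))) := by
        refine (ENNReal.continuous_ofReal.comp (by fun_prop :
          Continuous fun ε : ℝ => B * (w + ε))).continuousAt.tendsto.mono_left nhdsWithin_le_nhds
      have h1 : zygmundNorm n D (restrictedCZ Ω D f) ≤ ENNReal.ofReal (B * (w + 0)) :=
        ge_of_tendsto hlim (by filter_upwards [self_mem_nhdsWithin] with ε hε using key ε hε)
      refine h1.trans ?_
      rw [add_zero, ENNReal.ofReal_mul hB0, hw, ENNReal.ofReal_toReal h]
      gcongr
      exact ENNReal.ofReal_le_ofReal (by linarith)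

end Sufficiency

/-! ### Approximation of a homogeneous polynomial times a logarithm. -/

section Necessity

open MvPolynomial

variable {n : ℕ} {D : Set (Euc d)} {κ r Δ : ℝ} {Ω : Euc d → 𝕜}

theorem contDiff_polyFun (P : MvPolynomial (Fin d) 𝕜) {k : WithTop ℕ∞} :
    ContDiff ℝ k (polyFun P : Euc d → 𝕜) := by
  have h : (polyFun P : Euc d → 𝕜) =
      fun x => ∑ s ∈ multiIdx d P.totalDegree, coeff s P * ∏ i, ((x i : ℝ) : 𝕜) ^ s i := by
    funext x
    exact polyFun_eq_sum le_rfl x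
  rw [h]
  refine ContDiff.sum fun s _ => contDiff_const.mul (contDiff_prod fun i _ => ContDiff.pow ?_ _)
  exact (RCLike.ofRealCLM (K := 𝕜)).contDiff.comp (EuclideanSpace.proj (𝕜 := ℝ) i).contDiff

theorem polyFun_smul_of_homogeneous {P : MvPolynomial (Fin d) 𝕜} (hP : P.IsHomogeneous n) (t : ℝ)
    (x : Euc d) : polyFun P (t • x) = (t : 𝕜) ^ n * polyFun P x := by
  have h : affineSub 0 t P = C ((t : 𝕜) ^ n) * P := by
    ext s
    rw [coeff_affineSub_zero, coeff_C_mul]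
    by_cases hs : coeff s P = 0
    · rw [hs, mul_zero, mul_zero]
    · rw [← hP hs, Finsupp.degree_eq_weight_one]
      rfl
  have h1 := polyFun_affineSub 0 t P x
  rw [h, zero_add, polyFun_mul, polyFun_C] at h1
  exact h1.symm

theorem norm_polyFun_le_of_homogeneous {P : MvPolynomial (Fin d) 𝕜} (hP : P.IsHomogeneous n) {B : ℝ}
    (hcoef : ∀ s, ‖coeff s P‖ ≤ B) (x : Euc d) :
    ‖polyFun P x‖ ≤ (multiIdx d n).card * B * ‖x‖ ^ n := by
  rw [polyFun_eq_sum hP.totalDegree_le, mul_assoc, ← nsmul_eq_mul]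
  refine norm_sum_le_of_le _ (fun s hs => ?_) |>.trans (le_of_eq (Finset.sum_const _))
  rw [norm_mul]
  by_cases hs0 : coeff s P = 0
  · have := (norm_nonneg _).trans (hcoef s)
    rw [hs0, norm_zero, zero_mul]
    positivity
  · have hsn : s.degree = n := by
      rw [← hP hs0, Finsupp.degree_eq_weight_one]
      rfl
    have := norm_monomial_le (𝕜 := 𝕜) x s
    rw [hsn] at this
    exact mul_le_mul (hcoef s) this (norm_nonneg _) ((norm_nonneg _).trans (hcoef s))

theorem pow_mul_abs_log_le (hn : 1 ≤ n) {t M : ℝ} (ht : 0 ≤ t) (hM : 1 ≤ M) (htM : t ≤ M) :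
    t ^ n * |Real.log t| ≤ M ^ (n + 1) := by
  rcases ht.eq_or_lt with rfl | ht
  · rw [Real.log_zero, abs_zero, mul_zero]; positivity
  rcases le_total t 1 with h | h
  · have h1 := (Real.abs_log_mul_self_lt t ht h).le
    rw [abs_mul, abs_of_pos ht] at h1
    calc t ^ n * |Real.log t| ≤ t * |Real.log t| := by
          gcongr; exact pow_le_of_le_one ht.le h (by omega)
      _ ≤ 1 := by rw [mul_comm]; exact h1
      _ ≤ _ := one_le_pow₀ hM
  · rw [abs_of_nonneg (Real.log_nonneg h), pow_succ]
    exact mul_le_mul (pow_le_pow_left₀ ht.le htM n) ((Real.log_le_self ht.le).trans htM)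
      (Real.log_nonneg h) (by positivity)

/-- The difference is `P(u) log(‖u‖/l)`, of size `l^n τ^n |log τ|` up to constants with `τ = ‖u‖/l`,
and `τ^n |log τ|` is bounded for `τ ≤ M` since `n ≥ 1`. -/
theorem norm_polyFun_mul_log_sub_le (hn : 1 ≤ n) {P : MvPolynomial (Fin d) 𝕜}
    (hP : P.IsHomogeneous n) {B : ℝ} (hcoef : ∀ s, ‖coeff s P‖ ≤ B) {l M : ℝ} (hl : 0 < l)
    (hM : 1 ≤ M) {u : Euc d} (hu : ‖u‖ ≤ M * l) :
    ‖polyFun P u * ((Real.log ‖u‖ : ℝ) : 𝕜) - ((Real.log l : ℝ) : 𝕜) * polyFun P u‖ ≤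
      (multiIdx d n).card * M ^ (n + 1) * B * l ^ n := by
  have hB : 0 ≤ B := (norm_nonneg _).trans (hcoef 0)
  have h1 := norm_polyFun_le_of_homogeneous hP hcoef u
  rcases eq_or_ne u 0 with rfl | hu0
  · rw [norm_zero, zero_pow (by omega), mul_zero] at h1
    rw [norm_le_zero_iff.1 h1, zero_mul, mul_zero, sub_zero, norm_zero]
    positivity
  have hup : 0 < ‖u‖ := norm_pos_iff.2 hu0
  rw [mul_comm (polyFun P u), ← sub_mul, norm_mul, ← RCLike.ofReal_sub, RCLike.norm_ofReal,
    ← Real.log_div hup.ne' hl.ne']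
  have h2 := pow_mul_abs_log_le hn (t := ‖u‖ / l) (by positivity) hM ((div_le_iff₀ hl).2 hu)
  have h3 : ‖u‖ ^ n = l ^ n * (‖u‖ / l) ^ n := by rw [← mul_pow]; field_simp
  calc |Real.log (‖u‖ / l)| * ‖polyFun P u‖
      ≤ |Real.log (‖u‖ / l)| * ((multiIdx d n).card * B * ‖u‖ ^ n) := by gcongr
    _ = (multiIdx d n).card * B * l ^ n * ((‖u‖ / l) ^ n * |Real.log (‖u‖ / l)|) := by
        rw [h3]; ring
    _ ≤ (multiIdx d n).card * B * l ^ n * M ^ (n + 1) := by gcongr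
    _ = _ := by ring

/-- With `R = ‖c‖`, homogeneity gives `P(u) log‖u‖ = log R · P(u) + R^n P(u/R) log‖u/R‖`. The first
term is a polynomial, and the second is expanded by Taylor's formula at `c/R` on the unit sphere. -/
theorem exists_log_approx_far (hd : 1 ≤ d) {P : MvPolynomial (Fin d) 𝕜} (hP : P.IsHomogeneous n) :
    ∃ A : ℝ, 0 ≤ A ∧ ∀ (c : Euc d) (l : ℝ), 0 < l → 2 * d * l ≤ ‖c‖ →
      ∃ Q : MvPolynomial (Fin d) 𝕜, Q.totalDegree ≤ n ∧ ∀ u ∈ cube c l,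
        ‖polyFun P u * ((Real.log ‖u‖ : ℝ) : 𝕜) - polyFun Q u‖ ≤ A * l ^ n := by
  have hF : ContDiffOn ℝ (n + 1) (fun u : Euc d => polyFun P u * ((Real.log ‖u‖ : ℝ) : 𝕜)) {0}ᶜ := by
    intro u hu
    refine ContDiffAt.contDiffWithinAt ((contDiff_polyFun P).contDiffAt.mul ?_)
    exact (RCLike.ofRealCLM (K := 𝕜)).contDiff.contDiffAt.comp u
      ((contDiffAt_norm ℝ hu).log (norm_ne_zero_iff.2 hu))
  obtain ⟨A, hA, hT⟩ := exists_taylor_sphere n hF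
  have hd0 : (1 : ℝ) ≤ d := by exact_mod_cast hd
  refine ⟨A * d ^ n, by positivity, fun c l hl hc => ?_⟩
  set R := ‖c‖ with hR
  have hR0 : 0 < R := lt_of_lt_of_le (by positivity) hc
  obtain ⟨p, hp, hpT⟩ := hT (R⁻¹ • c) (by
    rw [norm_smul, norm_inv, Real.norm_of_nonneg hR0.le, ← hR, inv_mul_cancel₀ hR0.ne'])
  refine ⟨C ((Real.log R : ℝ) : 𝕜) * P + C ((R : 𝕜) ^ n) * affineSub (-(R⁻¹ • c)) R⁻¹ p,
    totalDegree_add_le (totalDegree_C_mul_le _ hP.totalDegree_le)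
      (totalDegree_C_mul_le _ ((totalDegree_affineSub_le _ _ _).trans hp)), fun u hu => ?_⟩
  have hu1 : ‖u - c‖ ≤ d * (l / 2) := norm_sub_le_of_mem_cube hu
  set h : Euc d := R⁻¹ • (u - c) with hh
  have hhn : ‖h‖ = ‖u - c‖ / R := by
    rw [hh, norm_smul, norm_inv, Real.norm_of_nonneg hR0.le, inv_mul_eq_div]
  have hh2 : ‖h‖ ≤ 1 / 2 := by
    rw [hhn, div_le_iff₀ hR0]
    nlinarith
  have hu2 : u = R • (R⁻¹ • c + h) := by
    rw [hh, ← smul_add, smul_inv_smul₀ hR0.ne', add_sub_cancel]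
  have hv : 0 < ‖R⁻¹ • c + h‖ := by
    have h1 : ‖R⁻¹ • c‖ = 1 := by
      rw [norm_smul, norm_inv, Real.norm_of_nonneg hR0.le, ← hR, inv_mul_cancel₀ hR0.ne']
    have h2 := norm_sub_norm_le (R⁻¹ • c) (-h)
    rw [norm_neg, sub_neg_eq_add] at h2
    linarith
  have hlog : Real.log ‖u‖ = Real.log R + Real.log ‖R⁻¹ • c + h‖ := by
    conv_lhs => rw [hu2, norm_smul, Real.norm_of_nonneg hR0.le, Real.log_mul hR0.ne' hv.ne']
  have hPu : polyFun P u = (R : 𝕜) ^ n * polyFun P (R⁻¹ • c + h) := by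
    conv_lhs => rw [hu2]
    exact polyFun_smul_of_homogeneous hP _ _
  have harg : -(R⁻¹ • c) + R⁻¹ • u = h := by rw [hh, smul_sub]; abel
  have hdiff : polyFun P u * ((Real.log ‖u‖ : ℝ) : 𝕜) -
      polyFun (C ((Real.log R : ℝ) : 𝕜) * P + C ((R : 𝕜) ^ n) * affineSub (-(R⁻¹ • c)) R⁻¹ p) u =
      (R : 𝕜) ^ n * (polyFun P (R⁻¹ • c + h) * ((Real.log ‖R⁻¹ • c + h‖ : ℝ) : 𝕜) -
        polyFun p h) := by
    rw [polyFun_add, polyFun_mul, polyFun_mul, polyFun_C, polyFun_C, polyFun_affineSub, harg, hlog,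
      hPu, RCLike.ofReal_add]
    ring
  rw [hdiff, norm_mul, norm_pow, RCLike.norm_ofReal, abs_of_pos hR0]
  have h3 : R * ‖h‖ ≤ d * l := by
    rw [hhn, mul_div_cancel₀ _ hR0.ne']
    refine hu1.trans ?_
    gcongr
    linarith
  calc R ^ n * ‖polyFun P (R⁻¹ • c + h) * ((Real.log ‖R⁻¹ • c + h‖ : ℝ) : 𝕜) - polyFun p h‖
      ≤ R ^ n * (A * ‖h‖ ^ (n + 1)) := by gcongr; exact hpT h hh2
    _ = A * (R * ‖h‖) ^ n * ‖h‖ := by ring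
    _ ≤ A * (d * l) ^ n * 1 := by gcongr; linarith
    _ = _ := by ring

/-- Cubes far from the origin are treated monomial by monomial, which makes the constant independent
of `P`. On the other cubes `‖u‖ ≤ 3 d l`, and `log l · P` is the approximation. -/
theorem exists_log_approx (hd : 1 ≤ d) (hn : 1 ≤ n) : ∃ A : ℝ, 0 ≤ A ∧
    ∀ (P : MvPolynomial (Fin d) 𝕜) (B : ℝ), P.IsHomogeneous n → (∀ s, ‖coeff s P‖ ≤ B) →
      ∀ (c : Euc d) (l : ℝ), 0 < l → ∃ Q : MvPolynomial (Fin d) 𝕜, Q.totalDegree ≤ n ∧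
        ∀ u ∈ cube c l, ‖polyFun P u * ((Real.log ‖u‖ : ℝ) : 𝕜) - polyFun Q u‖ ≤ A * B * l ^ n := by
  have hd1 : (1 : ℝ) ≤ d := by exact_mod_cast hd
  choose A₁ hA₁ hfar using fun s : Fin d →₀ ℕ =>
    exists_log_approx_far hd (isHomogeneous_monomial (n := s.degree) (1 : 𝕜) rfl)
  refine ⟨(∑ s ∈ multiIdx d n, A₁ s) + (multiIdx d n).card * (3 * d) ^ (n + 1), ?_, ?_⟩
  · have := Finset.sum_nonneg fun s (_ : s ∈ multiIdx d n) => hA₁ s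
    positivity
  intro P B hP hcoef c l hl
  have hB : 0 ≤ B := (norm_nonneg _).trans (hcoef 0)
  have hsum0 := Finset.sum_nonneg fun s (_ : s ∈ multiIdx d n) => hA₁ s
  rcases le_total (2 * d * l) ‖c‖ with hc | hc
  · choose Q hQ hle using fun s => hfar s c l hl hc
    refine ⟨∑ s ∈ multiIdx d n, C (coeff s P) * Q s, ?_, fun u hu => ?_⟩
    · refine totalDegree_finsetSum_le fun s hs => totalDegree_C_mul_le _ ((hQ s).trans ?_)
      exact mem_multiIdx.1 hs
    have h1 : polyFun P u =
        ∑ s ∈ multiIdx d n, coeff s P * polyFun (monomial s (1 : 𝕜)) u := by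
      rw [polyFun_eq_sum hP.totalDegree_le]
      refine Finset.sum_congr rfl fun s _ => ?_
      rw [polyFun, eval_monomial, one_mul, Finsupp.prod_fintype _ _ (fun _ => pow_zero _)]
    rw [h1, polyFun_sum, Finset.sum_mul, ← Finset.sum_sub_distrib]
    have h2 : ∀ s ∈ multiIdx d n, ‖coeff s P * polyFun (monomial s (1 : 𝕜)) u *
        ((Real.log ‖u‖ : ℝ) : 𝕜) - polyFun (C (coeff s P) * Q s) u‖ ≤ A₁ s * (B * l ^ n) := by
      intro s _
      rw [polyFun_mul, polyFun_C, mul_assoc, ← mul_sub, norm_mul]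
      by_cases hs0 : coeff s P = 0
      · rw [hs0, norm_zero, zero_mul]
        have := hA₁ s
        positivity
      · have hsn : s.degree = n := by
          rw [← hP hs0, Finsupp.degree_eq_weight_one]
          rfl
        have h3 := hle s u hu
        rw [hsn] at h3
        have := hA₁ s
        calc _ ≤ B * (A₁ s * l ^ n) := mul_le_mul (hcoef s) h3 (norm_nonneg _) hB
          _ = _ := by ring
    refine (norm_sum_le_of_le _ h2).trans ?_
    rw [← Finset.sum_mul, mul_assoc]
    gcongr
    exact le_add_of_nonneg_right (by positivity)
  · refine ⟨C ((Real.log l : ℝ) : 𝕜) * P, totalDegree_C_mul_le _ hP.totalDegree_le, fun u hu => ?_⟩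
    rw [polyFun_mul, polyFun_C]
    have hu1 : ‖u‖ ≤ 3 * d * l := by
      have h1 := norm_sub_le_of_mem_cube hu
      have h2 := norm_add_le (u - c) c
      rw [sub_add_cancel] at h2
      nlinarith
    refine (norm_polyFun_mul_log_sub_le hn hP hcoef hl (by linarith) hu1).trans ?_
    gcongr
    exact le_add_of_nonneg_left hsum0

end Necessity

/-! ### Logarithmic test functions and necessity of the two conditions. -/

section TestFunctions

open MvPolynomial

variable {n : ℕ} {D : Set (Euc d)} {κ r Δ : ℝ} {Ω : Euc d → 𝕜}

theorem approxOn_of_norm_le {f : Euc d → 𝕜} {N : ℝ} {c : Euc d} {l : ℝ} (hl : 0 < l)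
    {P : MvPolynomial (Fin d) 𝕜} (hP : P.totalDegree ≤ n) (hf : Measurable f) (hN : 0 ≤ N)
    (h : ∀ x ∈ cube c l, ‖f x - polyFun P x‖ ≤ N * l ^ n) : ApproxOn n f N c l P := by
  refine ⟨hP, hf.aestronglyMeasurable, ?_⟩
  calc ∫⁻ x in cube c l, ‖f x - polyFun P x‖ₑ
      ≤ ∫⁻ x in cube c l, ENNReal.ofReal (N * l ^ n) := by
        refine setLIntegral_mono' (measurableSet_cube c l) fun x hx => ?_
        rw [← ofReal_norm]
        exact ENNReal.ofReal_le_ofReal (h x hx)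
    _ = _ := by
        rw [setLIntegral_const, volume_cube c l hl.le, ← ENNReal.ofReal_mul (by positivity)]

theorem memZygmund_of_norm_le (hD : ConeDomain D κ r Δ) {f : Euc d → 𝕜} {N M : ℝ} (hN : 0 ≤ N)
    (hM : 0 ≤ M) (hf : Measurable f) (hb : ∀ x ∈ D, ‖f x‖ ≤ M)
    (h : ∀ c l, 0 < l → ∃ P, ApproxOn n f N c l P) :
    MemZygmund n D f ∧ zygmundNorm n D f ≤ ENNReal.ofReal (N + M * (volume D).toReal) := by
  have hDm := hD.isOpen.measurableSet
  have hfin : IsFiniteMeasure (volume.restrict D) := ⟨by simpa using hD.volume_lt_top⟩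
  have hint : IntegrableOn f D := by
    refine ⟨hf.aestronglyMeasurable, HasFiniteIntegral.of_bounded (C := M) ?_⟩
    filter_upwards [ae_restrict_mem hDm] with x hx using hb x hx
  have h1 : zygmundSeminorm n D f ≤ ENNReal.ofReal N :=
    seminorm_le_of_approxOn hN fun c l hl _ => h c l hl
  refine ⟨⟨hint.locallyIntegrableOn, h1.trans_lt ENNReal.ofReal_lt_top⟩, ?_⟩
  rw [zygmundNorm, ENNReal.ofReal_add hN (by positivity)]
  refine add_le_add h1 ?_
  calc ∫⁻ x in D, ‖f x‖ₑ ≤ ∫⁻ x in D, ENNReal.ofReal M := by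
        refine setLIntegral_mono' hDm fun x hx => ?_
        rw [← ofReal_norm]
        exact ENNReal.ofReal_le_ofReal (hb x hx)
    _ = _ := by
        rw [setLIntegral_const, ENNReal.ofReal_mul hM, ENNReal.ofReal_toReal hD.volume_lt_top.ne]

/-- A nonempty open set has positive measure, so for continuous functions the essential supremum
over an open set is a true supremum. -/
theorem norm_le_of_eLpNorm_top (hD : IsOpen D) {f : Euc d → 𝕜} (hf : Continuous f) {B : ℝ}
    (hB : eLpNorm f ⊤ (volume.restrict D) ≤ ENNReal.ofReal B) (hB0 : 0 ≤ B) :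
    ∀ x ∈ D, ‖f x‖ ≤ B := by
  rw [eLpNorm_exponent_top] at hB
  have h1 : ∀ᵐ x ∂volume.restrict D, ‖f x‖ ≤ B := by
    filter_upwards [ae_le_eLpNormEssSup (f := f) (μ := volume.restrict D)] with x hx
    have := hx.trans hB
    rwa [← ofReal_norm, ENNReal.ofReal_le_ofReal_iff hB0] at this
  rw [ae_restrict_iff' hD.measurableSet] at h1
  intro x hx
  by_contra hlt
  push Not at hlt
  have hopen : IsOpen (D ∩ {x | B < ‖f x‖}) := hD.inter (isOpen_lt continuous_const hf.norm)
  refine (hopen.measure_pos volume ⟨x, hx, hlt⟩).ne' ?_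
  refine measure_mono_null (fun z hz => ?_) (ae_iff.1 h1)
  simp only [Set.mem_ofPred_eq, Classical.not_imp, not_le]
  exact hz

-- The cone at `x₀` contains a cube of the fixed side `κ r` at the fixed height `r`. The bound on
-- that cube spreads to the unit cube about `x₀`, uniformly in `x₀`.
variable (𝕜) in
theorem exists_coeff_bound_of_domain (n : ℕ) (hD : ConeDomain D κ r Δ) : ∃ A : ℝ, 0 ≤ A ∧
    ∀ x₀ ∈ D, ∀ (P : MvPolynomial (Fin d) 𝕜) (B : ℝ), P.totalDegree ≤ n → 0 ≤ B →
      (∀ x ∈ D, ‖polyFun P (x - x₀)‖ ≤ B) → ∀ s, ‖coeff s P‖ ≤ A * B := by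
  have hκ := hD.κ_pos
  have hr := hD.r_pos
  obtain ⟨A, hA, hcf⟩ := exists_coeff_bound 𝕜 d n
  set ρ := κ * r with hρ
  have hρ0 : 0 < ρ := by positivity
  set G : ℝ := ∑ s ∈ multiIdx d n, A * (ρ ^ s.degree)⁻¹ * (d + r) ^ s.degree with hG
  have hG0 : 0 ≤ G := by positivity
  refine ⟨A * G, by positivity, fun x₀ hx₀ P B hP hB hPB s => ?_⟩
  obtain ⟨e, he, hcone⟩ := hD.cone x₀ hx₀
  have hcube := hcone x₀ hx₀ (by rw [sub_self, norm_zero]; exact hr.le) r hr le_rfl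
  set P' := affineSub (-x₀) 1 P with hP'
  have hP'deg : P'.totalDegree ≤ n := (totalDegree_affineSub_le _ _ _).trans hP
  have h1 := hcf P' hP'deg (x₀ + r • e) ρ B hρ0 fun x hx => by
    rw [hP', polyFun_affineSub_neg]
    exact hPB x (hcube hx)
  have h2 : ∀ x ∈ cube (0 : Euc d) 1, ‖polyFun P x‖ ≤ G * B := by
    intro x hx
    have e1 : polyFun P x = polyFun P' (x + x₀) := by
      rw [hP', polyFun_affineSub_neg, add_sub_cancel_right]
    rw [e1]
    refine (norm_polyFun_le hP'deg (x₀ + r • e) _).trans ?_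
    rw [hG, Finset.sum_mul]
    refine Finset.sum_le_sum fun t _ => ?_
    have e2 : ‖x + x₀ - (x₀ + r • e)‖ ≤ d + r := by
      have : x + x₀ - (x₀ + r • e) = x - r • e := by abel
      rw [this]
      have e3 := norm_sub_le_of_mem_cube hx
      have e4 := norm_sub_le x (r • e)
      rw [norm_smul, Real.norm_of_nonneg hr.le] at e4
      rw [sub_zero] at e3
      have : (0 : ℝ) ≤ d := Nat.cast_nonneg d
      nlinarith
    have e5 : ‖coeff t (affineSub (x₀ + r • e) 1 P')‖ ≤ A * B * (ρ ^ t.degree)⁻¹ := by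
      rw [← div_eq_mul_inv, le_div_iff₀ (by positivity)]
      exact h1 t
    calc _ ≤ A * B * (ρ ^ t.degree)⁻¹ * (d + r) ^ t.degree := by gcongr
      _ = _ := by ring
  have h3 := hcf P hP 0 1 (G * B) one_pos h2 s
  rw [one_pow, mul_one, affineSub_zero_one] at h3
  exact h3.trans (le_of_eq (by ring))

-- The functions `P(x - x₀) log‖x - x₀‖` are extremal for the logarithmic growth of the top
-- coefficients: their approximating polynomials at `x₀` are `log l · P(x - x₀)`.
variable (𝕜) in
theorem exists_log_test (hd : 1 ≤ d) (hn : 1 ≤ n) (hD : ConeDomain D κ r Δ) : ∃ A : ℝ, 0 ≤ A ∧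
    ∀ x₀ ∈ D, ∀ (P : MvPolynomial (Fin d) 𝕜) (B : ℝ), P.IsHomogeneous n → 0 < B →
      (∀ x ∈ D, ‖polyFun P (x - x₀)‖ ≤ B) → ∃ f : Euc d → 𝕜,
        MemZygmund n D f ∧ zygmundNorm n D f < ENNReal.ofReal (A * B) ∧
        ∀ l, 0 < l →
          ApproxOn n f (A * B) x₀ l (C ((Real.log l : ℝ) : 𝕜) * affineSub (-x₀) 1 P) := by
  obtain ⟨A₁, hA₁, hcf⟩ := exists_coeff_bound_of_domain 𝕜 n hD
  obtain ⟨A₂, hA₂, happ⟩ := exists_log_approx (𝕜 := 𝕜) hd hn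
  have hΔ := hD.Δ_pos
  have hd1 : (1 : ℝ) ≤ d := by exact_mod_cast hd
  set I : ℝ := ((multiIdx d n).card : ℝ) with hI
  set V : ℝ := (volume D).toReal with hV
  have hV0 : 0 ≤ V := ENNReal.toReal_nonneg
  set A₃ : ℝ := I * (1 + Δ) ^ (n + 1) * A₁ with hA₃
  set A₄ : ℝ := I * d ^ (n + 1) * A₁ with hA₄
  -- The summands account for the seminorm, the `L^1` norm, the approximation by `log l · P`, and
  -- the strictness of the norm bound.
  refine ⟨A₂ * A₁ + A₃ * V + A₄ + 1, by positivity, fun x₀ hx₀ P B hP hB hPB => ?_⟩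
  have hcoef := hcf x₀ hx₀ P B hP.totalDegree_le hB.le hPB
  set f : Euc d → 𝕜 := fun x => polyFun P (x - x₀) * ((Real.log ‖x - x₀‖ : ℝ) : 𝕜) with hf
  have hfm : Measurable f := by
    refine ((continuous_polyFun P).measurable.comp (measurable_id.sub_const x₀)).mul ?_
    exact RCLike.continuous_ofReal.measurable.comp
      (Real.measurable_log.comp (measurable_id.sub_const x₀).norm)
  have hmem := memZygmund_of_norm_le (n := n) hD (f := f) (N := A₂ * (A₁ * B)) (M := A₃ * B)
    (by positivity) (by positivity) hfm (fun x hx => by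
      have h1 := norm_polyFun_mul_log_sub_le hn hP hcoef one_pos (M := 1 + Δ) (by linarith)
        (u := x - x₀) (by rw [mul_one]; exact (hD.norm_sub_le x hx x₀ hx₀).trans (by linarith))
      rw [Real.log_one, RCLike.ofReal_zero, zero_mul, sub_zero, one_pow, mul_one] at h1
      refine h1.trans (le_of_eq ?_)
      rw [hA₃]; ring) (fun c l hl => by
      obtain ⟨Q, hQ, hle⟩ := happ P (A₁ * B) hP hcoef (c - x₀) l hl
      refine ⟨affineSub (-x₀) 1 Q, approxOn_of_norm_le hl
        ((totalDegree_affineSub_le _ _ _).trans hQ) hfm (by positivity) fun x hx => ?_⟩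
      rw [polyFun_affineSub_neg]
      refine hle (x - x₀) fun i => ?_
      have : (x - x₀) i - (c - x₀) i = x i - c i := by simp
      rw [this]
      exact hx i)
  refine ⟨f, hmem.1, hmem.2.trans_lt ?_, fun l hl => ?_⟩
  · rw [ENNReal.ofReal_lt_ofReal_iff (by positivity)]
    have : 0 ≤ A₄ * B := by positivity
    nlinarith
  · refine approxOn_of_norm_le hl (totalDegree_C_mul_le _
      ((totalDegree_affineSub_le _ _ _).trans hP.totalDegree_le)) hfm (by positivity) fun x hx => ?_
    rw [polyFun_mul, polyFun_C, polyFun_affineSub_neg]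
    refine (norm_polyFun_mul_log_sub_le hn hP hcoef hl hd1 (u := x - x₀) ?_).trans ?_
    · refine (norm_sub_le_of_mem_cube hx).trans ?_
      gcongr
      linarith
    · have h1 : I * d ^ (n + 1) * (A₁ * B) = A₄ * B := by rw [hA₄]; ring
      rw [← hI, h1]
      gcongr
      have : 0 ≤ A₂ * A₁ + A₃ * V := by positivity
      linarith

theorem IsBoundedOnZygmund.polynomial_condition (h : IsBoundedOnZygmund n Ω D)
    (P : MvPolynomial (Fin d) 𝕜) (hP : P.totalDegree ≤ n) :
    MemZygmund n D (restrictedCZ Ω D (polyFun P)) := by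
  obtain ⟨K, hK⟩ := h
  have hloc : LocallyIntegrableOn (polyFun P : Euc d → 𝕜) D :=
    (continuous_polyFun P).locallyIntegrable.locallyIntegrableOn D
  refine (hK _ ⟨hloc, ?_⟩).1
  exact (seminorm_le_of_approxOn (N := 0) le_rfl fun c l hl hc =>
    ⟨P, hP, aestronglyMeasurable_cube hloc hc, by simp⟩).trans_lt ENNReal.ofReal_lt_top

theorem exists_approxOn_of_bounded {K : ℝ≥0} {f : Euc d → 𝕜}
    (h : MemZygmund n D (restrictedCZ Ω D f) ∧
      zygmundNorm n D (restrictedCZ Ω D f) ≤ K * zygmundNorm n D f) {M : ℝ} (hM : 0 < M)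
    (hf : zygmundNorm n D f ≤ ENNReal.ofReal M) {c : Euc d} {l : ℝ} (hl : 0 < l)
    (hc : cube c l ⊆ D) : ∃ S, ApproxOn n (restrictedCZ Ω D f) ((K + 1) * M) c l S := by
  have hK := K.coe_nonneg
  refine exists_approxOn_of_seminorm_lt h.1.1 (by positivity) ?_ c l hl hc
  have h1 : zygmundSeminorm n D (restrictedCZ Ω D f) ≤ K * ENNReal.ofReal M :=
    le_self_add.trans (h.2.trans (by gcongr))
  refine h1.trans_lt ?_
  rw [← ENNReal.ofReal_coe_nnreal, ← ENNReal.ofReal_mul hK,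
    ENNReal.ofReal_lt_ofReal_iff (by positivity)]
  linarith

/-- For the test function `f` and `a = log l`, both `T_D f` and `T_D(f - a P)` are approximable on
the cube, the former by boundedness and the latter by `IsCZNumerator.exists_approx_sub`. Their
difference is `a T_D P`. -/
theorem IsCZNumerator.exists_homogeneous_approx (hd : 1 ≤ d) (hn : 1 ≤ n)
    (hΩ : IsCZNumerator (n + 1) Ω) (hD : ConeDomain D κ r Δ) (h : IsBoundedOnZygmund n Ω D) :
    ∃ A : ℝ, 0 ≤ A ∧ ∀ (x₀ : Euc d) (l : ℝ), 0 < l → cube x₀ l ⊆ D →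
      ∀ (P : MvPolynomial (Fin d) 𝕜) (B : ℝ), P.IsHomogeneous n → 0 < B →
        (∀ x ∈ D, ‖polyFun P (x - x₀)‖ ≤ B) →
        ∃ S, ApproxOn n (restrictedCZ Ω D (polyFun (affineSub (-x₀) 1 P)))
          (A * B / max 1 (Real.log (1 / l))) x₀ l S := by
  have hκr : 0 < κ * r := mul_pos hD.κ_pos hD.r_pos
  obtain ⟨K, hK⟩ := h
  have hK0 := K.coe_nonneg
  obtain ⟨A₁, hA₁, htest⟩ := exists_log_test 𝕜 hd hn hD
  obtain ⟨A₂, hA₂, hsub⟩ := hΩ.exists_approx_sub hd hn hD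
  set V : ℝ := (volume D).toReal with hV
  have hV0 : 0 ≤ V := ENNReal.toReal_nonneg
  refine ⟨(K + 1) * (A₁ + 1) + A₂ * A₁ + (K + 1) * (V + 1), by positivity, ?_⟩
  intro x₀ l hl hc P B hP hB hPB
  have hx₀ : x₀ ∈ D := hc (self_mem_cube x₀ hl.le)
  set P' := affineSub (-x₀) 1 P with hP'
  have hP'deg : P'.totalDegree ≤ n := (totalDegree_affineSub_le _ _ _).trans hP.totalDegree_le
  -- If `log(1/l) ≤ 1` there is nothing to gain, and boundedness is applied to the polynomial
  -- itself.
  rcases le_total (Real.log (1 / l)) 1 with hlog | hlog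
  · rw [max_eq_left hlog, div_one]
    have hmem := memZygmund_of_norm_le (n := n) hD (f := polyFun P') (N := 0) (M := B) le_rfl hB.le
      (continuous_polyFun P').measurable
      (fun x hx => by rw [hP', polyFun_affineSub_neg]; exact hPB x hx)
      fun c l hl => ⟨P', approxOn_of_norm_le hl hP'deg (continuous_polyFun P').measurable le_rfl
        fun x _ => by simp⟩
    obtain ⟨S, hS⟩ := exists_approxOn_of_bounded (hK _ hmem.1) (M := (V + 1) * B) (by positivity)
      (hmem.2.trans (ENNReal.ofReal_le_ofReal (by rw [← hV]; linarith))) hl hc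
    refine ⟨S, hS.mono hl ?_⟩
    have : 0 ≤ ((K + 1) * (A₁ + 1) + A₂ * A₁) * B := by positivity
    linarith
  · rw [max_eq_right hlog]
    obtain ⟨f, hfm, hfn, hfa⟩ := htest x₀ hx₀ P B hP hB hPB
    have hG := good_of_norm_lt hfm.1 (by positivity) hfn (κ * r) hκr
    obtain ⟨S₁, hS₁⟩ := exists_approxOn_of_bounded (hK f hfm) (M := (A₁ + 1) * B) (by positivity)
      (hfn.le.trans (ENNReal.ofReal_le_ofReal (by linarith))) hl hc
    obtain ⟨S₂, hS₂⟩ := hsub f (A₁ * B) (by positivity) hG x₀ l _ hl hc (hfa l hl)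
    set a : ℝ := Real.log l with ha
    have ha1 : Real.log (1 / l) = -a := by rw [one_div, Real.log_inv]
    rw [ha1] at hlog ⊢
    have ha0 : (a : 𝕜) ≠ 0 := by
      rw [Ne, RCLike.ofReal_eq_zero]
      intro h0
      rw [h0] at hlog
      linarith
    have hsum := (hS₁.add (hS₂.const_mul (-1)) hl (by positivity) (by positivity)).const_mul
      ((a : 𝕜)⁻¹)
    refine ⟨_, (hsum.mono hl ?_).congr ?_⟩
    · rw [norm_inv, RCLike.norm_ofReal, abs_of_neg (by linarith), norm_neg, norm_one, one_mul,
        inv_mul_eq_div]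
      have : 0 ≤ (K + 1) * (V + 1) * B := by positivity
      gcongr
      linarith
    · refine ae_restrict_of_ae_restrict_of_subset hc ?_
      filter_upwards [hG.pvExists hd hn hΩ hD (by positivity), hΩ.pvExists_polyFun hd hn hD hP'deg,
        ae_restrict_mem hD.isOpen.measurableSet] with y h1 h2 hy
      have e1 := pv_indicator_const_mul h2 (a : 𝕜)
      have e2 := pv_indicator_add h1 (pv_indicator_const_mul e1.1 (-1)).1
      have e3 := e2.2
      rw [(pv_indicator_const_mul e1.1 (-1)).2, e1.2] at e3
      have e4 : (fun x => f x + -1 * ((a : 𝕜) * polyFun P' x)) =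
          fun x => f x - polyFun (C (a : 𝕜) * P') x := by
        funext x
        rw [polyFun_mul, polyFun_C]
        ring
      rw [e4] at e3
      simp only [restrictedCZ, Set.indicator_of_mem hy]
      rw [e3]
      field_simp
      ring

theorem IsCZNumerator.homogeneous_condition (hd : 1 ≤ d) (hn : 1 ≤ n)
    (hΩ : IsCZNumerator (n + 1) Ω) (hD : ConeDomain D κ r Δ) (h : IsBoundedOnZygmund n Ω D) :
    ∃ C : ℝ≥0, ∀ (x₀ : EuclideanSpace ℝ (Fin d)) (l : ℝ), 0 < l → cube x₀ l ⊆ D →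
      ∀ P : MvPolynomial (Fin d) 𝕜, P.IsHomogeneous n →
        ∃ S : MvPolynomial (Fin d) 𝕜, S.totalDegree ≤ n ∧
          (⨍⁻ x in cube x₀ l,
              ‖restrictedCZ Ω D (fun z => polyFun P (z - x₀)) x - polyFun S x‖ₑ ∂volume) ≤
            C * eLpNorm (fun z => polyFun P (z - x₀)) ⊤ (volume.restrict D) *
              ENNReal.ofReal (l ^ n / max 1 (Real.log (1 / l))) := by
  obtain ⟨A, hA, happ⟩ := hΩ.exists_homogeneous_approx hd hn hD h
  obtain ⟨A', hA', hcf⟩ := exists_coeff_bound_of_domain 𝕜 n hD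
  refine ⟨A.toNNReal, fun x₀ l hl hc P hP => ?_⟩
  have hx₀ : x₀ ∈ D := hc (self_mem_cube x₀ hl.le)
  have hcont : Continuous fun z : Euc d => polyFun P (z - x₀) :=
    (continuous_polyFun P).comp (continuous_id.sub continuous_const)
  set E := eLpNorm (fun z => polyFun P (z - x₀)) ⊤ (volume.restrict D) with hE
  have hEfin : E ≠ ∞ := by
    obtain ⟨M, hM⟩ := hD.isBounded.isCompact_closure.exists_bound_of_continuousOn hcont.continuousOn
    rw [hE, eLpNorm_exponent_top]
    refine ((eLpNormEssSup_le_of_ae_bound (C := M) ?_).trans_lt ENNReal.ofReal_lt_top).ne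
    filter_upwards [ae_restrict_mem hD.isOpen.measurableSet] with z hz
    exact hM z (subset_closure hz)
  set B := E.toReal with hB
  have hB0 : 0 ≤ B := ENNReal.toReal_nonneg
  have hEB : E = ENNReal.ofReal B := (ENNReal.ofReal_toReal hEfin).symm
  have hPB := norm_le_of_eLpNorm_top hD.isOpen hcont hEB.le hB0
  set m := max 1 (Real.log (1 / l)) with hm
  have hm1 : 1 ≤ m := le_max_left _ _
  -- If the supremum over `D` vanishes then so do all coefficients. Otherwise the supremum is
  -- positive, as the test function requires.
  rcases hB0.eq_or_lt with hz | hpos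
  · refine ⟨0, by simp, le_of_eq_of_le ?_ zero_le⟩
    have hP0 : P = 0 := by
      ext s
      have := hcf x₀ hx₀ P B hP.totalDegree_le hB0 hPB s
      rw [← hz, mul_zero] at this
      rw [norm_le_zero_iff.1 this, coeff_zero]
    have h0 : ∀ x, restrictedCZ Ω D (fun z : Euc d => polyFun P (z - x₀)) x = 0 := by
      intro x
      have : (D.indicator fun z : Euc d => polyFun P (z - x₀)) = fun _ => 0 := by
        funext z
        simp [hP0]
      rw [restrictedCZ, this]
      by_cases hx : x ∈ D
      · rw [Set.indicator_of_mem hx, czOp_zero.2]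
      · rw [Set.indicator_of_notMem hx]
    simp [h0]
  · obtain ⟨S, hS⟩ := happ x₀ l hl hc P B hP hpos hPB
    refine ⟨S, hS.deg, ?_⟩
    have hfun : (polyFun (affineSub (-x₀) 1 P) : Euc d → 𝕜) = fun x => polyFun P (x - x₀) := by
      funext x
      exact polyFun_affineSub_neg x₀ x P
    have hle := hS.le
    rw [hfun, ← laverage_cube_le_iff hl (by positivity)] at hle
    refine hle.trans (le_of_eq ?_)
    rw [hEB, ← ENNReal.ofReal_coe_nnreal, Real.coe_toNNReal A hA, ← ENNReal.ofReal_mul hA,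
      ← ENNReal.ofReal_mul (by positivity)]
    congr 1
    ring

end TestFunctions

end ZygmundTP

end

/-! ### The equivalence. -/

open ZygmundTP in
theorem corollary3 {𝕜 : Type*} [RCLike 𝕜] {d n : ℕ} (hd : 1 ≤ d) (hn : 1 ≤ n)
    (D : Set (EuclideanSpace ℝ (Fin d))) (hD : IsBoundedLipschitzDomain D)
    (Ω : EuclideanSpace ℝ (Fin d) → 𝕜) (hΩ : IsCZNumerator (n + 1) Ω) :
    -- `T_D f` is well defined on `Z_n(D)`
    (∀ f : EuclideanSpace ℝ (Fin d) → 𝕜, MemZygmund n D f →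
      ∀ᵐ y ∂volume.restrict D, PVExists Ω (D.indicator f) y) ∧
    (IsBoundedOnZygmund n Ω D ↔
      (∀ P : MvPolynomial (Fin d) 𝕜, P.totalDegree ≤ n →
        MemZygmund n D (restrictedCZ Ω D (polyFun P))) ∧
      (∃ C : ℝ≥0, ∀ (x₀ : EuclideanSpace ℝ (Fin d)) (l : ℝ), 0 < l → cube x₀ l ⊆ D →
        ∀ P : MvPolynomial (Fin d) 𝕜, P.IsHomogeneous n →
          ∃ S : MvPolynomial (Fin d) 𝕜, S.totalDegree ≤ n ∧
            (⨍⁻ x in cube x₀ l,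
                ‖restrictedCZ Ω D (fun z => polyFun P (z - x₀)) x - polyFun S x‖ₑ ∂volume) ≤
              C * eLpNorm (fun z => polyFun P (z - x₀)) ⊤ (volume.restrict D) *
                ENNReal.ofReal (l ^ n / max 1 (Real.log (1 / l))))) := by
  obtain ⟨κ, r, Δ, hcone⟩ := exists_coneDomain hd hD
  refine ⟨fun f hf => ?_, fun h => ⟨h.polynomial_condition,
    hΩ.homogeneous_condition hd hn hcone h⟩, fun h => hΩ.bounded_of_conditions hd hn hcone h.1 h.2⟩
  obtain ⟨N, hN, hG⟩ := exists_good_of_memZygmund hcone.isBounded hf (κ * r)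
    (mul_pos hcone.κ_pos hcone.r_pos)
  exact hG.pvExists hd hn hΩ hcone hN
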